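/- **Notation.** Repeated indices are summed. Let $\mathrm{Fun}$ be one of the two algebras of functions on $\mathbb C^5$: (a) all entire holomorphic functions, (b) the polynomials $\mathbb C[w^1,\dots,w^5]$. Let $\mathfrak g_{\rm het}$ be the Lie algebra with underlying space $$\mathrm{Vect}^{\rm div}(\mathbb C^5)\oplus \Omega^1(\mathbb C^5)/\mathrm{Im}\,\partial\oplus \mathrm{Fun}(\mathbb C^5)\otimes\mathfrak{so}(32)$$ (divergence-free vector fields; one-forms modulo exact ones; skew-symmetric $32\times 32$ matrices of functions, all with coefficients in $\mathrm{Fun}$) and with bracket, for $X=X^i\partial_i$, $Y=Y^j\partial_j$, $$[X,Y]=[X,Y]_{\rm Vect}+2\,[\partial_jX^i\,\partial(\partial_iY^j)],\quad [X,\omega]=L_X\omega,\quad [X,\alpha]=X\cdot\alpha,\quad [\alpha,\alpha']=(\alpha\alpha'-\alpha'\alpha)+[\mathrm{tr}(\alpha\,\partial\alpha')],$$ the brackets $[\omega,\omega']$ and $[\omega,\alpha]$ being zero. **The theory.** Take $\Omega=dz^1\cdots dz^5$ on $\mathbb C^5$. The fields of type I Kodaira–Spencer theory coupled to $\mathfrak{so}(32)$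 holomorphic Chern–Simons theory are smooth Dolbeault forms of type $(0,\bullet)$ with values as follows: $\mu=\mu^i\partial_i\in\mathrm{PV}^{1,\bullet}$ with $\partial_\Omega\mu=0$; $\eta\in \mathrm{PV}^{3,\bullet}$ with $\partial_\Omega\eta=0$, equivalently the $\partial$-closed form $\omega=\eta\vee\Omega\in\Omega^{2,\bullet}$; and $A\in\Omega^{0,\bullet}\otimes\mathfrak{so}(32)$. Let $\mathcal L$ be the $\mathbb Z/2$-graded vector space of these fields with parity shifted, so that a $(0,q)$-form has parity $q$. Consider the action with quadratic part $\int\big(\langle\eta,\partial^{-1}\bar\partial\mu\rangle+\tfrac12\mathrm{tr}(A\bar\partial A)\big)$ and cubic part $$S^{(3)}=\int\Big(\tfrac12\langle\eta,\mu\wedge\mu\rangle+\tfrac16\mathrm{tr}(A[A,A])+\tfrac12\mu^i\,\mathrm{tr}(A\partial_iA)+\tfrac13\,\mu^k\,\partial_i\mu^j\,\partial_k\partial_j\mu^i\Big),$$ where $\mathrm{tr}$ is the trace in the vector representation and $\langle\eta,\mu\wedge\mu\rangle=\omega_{ij}\mu^i\mu^j$. The last term is the one required for one-loop anomaly cancellation.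 **Theorem.** There is a unique bilinear bracket $l_2$ on $\mathcal L$ given by the BV anti-bracket with $S^{(3)}$: for all compactly supported variations $\delta\mu=\partial_\Omega b$, $\delta\omega=\partial\gamma$, $\delta A=a$, the first variation of $S^{(3)}$ is the odd symplectic pairing $\int\big(\tfrac12b^{ij}(\cdot)_{ij}+\gamma_i(\cdot)^i+\mathrm{tr}(a\,\cdot)\big)$ with $\tfrac12l_2(\Phi,\Phi)$ (here $(\partial_\Omega b)^i=\partial_jb^{ij}$, and the identity is polarized in the superfield $\Phi$). With the linear BRST operator $l_1=\bar\partial$, the triple $(\mathcal L,\bar\partial,l_2)$ is a $\mathbb Z/2$-graded dg Lie algebra: it is the $L_\infty$ algebra of global gauge transformations (for the action up to cubic order, which is all that enters the Lie bracket on cohomology). Its $\bar\partial$-cohomology is concentrated in even degree, and with the induced bracket it is a Lie algebra isomorphic to $\mathfrak g_{\rm het}$ with $\mathrm{Fun}$ the entire functions. The fields with coefficients polynomial in $z^i,\bar z^i$ form a sub-dg Lie algebra, whose cohomology is likewise concentrated in even degree and is isomorphic to $\mathfrak g_{\rm het}$ with $\mathrm{Fun}$ the polynomials. -/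

import Mathlib

namespace TypeOneHet

open scoped ContDiff TensorProduct
open MeasureTheory

set_option linter.unusedSectionVars false

/-! ### The heterotic Lie algebra -/

/-- An algebra of functions on `ℂ⁵` with its five commuting partial derivatives. -/
class PartialDerivatives (F : Type) [CommRing F] [Algebra ℂ F] where
  /-- the partial derivative `∂/∂wⁱ` -/
  pd : Fin 5 → Derivation ℂ F F
  pd_comm : ∀ (i j : Fin 5) (f : F), pd i (pd j f) = pd j (pd i f)

section Het

variable (F : Type) [CommRing F] [Algebra ℂ F] [PartialDerivatives F]

open PartialDerivatives

/-- The divergence `∑ ∂_i Xⁱ` of a vector field `X = Xⁱ ∂_i`. -/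
def divergence : (Fin 5 → F) →ₗ[ℂ] F :=
  ∑ i, (pd (F := F) i).toLinearMap ∘ₗ LinearMap.proj i

/-- The differential `∂f = ∂_k f dwᵏ`. -/
def gradient : F →ₗ[ℂ] (Fin 5 → F) :=
  LinearMap.pi fun k => (pd (F := F) k).toLinearMap

/-- Divergence-free vector fields. -/
def VectDiv : Submodule ℂ (Fin 5 → F) := LinearMap.ker (divergence F)

/-- Exact one-forms. -/
def ExactForms : Submodule ℂ (Fin 5 → F) := LinearMap.range (gradient F)

/-- `Fun ⊗ so(32)`: skew-symmetric `32 × 32` matrices of functions. -/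
def SkewMat (B : Type) [Ring B] [Algebra ℂ B] : Submodule ℂ (Matrix (Fin 32) (Fin 32) B) where
  carrier := {A | A.transpose = -A}
  add_mem' := by
    intro a b ha hb
    simp only [Set.mem_ofPred_eq] at *
    rw [Matrix.transpose_add, ha, hb]; abel
  zero_mem' := by simp
  smul_mem' := by
    intro c a ha
    simp only [Set.mem_ofPred_eq] at *
    rw [Matrix.transpose_smul, ha, smul_neg]

variable {F}

/-- The derivation `f ↦ Xⁱ ∂_i f`. -/
def vecDer (X : Fin 5 → F) : Derivation ℂ F F := ∑ l, X l • pd (F := F) l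

/-- The commutator of vector fields `Xⁱ (∂_i Yʲ) ∂_j - Yʲ (∂_j Xⁱ) ∂_i`. -/
def vecBracket (X Y : Fin 5 → F) : Fin 5 → F := fun j => vecDer X (Y j) - vecDer Y (X j)

/-- The Lie derivative `L_X ω` of the one-form `ω = ω_k dwᵏ`. -/
def lieDer (X : Fin 5 → F) (w : Fin 5 → F) : Fin 5 → F :=
  fun k => vecDer X (w k) + ∑ l, pd k (X l) * w l

/-- The one-form `∂_j Xⁱ ∂(∂_i Yʲ) = ∂_j Xⁱ ∂_k ∂_i Yʲ dwᵏ`. -/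
def vecCocycle (X Y : Fin 5 → F) : Fin 5 → F :=
  fun k => ∑ i, ∑ j, pd j (X i) * pd k (pd i (Y j))

/-- The one-form `tr (α ∂ β)`. -/
def trCocycle (a b : Matrix (Fin 32) (Fin 32) F) : Fin 5 → F :=
  fun k => (a * b.map (pd k)).trace

theorem vecDer_apply (X : Fin 5 → F) (f : F) : vecDer X f = ∑ l, X l * pd l f := by
  have h : ∀ s : Finset (Fin 5), (∑ l ∈ s, X l • pd (F := F) l) f = ∑ l ∈ s, X l * pd l f := by
    intro s
    induction s using Finset.induction_on with
    | empty => simp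
    | insert a s ha ih => rw [Finset.sum_insert ha, Finset.sum_insert ha, ← ih]; simp
  exact h Finset.univ

theorem mem_vectDiv (X : Fin 5 → F) : X ∈ VectDiv F ↔ ∑ i, pd i (X i) = 0 := by
  simp [VectDiv, divergence, LinearMap.sum_apply]

theorem pd_vecDer (k : Fin 5) (X : Fin 5 → F) (f : F) :
    pd k (vecDer X f) = vecDer X (pd k f) + ∑ l, pd k (X l) * pd l f := by
  simp only [vecDer_apply, map_sum, Derivation.leibniz, smul_eq_mul]
  rw [← Finset.sum_add_distrib]
  refine Finset.sum_congr rfl fun l _ => ?_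
  rw [pd_comm k l f]; ring

theorem vecDer_vecBracket (X Y : Fin 5 → F) (f : F) :
    vecDer (vecBracket X Y) f = vecDer X (vecDer Y f) - vecDer Y (vecDer X f) := by
  have h : ∀ U V : Fin 5 → F, vecDer U (vecDer V f)
      = (∑ l, vecDer U (V l) * pd l f) + ∑ l, ∑ m, V l * (U m * pd m (pd l f)) := by
    intro U V
    rw [vecDer_apply V f, map_sum, ← Finset.sum_add_distrib]
    refine Finset.sum_congr rfl fun l _ => ?_
    rw [Derivation.leibniz, smul_eq_mul, smul_eq_mul, vecDer_apply U (pd l f), Finset.mul_sum]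
    ring
  rw [h X Y, h Y X, vecDer_apply]
  have h2 : (∑ l, ∑ m, Y l * (X m * pd m (pd l f))) = ∑ l, ∑ m, X l * (Y m * pd m (pd l f)) := by
    rw [Finset.sum_comm]
    refine Finset.sum_congr rfl fun l _ => Finset.sum_congr rfl fun m _ => ?_
    rw [pd_comm m l]; ring
  rw [h2, add_sub_add_right_eq_sub, ← Finset.sum_sub_distrib]
  refine Finset.sum_congr rfl fun l _ => ?_
  simp only [vecBracket]; ring

theorem vecBracket_mem {X Y : Fin 5 → F} (hX : X ∈ VectDiv F) (hY : Y ∈ VectDiv F) :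
    vecBracket X Y ∈ VectDiv F := by
  rw [mem_vectDiv] at *
  simp only [vecBracket, map_sub, pd_vecDer, Finset.sum_sub_distrib, Finset.sum_add_distrib]
  rw [← map_sum, ← map_sum, hX, hY, map_zero, map_zero, zero_add, zero_add, sub_eq_zero,
    Finset.sum_comm]
  refine Finset.sum_congr rfl fun l _ => Finset.sum_congr rfl fun m _ => ?_
  ring

theorem lieDer_gradient (X : Fin 5 → F) (f : F) :
    lieDer X (gradient F f) = gradient F (vecDer X f) := by
  funext k
  simp [lieDer, gradient, pd_vecDer]

theorem lieDer_add_left (X Y w : Fin 5 → F) : lieDer (X + Y) w = lieDer X w + lieDer Y w := by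
  funext k
  simp only [lieDer, vecDer_apply, Pi.add_apply, map_add, add_mul, Finset.sum_add_distrib]
  ring

theorem vecDer_smul (c : ℂ) (X : Fin 5 → F) (f : F) : vecDer (c • X) f = c • vecDer X f := by
  simp [vecDer_apply, Finset.smul_sum]

theorem vecDer_add (X Y : Fin 5 → F) (f : F) :
    vecDer (X + Y) f = vecDer X f + vecDer Y f := by
  simp [vecDer_apply, add_mul, Finset.sum_add_distrib]

/-- The Lie derivative on one-forms modulo exact ones. -/
def lieDerQ (X : Fin 5 → F) :
    ((Fin 5 → F) ⧸ ExactForms F) →ₗ[ℂ] ((Fin 5 → F) ⧸ ExactForms F) :=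
  (ExactForms F).mapQ (ExactForms F)
    { toFun := lieDer X
      map_add' := by
        intro v w; funext k
        simp only [lieDer, Pi.add_apply, map_add, mul_add, Finset.sum_add_distrib]; ring
      map_smul' := by
        intro c v; funext k
        simp [lieDer, Finset.smul_sum] }
    (by
      rintro _ ⟨f, rfl⟩
      exact ⟨vecDer X f, (lieDer_gradient X f).symm⟩)

theorem lieDerQ_mk (X w : Fin 5 → F) :
    lieDerQ X ((ExactForms F).mkQ w) = (ExactForms F).mkQ (lieDer X w) := rfl

theorem commutator_mem {a b : Matrix (Fin 32) (Fin 32) F} (ha : a ∈ SkewMat F)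
    (hb : b ∈ SkewMat F) : a * b - b * a ∈ SkewMat F := by
  have ha' : a.transpose = -a := ha
  have hb' : b.transpose = -b := hb
  change (a * b - b * a).transpose = -(a * b - b * a)
  rw [Matrix.transpose_sub, Matrix.transpose_mul, Matrix.transpose_mul, ha', hb']
  simp

theorem map_mem_skew (D : Derivation ℂ F F) {a : Matrix (Fin 32) (Fin 32) F}
    (ha : a ∈ SkewMat F) : a.map D ∈ SkewMat F := by
  have ha' : a.transpose = -a := ha
  change (a.map D).transpose = -(a.map D)
  rw [← Matrix.transpose_map, ha']
  ext i j; simp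

variable (F)

/-- The vector space
`Vect^div(ℂ⁵) ⊕ Ω¹(ℂ⁵)/Im ∂ ⊕ Fun(ℂ⁵) ⊗ so(32)` underlying the heterotic Lie algebra. -/
def GHet : Type := VectDiv F × ((Fin 5 → F) ⧸ ExactForms F) × SkewMat F

variable {F}

/-- The divergence-free vector field of an element of the heterotic Lie algebra. -/
def GHet.vec (x : GHet F) : Fin 5 → F := x.1.1

/-- The one-form class of an element of the heterotic Lie algebra. -/
def GHet.form (x : GHet F) : (Fin 5 → F) ⧸ ExactForms F := x.2.1

/-- The matrix of functions of an element of the heterotic Lie algebra. -/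
def GHet.mat (x : GHet F) : Matrix (Fin 32) (Fin 32) F := x.2.2.1

theorem GHet.vec_mem (x : GHet F) : x.vec ∈ VectDiv F := x.1.2

theorem GHet.mat_mem (x : GHet F) : x.mat ∈ SkewMat F := x.2.2.2

variable (F)

noncomputable instance : AddCommGroup (GHet F) :=
  inferInstanceAs (AddCommGroup (VectDiv F × ((Fin 5 → F) ⧸ ExactForms F) × SkewMat F))

noncomputable instance : Module ℂ (GHet F) :=
  inferInstanceAs (Module ℂ (VectDiv F × ((Fin 5 → F) ⧸ ExactForms F) × SkewMat F))

/-- The bracket of the heterotic Lie algebra: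
`[X, Y] = [X, Y]_Vect + 2 [∂_j Xⁱ ∂ ∂_i Yʲ]`, `[X, ω] = L_X ω`, `[X, α] = X · α`,
`[α, β] = (αβ - βα) + [tr (α ∂ β)]`. -/
noncomputable instance : Bracket (GHet F) (GHet F) where
  bracket x y :=
    (⟨vecBracket x.vec y.vec, vecBracket_mem x.vec_mem y.vec_mem⟩,
     lieDerQ x.vec y.form - lieDerQ y.vec x.form
        + (ExactForms F).mkQ ((2 : ℂ) • vecCocycle x.vec y.vec + trCocycle x.mat y.mat),
     ⟨y.mat.map (vecDer x.vec) - x.mat.map (vecDer y.vec)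
        + (x.mat * y.mat - y.mat * x.mat),
      add_mem (sub_mem (map_mem_skew _ y.mat_mem) (map_mem_skew _ x.mat_mem))
        (commutator_mem x.mat_mem y.mat_mem)⟩)

variable {F}

theorem mkQ_eq_of_gradient {v w : Fin 5 → F} (f : F) (h : v - w = gradient F f) :
    (ExactForms F).mkQ v = (ExactForms F).mkQ w := by
  rw [← sub_eq_zero, ← map_sub, h]
  exact (Submodule.Quotient.mk_eq_zero _).2 ⟨f, rfl⟩

section MatrixCalculus

variable {n : Type} [Fintype n]

theorem map_der_mul (D : Derivation ℂ F F) (A B : Matrix n n F) :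
    (A * B).map D = A.map D * B + A * B.map D := by
  ext i j
  simp only [Matrix.map_apply, Matrix.mul_apply, Matrix.add_apply, map_sum, Derivation.leibniz,
    smul_eq_mul, ← Finset.sum_add_distrib]
  refine Finset.sum_congr rfl fun k _ => ?_
  ring

theorem der_trace (D : Derivation ℂ F F) (A : Matrix n n F) :
    D A.trace = (A.map D).trace := by
  simp [Matrix.trace, map_sum]

theorem map_der_add (D : Derivation ℂ F F) (A B : Matrix n n F) :
    (A + B).map D = A.map D + B.map D := by ext; simp

theorem map_der_sub (D : Derivation ℂ F F) (A B : Matrix n n F) :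
    (A - B).map D = A.map D - B.map D := by ext; simp

theorem map_der_smul (D : Derivation ℂ F F) (c : ℂ) (A : Matrix n n F) :
    (c • A).map D = c • A.map D := by ext; simp

end MatrixCalculus

/-- The Jacobian matrix `(∂_j Xⁱ)`. -/
def jac (X : Fin 5 → F) : Matrix (Fin 5) (Fin 5) F := Matrix.of fun i j => pd j (X i)

theorem vecCocycle_eq (X Y : Fin 5 → F) (k : Fin 5) :
    vecCocycle X Y k = (jac X * (jac Y).map (pd k)).trace := by
  simp [vecCocycle, Matrix.trace, Matrix.mul_apply, jac]

theorem jac_vecBracket (X Y : Fin 5 → F) :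
    jac (vecBracket X Y) = (jac Y).map (vecDer X) - (jac X).map (vecDer Y)
      - (jac X * jac Y - jac Y * jac X) := by
  ext i j
  simp only [jac, vecBracket, Matrix.of_apply, map_sub, pd_vecDer, Matrix.sub_apply,
    Matrix.map_apply, Matrix.mul_apply]
  have h : ∀ U V : Fin 5 → F, (∑ l, pd j (U l) * pd l (V i)) = ∑ l, pd l (V i) * pd j (U l) :=
    fun U V => Finset.sum_congr rfl fun l _ => mul_comm _ _
  rw [h X Y, h Y X]; ring

theorem map_pd_vecDer (k : Fin 5) (X : Fin 5 → F) {n : Type} (A : Matrix n n F) :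
    (A.map (vecDer X)).map (pd k)
      = (A.map (pd k)).map (vecDer X) + ∑ l, pd k (X l) • A.map (pd l) := by
  ext i j
  simp [pd_vecDer, Matrix.sum_apply]

theorem lieDer_trace {n : Type} [Fintype n] (X : Fin 5 → F) (A B : Matrix n n F) :
    lieDer X (fun k => (A * B.map (pd k)).trace)
      = fun k => (A.map (vecDer X) * B.map (pd k)).trace
          + (A * (B.map (vecDer X)).map (pd k)).trace := by
  funext k
  simp only [lieDer]
  rw [der_trace, map_der_mul, map_pd_vecDer, Matrix.trace_add, Matrix.mul_add, Matrix.trace_add,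
    Matrix.mul_sum, Matrix.trace_sum]
  simp only [Matrix.mul_smul, Matrix.trace_smul, smul_eq_mul]
  ring

theorem trace_pd_exact {n : Type} [Fintype n] (A B : Matrix n n F) (k : Fin 5) :
    (A * B.map (pd k)).trace = pd k (A * B).trace - (B * A.map (pd k)).trace := by
  rw [der_trace, map_der_mul, Matrix.trace_add, Matrix.trace_mul_comm (A.map (pd k)) B]; ring

theorem lieDer_vecBracket (X Y w : Fin 5 → F) :
    lieDer (vecBracket X Y) w = lieDer X (lieDer Y w) - lieDer Y (lieDer X w) := by
  have key : ∀ U V : Fin 5 → F, ∀ k, lieDer U (lieDer V w) k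
      = vecDer U (vecDer V (w k)) + ((∑ l, vecDer U (pd k (V l)) * w l)
        + (∑ l, pd k (V l) * vecDer U (w l)) + ∑ l, pd k (U l) * vecDer V (w l))
        + ∑ l, ∑ m, pd k (U l) * (pd l (V m) * w m) := by
    intro U V k
    simp only [lieDer, map_add, map_sum, Derivation.leibniz, smul_eq_mul, mul_add,
      Finset.sum_add_distrib, Finset.mul_sum]
    have : (∑ l, w l * vecDer U (pd k (V l))) = ∑ l, vecDer U (pd k (V l)) * w l :=
      Finset.sum_congr rfl fun l _ => mul_comm _ _
    rw [this]; ring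
  funext k
  rw [Pi.sub_apply, key X Y, key Y X]
  simp only [lieDer, vecDer_vecBracket]
  have e : ∀ l, pd k (vecBracket X Y l) * w l
      = (vecDer X (pd k (Y l)) * w l - vecDer Y (pd k (X l)) * w l)
        + ((∑ m, pd k (X m) * (pd m (Y l) * w l)) - ∑ m, pd k (Y m) * (pd m (X l) * w l)) := by
    intro l
    simp only [vecBracket, map_sub, pd_vecDer, sub_mul, add_mul, Finset.sum_mul, mul_assoc]
    ring
  simp only [e, Finset.sum_add_distrib, Finset.sum_sub_distrib]
  rw [Finset.sum_comm (f := fun l m => pd k (X m) * (pd m (Y l) * w l)),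
    Finset.sum_comm (f := fun l m => pd k (Y m) * (pd m (X l) * w l))]
  ring

/-- The cocycle identity for `∂_j Xⁱ ∂ ∂_i Yʲ`, modulo exact one-forms. -/
theorem vecCocycle_cocycle (X Y Z : Fin 5 → F) :
    (ExactForms F).mkQ (lieDer X (vecCocycle Y Z) + vecCocycle X (vecBracket Y Z))
      = (ExactForms F).mkQ (-lieDer Z (vecCocycle X Y) + vecCocycle (vecBracket X Y) Z
          + lieDer Y (vecCocycle X Z) + vecCocycle Y (vecBracket X Z)) := by
  have hc : ∀ U V : Fin 5 → F,
      vecCocycle U V = fun k => (jac U * (jac V).map (pd k)).trace :=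
    fun U V => funext fun k => vecCocycle_eq U V k
  apply mkQ_eq_of_gradient
    ((jac Y * (jac X).map (vecDer Z)).trace + (jac Y * (jac X * jac Z - jac Z * jac X)).trace)
  funext k
  simp only [hc, lieDer_trace, jac_vecBracket, gradient, LinearMap.pi_apply, Pi.sub_apply,
    Pi.add_apply, Pi.neg_apply, Derivation.coeFn_coe, map_add, map_sub, der_trace, map_der_sub, map_der_mul,
    Matrix.mul_add, Matrix.add_mul, Matrix.mul_sub, Matrix.sub_mul, ← Matrix.mul_assoc, Matrix.trace_add,
    Matrix.trace_sub]
  generalize jac X = A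
  generalize jac Y = B
  generalize jac Z = C
  generalize C.map (vecDer X) = CX
  have e1 : (A * B.map (pd k) * C).trace = (B.map (pd k) * C * A).trace := by
    rw [Matrix.mul_assoc, Matrix.trace_mul_comm]
  have e2 : (A * C.map (pd k) * B).trace = (B * A * C.map (pd k)).trace := by
    rw [Matrix.trace_mul_comm, Matrix.mul_assoc]
  have e3 : (A * C * B.map (pd k)).trace = (B.map (pd k) * A * C).trace := by
    rw [Matrix.trace_mul_comm, Matrix.mul_assoc]
  have e4 : (A.map (vecDer Z) * B.map (pd k)).trace = (B.map (pd k) * A.map (vecDer Z)).trace :=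
    Matrix.trace_mul_comm _ _
  rw [e1, e2, e3, e4]
  ring

theorem trCocycle_cocycle (a b c : Matrix (Fin 32) (Fin 32) F) :
    (ExactForms F).mkQ (trCocycle a (b * c - c * b))
      = (ExactForms F).mkQ (trCocycle (a * b - b * a) c + trCocycle b (a * c - c * a)) := by
  apply mkQ_eq_of_gradient ((a * b * c).trace - (b * a * c).trace)
  funext k
  simp only [trCocycle, gradient, LinearMap.pi_apply, Pi.sub_apply,
    Pi.add_apply, Derivation.coeFn_coe, map_sub, der_trace, map_der_sub,
    map_der_mul, Matrix.mul_add, Matrix.add_mul, Matrix.mul_sub, Matrix.sub_mul,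
    ← Matrix.mul_assoc, Matrix.trace_add, Matrix.trace_sub]
  generalize a.map (pd k) = a1
  generalize b.map (pd k) = b1
  generalize c.map (pd k) = c1
  have cyc : ∀ x y z : Matrix (Fin 32) (Fin 32) F, (x * y * z).trace = (y * z * x).trace :=
    fun x y z => by rw [Matrix.mul_assoc, Matrix.trace_mul_comm]
  rw [cyc a b1 c, cyc b1 c a, cyc a c1 b, cyc c1 b a, cyc a c b1, cyc c b1 a, cyc b a1 c, cyc a1 c b,
    cyc b c1 a, cyc c1 a b, cyc b1 a c, cyc a1 b c]
  ring

theorem trCocycle_add_left (a b c : Matrix (Fin 32) (Fin 32) F) :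
    trCocycle (a + b) c = trCocycle a c + trCocycle b c := by
  funext k
  simp only [trCocycle, Matrix.add_mul, Matrix.trace_add, Pi.add_apply]

theorem trCocycle_add_right (a b c : Matrix (Fin 32) (Fin 32) F) :
    trCocycle a (b + c) = trCocycle a b + trCocycle a c := by
  funext k
  simp only [trCocycle, map_der_add, Matrix.mul_add, Matrix.trace_add, Pi.add_apply]

theorem trCocycle_sub_left (a b c : Matrix (Fin 32) (Fin 32) F) :
    trCocycle (a - b) c = trCocycle a c - trCocycle b c := by
  funext k
  simp only [trCocycle, Matrix.sub_mul, Matrix.trace_sub, Pi.sub_apply]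

theorem trCocycle_sub_right (a b c : Matrix (Fin 32) (Fin 32) F) :
    trCocycle a (b - c) = trCocycle a b - trCocycle a c := by
  funext k
  simp only [trCocycle, map_der_sub, Matrix.mul_sub, Matrix.trace_sub, Pi.sub_apply]

theorem trCocycle_symm (a b : Matrix (Fin 32) (Fin 32) F) :
    (ExactForms F).mkQ (trCocycle a b) = -(ExactForms F).mkQ (trCocycle b a) := by
  rw [← map_neg]
  apply mkQ_eq_of_gradient (a * b).trace
  funext k
  have h := trace_pd_exact a b k
  simp only [trCocycle, gradient, LinearMap.pi_apply, Pi.sub_apply, Pi.neg_apply,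
    Derivation.coeFn_coe, h]
  ring

theorem lieDer_trCocycle (X : Fin 5 → F) (a b : Matrix (Fin 32) (Fin 32) F) :
    lieDer X (trCocycle a b)
      = trCocycle (a.map (vecDer X)) b + trCocycle a (b.map (vecDer X)) :=
  lieDer_trace X a b

theorem vecCocycle_symm (X Y : Fin 5 → F) :
    (ExactForms F).mkQ (vecCocycle X Y) = -(ExactForms F).mkQ (vecCocycle Y X) := by
  rw [← map_neg]
  apply mkQ_eq_of_gradient (jac X * jac Y).trace
  funext k
  have h := trace_pd_exact (jac X) (jac Y) k
  simp only [vecCocycle_eq, gradient, LinearMap.pi_apply, Pi.sub_apply, Pi.neg_apply,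
    Derivation.coeFn_coe, h]
  ring

theorem vecCocycle_add_left (X Y Z : Fin 5 → F) :
    vecCocycle (X + Y) Z = vecCocycle X Z + vecCocycle Y Z := by
  funext k
  simp [vecCocycle, add_mul, Finset.sum_add_distrib]

theorem vecCocycle_smul_right (c : ℂ) (X Y : Fin 5 → F) :
    vecCocycle X (c • Y) = c • vecCocycle X Y := by
  funext k
  simp [vecCocycle, Finset.smul_sum]

theorem trCocycle_smul_right (c : ℂ) (a b : Matrix (Fin 32) (Fin 32) F) :
    trCocycle a (c • b) = c • trCocycle a b := by
  funext k
  simp [trCocycle, map_der_smul]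

theorem lieDerQ_add_left (X Y : Fin 5 → F) (q : (Fin 5 → F) ⧸ ExactForms F) :
    lieDerQ (X + Y) q = lieDerQ X q + lieDerQ Y q := by
  obtain ⟨w, rfl⟩ := (ExactForms F).mkQ_surjective q
  simp only [lieDerQ_mk, lieDer_add_left, map_add]

theorem lieDerQ_smul_left (c : ℂ) (X : Fin 5 → F) (q : (Fin 5 → F) ⧸ ExactForms F) :
    lieDerQ (c • X) q = c • lieDerQ X q := by
  obtain ⟨w, rfl⟩ := (ExactForms F).mkQ_surjective q
  rw [lieDerQ_mk, lieDerQ_mk, ← map_smul]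
  congr 1
  funext k
  simp [lieDer, vecDer_smul, Finset.smul_sum]

theorem lieDerQ_vecBracket (X Y : Fin 5 → F) (q : (Fin 5 → F) ⧸ ExactForms F) :
    lieDerQ (vecBracket X Y) q = lieDerQ X (lieDerQ Y q) - lieDerQ Y (lieDerQ X q) := by
  obtain ⟨w, rfl⟩ := (ExactForms F).mkQ_surjective q
  simp only [lieDerQ_mk, lieDer_vecBracket, map_sub]

theorem ghet_ext {x y : GHet F} (h1 : x.vec = y.vec) (h2 : x.form = y.form)
    (h3 : x.mat = y.mat) : x = y :=
  Prod.ext (Subtype.ext h1) (Prod.ext h2 (Subtype.ext h3))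

theorem lie_vec (x y : GHet F) : (⁅x, y⁆ : GHet F).vec = vecBracket x.vec y.vec := rfl

theorem lie_form (x y : GHet F) : (⁅x, y⁆ : GHet F).form
    = lieDerQ x.vec y.form - lieDerQ y.vec x.form
        + (ExactForms F).mkQ ((2 : ℂ) • vecCocycle x.vec y.vec + trCocycle x.mat y.mat) := rfl

theorem lie_mat (x y : GHet F) : (⁅x, y⁆ : GHet F).mat
    = y.mat.map (vecDer x.vec) - x.mat.map (vecDer y.vec)
        + (x.mat * y.mat - y.mat * x.mat) := rfl

theorem add_vec (x y : GHet F) : (x + y).vec = x.vec + y.vec := rfl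

theorem add_form (x y : GHet F) : (x + y).form = x.form + y.form := rfl

theorem add_mat (x y : GHet F) : (x + y).mat = x.mat + y.mat := rfl

theorem smul_vec (c : ℂ) (x : GHet F) : (c • x).vec = c • x.vec := rfl

theorem smul_form (c : ℂ) (x : GHet F) : (c • x).form = c • x.form := rfl

theorem smul_mat (c : ℂ) (x : GHet F) : (c • x).mat = c • x.mat := rfl

theorem vecBracket_skew (X Y : Fin 5 → F) : vecBracket X Y = -vecBracket Y X := by
  funext j
  simp only [vecBracket, Pi.neg_apply]; ring

theorem vecBracket_add_left (X Y Z : Fin 5 → F) :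
    vecBracket (X + Y) Z = vecBracket X Z + vecBracket Y Z := by
  funext j
  simp only [vecBracket, Pi.add_apply, vecDer_add, map_add]; ring

theorem ghet_skew (x y : GHet F) : ⁅x, y⁆ = -⁅y, x⁆ := by
  refine ghet_ext ?_ ?_ ?_
  · exact vecBracket_skew _ _
  · change (⁅x, y⁆ : GHet F).form = -(⁅y, x⁆ : GHet F).form
    rw [lie_form, lie_form, map_add, map_add, map_smul, map_smul, vecCocycle_symm x.vec,
      trCocycle_symm x.mat]
    module
  · change (⁅x, y⁆ : GHet F).mat = -(⁅y, x⁆ : GHet F).mat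
    rw [lie_mat, lie_mat]; abel

theorem map_vecDer_add (X Y : Fin 5 → F) (a : Matrix (Fin 32) (Fin 32) F) :
    a.map (vecDer (X + Y)) = a.map (vecDer X) + a.map (vecDer Y) := by
  ext i j; simp [vecDer_add]

theorem ghet_add_lie (x y z : GHet F) : ⁅x + y, z⁆ = ⁅x, z⁆ + ⁅y, z⁆ := by
  refine ghet_ext ?_ ?_ ?_
  · exact vecBracket_add_left _ _ _
  · rw [add_form, lie_form, lie_form, lie_form, add_vec, add_form, add_mat, vecCocycle_add_left,
      trCocycle_add_left, lieDerQ_add_left]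
    simp only [map_add, map_smul, smul_add]
    abel
  · rw [add_mat, lie_mat, lie_mat, lie_mat, add_vec, add_mat, map_vecDer_add, map_der_add,
      Matrix.add_mul, Matrix.mul_add]
    abel

theorem ghet_leibniz (x y z : GHet F) : ⁅x, ⁅y, z⁆⁆ = ⁅⁅x, y⁆, z⁆ + ⁅y, ⁅x, z⁆⁆ := by
  have hmap : ∀ (U V : Fin 5 → F) (a : Matrix (Fin 32) (Fin 32) F),
      a.map (vecDer (vecBracket U V))
        = (a.map (vecDer V)).map (vecDer U) - (a.map (vecDer U)).map (vecDer V) := by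
    intro U V a; ext i j; simp [vecDer_vecBracket]
  refine ghet_ext ?_ ?_ ?_
  · rw [add_vec, lie_vec, lie_vec, lie_vec, lie_vec, lie_vec, lie_vec]
    funext j
    simp only [vecBracket, Pi.add_apply, map_sub]
    have h1 := vecDer_vecBracket x.vec y.vec (z.vec j)
    have h2 := vecDer_vecBracket y.vec z.vec (x.vec j)
    have h3 := vecDer_vecBracket x.vec z.vec (y.vec j)
    rw [h1, h2, h3]; ring
  · rw [add_form]
    simp only [lie_form, lie_vec, lie_mat, map_add, map_sub, map_smul, lieDerQ_mk,
      lieDerQ_vecBracket, trCocycle_add_left, trCocycle_add_right, trCocycle_sub_left,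
      trCocycle_sub_right, lieDer_trCocycle]
    have h1 := vecCocycle_cocycle x.vec y.vec z.vec
    have h2 := trCocycle_cocycle x.mat y.mat z.mat
    have h3 := trCocycle_symm (x.mat.map (vecDer z.vec)) y.mat
    simp only [map_add, map_neg, trCocycle_sub_left, trCocycle_sub_right, map_sub] at h1 h2
    linear_combination (norm := module) (2 : ℂ) • h1 + h2 + h3
  · rw [add_mat]
    simp only [lie_mat, lie_vec, hmap, map_der_add, map_der_sub, map_der_mul]
    noncomm_ring

noncomputable instance : LieRing (GHet F) where
  add_lie := ghet_add_lie
  lie_add x y z := by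
    rw [ghet_skew x, ghet_add_lie, ghet_skew x y, ghet_skew x z, neg_add]
  lie_self x := by
    have h : (2 : ℂ) • ⁅x, x⁆ = 0 := by
      rw [two_smul]
      exact add_eq_zero_iff_eq_neg.2 (ghet_skew x x)
    exact (smul_eq_zero.1 h).resolve_left two_ne_zero
  leibniz_lie := ghet_leibniz

noncomputable instance : LieAlgebra ℂ (GHet F) where
  lie_smul c x y := by
    refine ghet_ext ?_ ?_ ?_
    · rw [smul_vec, lie_vec, lie_vec, smul_vec]
      funext j
      simp [vecBracket, vecDer_smul, smul_sub]
    · rw [smul_form, lie_form, lie_form, smul_vec, smul_form, smul_mat, lieDerQ_smul_left,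
        vecCocycle_smul_right, trCocycle_smul_right]
      simp only [map_add, map_smul]
      module
    · rw [smul_mat, lie_mat, lie_mat, smul_vec, smul_mat, map_der_smul]
      have : x.mat.map (vecDer (c • y.vec)) = c • x.mat.map (vecDer y.vec) := by
        ext i j; simp [vecDer_smul]
      rw [this, Matrix.mul_smul, Matrix.smul_mul]
      module

end Het
/-! ### Smooth functions on `ℂ⁵` and Wirtinger derivatives -/

/-- `C^∞(ℂ⁵, ℂ)`: complex valued functions that are smooth in the real sense. -/
def Smooth : Subalgebra ℂ ((Fin 5 → ℂ) → ℂ) where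
  carrier := {f | ContDiff ℝ ∞ f}
  mul_mem' := fun {f g} hf hg =>
    (show ContDiff ℝ ∞ f from hf).mul (show ContDiff ℝ ∞ g from hg)
  add_mem' := fun {f g} hf hg =>
    (show ContDiff ℝ ∞ f from hf).add (show ContDiff ℝ ∞ g from hg)
  algebraMap_mem' := fun c => (contDiff_const : ContDiff ℝ ∞ fun _ : Fin 5 → ℂ => c)

noncomputable instance : CommRing Smooth := inferInstance
noncomputable instance : Algebra ℂ Smooth := inferInstance

theorem smooth_contDiff (f : Smooth) : ContDiff ℝ ∞ f.1 := f.2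

theorem smooth_differentiable (f : Smooth) : Differentiable ℝ f.1 :=
  (smooth_contDiff f).differentiable (by simp)

/-- The derivative of a smooth function in a constant real direction. -/
noncomputable def dirDer (v : Fin 5 → ℂ) : Derivation ℂ Smooth Smooth :=
  Derivation.mk'
    { toFun := fun f => ⟨fun z => fderiv ℝ f.1 z v,
        ((smooth_contDiff f).fderiv_right (m := ∞) (by simp)).clm_apply contDiff_const⟩
      map_add' := by
        intro f g
        apply Subtype.ext; funext z
        change fderiv ℝ (f.1 + g.1) z v = fderiv ℝ f.1 z v + fderiv ℝ g.1 z v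
        rw [fderiv_add (smooth_differentiable f z) (smooth_differentiable g z)]; rfl
      map_smul' := by
        intro c f
        apply Subtype.ext; funext z
        change fderiv ℝ (c • f.1) z v = c • fderiv ℝ f.1 z v
        rw [fderiv_const_smul (smooth_differentiable f z)]; rfl }
    (by
      intro f g
      apply Subtype.ext; funext z
      change fderiv ℝ (f.1 * g.1) z v = f.1 z * fderiv ℝ g.1 z v + g.1 z * fderiv ℝ f.1 z v
      rw [fderiv_mul (smooth_differentiable f z) (smooth_differentiable g z)]; rfl)

theorem dirDer_comm (v w : Fin 5 → ℂ) (f : Smooth) :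
    dirDer v (dirDer w f) = dirDer w (dirDer v f) := by
  have h : ∀ (a b : Fin 5 → ℂ) (z : Fin 5 → ℂ),
      (dirDer a (dirDer b f)).1 z = fderiv ℝ (fderiv ℝ f.1) z a b := by
    intro a b z
    have hd : DifferentiableAt ℝ (fderiv ℝ f.1) z :=
      (((smooth_contDiff f).fderiv_right (m := 1) (by norm_cast)).differentiable (by simp)) z
    change fderiv ℝ (fun y => fderiv ℝ f.1 y b) z a = _
    rw [fderiv_clm_apply hd (differentiableAt_const b)]
    simp
  apply Subtype.ext; funext z
  rw [h, h]
  exact ((smooth_contDiff f).contDiffAt.isSymmSndFDerivAt (by simp; norm_cast)) v w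

/-- `∂/∂zⁱ = ½ (∂/∂xⁱ - √-1 ∂/∂yⁱ)`. -/
noncomputable def dz (i : Fin 5) : Derivation ℂ Smooth Smooth :=
  (1 / 2 : ℂ) • (dirDer (Pi.single i 1) - Complex.I • dirDer (Pi.single i Complex.I))

/-- `∂/∂z̄ⁱ = ½ (∂/∂xⁱ + √-1 ∂/∂yⁱ)`. -/
noncomputable def dzbar (i : Fin 5) : Derivation ℂ Smooth Smooth :=
  (1 / 2 : ℂ) • (dirDer (Pi.single i 1) + Complex.I • dirDer (Pi.single i Complex.I))

theorem dz_dz (i j : Fin 5) (f : Smooth) : dz i (dz j f) = dz j (dz i f) := by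
  simp only [dz, Derivation.smul_apply, Derivation.sub_apply, Derivation.map_smul, map_sub]
  rw [dirDer_comm (Pi.single j 1) (Pi.single i 1), dirDer_comm (Pi.single j 1) (Pi.single i Complex.I),
    dirDer_comm (Pi.single j Complex.I) (Pi.single i 1),
    dirDer_comm (Pi.single j Complex.I) (Pi.single i Complex.I)]
  module

theorem dzbar_dzbar (i j : Fin 5) (f : Smooth) : dzbar i (dzbar j f) = dzbar j (dzbar i f) := by
  simp only [dzbar, Derivation.smul_apply, Derivation.add_apply, Derivation.map_smul, map_add]
  rw [dirDer_comm (Pi.single j 1) (Pi.single i 1), dirDer_comm (Pi.single j 1) (Pi.single i Complex.I),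
    dirDer_comm (Pi.single j Complex.I) (Pi.single i 1),
    dirDer_comm (Pi.single j Complex.I) (Pi.single i Complex.I)]
  module

theorem dz_dzbar (i j : Fin 5) (f : Smooth) : dz i (dzbar j f) = dzbar j (dz i f) := by
  simp only [dz, dzbar, Derivation.smul_apply, Derivation.sub_apply, Derivation.add_apply,
    Derivation.map_smul, map_sub, map_add]
  rw [dirDer_comm (Pi.single j 1) (Pi.single i 1), dirDer_comm (Pi.single j 1) (Pi.single i Complex.I),
    dirDer_comm (Pi.single j Complex.I) (Pi.single i 1),
    dirDer_comm (Pi.single j Complex.I) (Pi.single i Complex.I)]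
  module

/-! ### The two function algebras: polynomials and entire functions -/

/-- Polynomial functions `ℂ[w¹, …, w⁵]`. -/
noncomputable instance : PartialDerivatives (MvPolynomial (Fin 5) ℂ) where
  pd := fun i => MvPolynomial.pderiv i
  pd_comm := by
    intro i j f
    have h : ⁅MvPolynomial.pderiv (R := ℂ) i, MvPolynomial.pderiv (R := ℂ) j⁆ = 0 := by
      refine MvPolynomial.derivation_ext fun k => ?_
      rw [Derivation.commutator_apply]
      simp [MvPolynomial.pderiv_X, Pi.single_apply, apply_ite]
    have h2 := congrArg (fun d => d f) h
    simpa [Derivation.commutator_apply, sub_eq_zero] using h2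

/-- Entire holomorphic functions on `ℂ⁵`, as the smooth functions that satisfy the
Cauchy-Riemann equations. -/
noncomputable def Hol : Subalgebra ℂ Smooth where
  carrier := {f | ∀ i, dzbar i f = 0}
  mul_mem' := by
    intro f g hf hg i
    rw [Derivation.leibniz, hf i, hg i, smul_zero, smul_zero, add_zero]
  add_mem' := by
    intro f g hf hg i
    rw [map_add, hf i, hg i, add_zero]
  algebraMap_mem' := fun c i => (dzbar i).map_algebraMap c

noncomputable instance : PartialDerivatives Hol where
  pd := fun i => Derivation.mk'
    { toFun := fun f => ⟨dz i f.1, fun j => by rw [← dz_dzbar, f.2 j, map_zero]⟩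
      map_add' := fun f g => Subtype.ext (map_add (dz i) f.1 g.1)
      map_smul' := fun c f => Subtype.ext (Derivation.map_smul (dz i) c f.1) }
    (fun f g => Subtype.ext ((dz i).leibniz f.1 g.1))
  pd_comm := fun i j f => Subtype.ext (dz_dz i j f.1)

/-! ### Dolbeault forms of type `(0, •)` -/

/-- The exterior algebra `ℂ[dz̄¹, …, dz̄⁵]`. -/
abbrev AntiHol : Type := ExteriorAlgebra ℂ (Fin 5 → ℂ)

noncomputable instance : Ring AntiHol := inferInstance
noncomputable instance : Algebra ℂ AntiHol := inferInstance
noncomputable instance : AddCommGroup AntiHol := inferInstance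
noncomputable instance : Module ℂ AntiHol := inferInstance

/-- The generator `dz̄ⁱ`. -/
noncomputable def dzb (i : Fin 5) : AntiHol := ExteriorAlgebra.ι ℂ (Pi.single i 1)

/-- The graded-commutative algebra `Ω^{0,•}(ℂ⁵) = C^∞(ℂ⁵)[dz̄¹, …, dz̄⁵]`. -/
abbrev Dol : Type := Smooth ⊗[ℂ] AntiHol

noncomputable instance : Ring Dol := inferInstance
noncomputable instance : Algebra ℂ Dol := inferInstance
noncomputable instance : AddCommGroup Dol := inferInstance
noncomputable instance : Module ℂ Dol := inferInstance

/-- The holomorphic derivative `∂/∂zⁱ`, acting on the coefficients of a `(0, •)`-form. -/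
noncomputable def D (i : Fin 5) : Dol →ₗ[ℂ] Dol :=
  LinearMap.rTensor AntiHol (dz i).toLinearMap

/-- The Dolbeault operator `∂̄ = ∑ dz̄ⁱ ∂/∂z̄ⁱ`. -/
noncomputable def dbar : Dol →ₗ[ℂ] Dol :=
  ∑ i, TensorProduct.map (dzbar i).toLinearMap (LinearMap.mulLeft ℂ (dzb i))

/-- The operator `(-1)^q` on `(0, q)`-forms. -/
noncomputable def par : Dol →ₗ[ℂ] Dol :=
  LinearMap.lTensor Smooth
    (CliffordAlgebra.involute (Q := (0 : QuadraticForm ℂ (Fin 5 → ℂ)))).toLinearMap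

/-- The coefficient of `dz̄¹ dz̄² dz̄³ dz̄⁴ dz̄⁵`. -/
noncomputable def topCoeff : AntiHol →ₗ[ℂ] ℂ :=
  ExteriorAlgebra.liftAlternating (R := ℂ) (M := Fin 5 → ℂ) (N := ℂ) fun
    | 5 => (Pi.basisFun ℂ (Fin 5)).det
    | _ => 0

/-- `∫ Ω ∧ x` for a `(0, •)`-form `x` on `ℂ⁵` (up to the constant factor that relates
`dz¹ … dz⁵ dz̄¹ … dz̄⁵` to Lebesgue measure): the Lebesgue integral of the `(0, 5)`-component. -/
noncomputable def integral (x : Dol) : ℂ :=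
  ∫ z : Fin 5 → ℂ, (TensorProduct.rid ℂ Smooth (LinearMap.lTensor Smooth topCoeff x)).1 z

/-- `(0, •)`-forms with compact support. -/
noncomputable def DolCompact : Submodule ℂ Dol :=
  Submodule.span ℂ {x | ∃ (f : Smooth) (w : AntiHol), HasCompactSupport f.1 ∧ x = f ⊗ₜ[ℂ] w}

/-- Smooth functions that are polynomials in the `zⁱ` and `z̄ⁱ`. -/
noncomputable def PolySmooth : Subalgebra ℂ Smooth :=
  Algebra.adjoin ℂ {f | ∃ i : Fin 5, f.1 = (fun z => z i) ∨ f.1 = fun z => star (z i)}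

/-- `(0, •)`-forms whose coefficients are polynomials in the `zⁱ` and `z̄ⁱ`. -/
noncomputable def DolPoly : Submodule ℂ Dol :=
  Submodule.span ℂ {x | ∃ (f : Smooth) (w : AntiHol), f ∈ PolySmooth ∧ x = f ⊗ₜ[ℂ] w}

theorem D_dbar (i : Fin 5) (x : Dol) : D i (dbar x) = dbar (D i x) := by
  induction x using TensorProduct.induction_on with
  | zero => simp
  | add x y hx hy => simp only [map_add, hx, hy]
  | tmul f w =>
    simp only [D, dbar, LinearMap.sum_apply, TensorProduct.map_tmul, LinearMap.rTensor_tmul,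
      map_sum, Derivation.coeFn_coe, dz_dzbar]

/-! ### The fields -/

/-- Triples `(μⁱ, ω_{ij}, A_{ab})` of tensors with values in `(0, •)`-forms on `ℂ⁵`. -/
abbrev RawField : Type := (Fin 5 → Dol) × (Fin 5 → Fin 5 → Dol) × Matrix (Fin 32) (Fin 32) Dol

/-- The component `μⁱ`. -/
noncomputable def cMu (i : Fin 5) : RawField →ₗ[ℂ] Dol :=
  LinearMap.proj i ∘ₗ LinearMap.fst ℂ _ _

/-- The component `ω_{ij}`. -/
noncomputable def cOm (i j : Fin 5) : RawField →ₗ[ℂ] Dol :=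
  LinearMap.proj j ∘ₗ LinearMap.proj i ∘ₗ LinearMap.fst ℂ _ _ ∘ₗ LinearMap.snd ℂ _ _

/-- The component `A_{ab}`. -/
noncomputable def cA (a b : Fin 32) : RawField →ₗ[ℂ] Dol :=
  Matrix.entryLinearMap ℂ Dol a b ∘ₗ LinearMap.snd ℂ _ _ ∘ₗ LinearMap.snd ℂ _ _

/-- The fields of type I Kodaira-Spencer theory on `ℂ⁵` coupled to `so(32)` holomorphic
Chern-Simons theory, with `Ω = dz¹ ⋯ dz⁵`:
* `μ = μⁱ ∂_i ∈ PV^{1,•}` with `∂_Ω μ = ∑ ∂_i μⁱ = 0`;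
* `η ∈ PV^{3,•}` with `∂_Ω η = 0`. It is recorded as the two-form `ω = η ∨ Ω ∈ Ω^{2,•}`,
  `ω = ½ ω_{ij} dzⁱ dzʲ`. The operator `∂_Ω` on polyvector fields is by definition the operator
  `∂` on forms carried over along `∨ Ω`, so that the constraint on `η` reads `∂ω = 0`;
* `A ∈ Ω^{0,•} ⊗ so(32)`.
The space is taken with the parity shift that makes `(0, q)`-forms elements of parity `q`. -/
def Fields : Submodule ℂ RawField where
  carrier := {φ |
    (∑ i, D i (cMu i φ) = 0) ∧
    (∀ i j, cOm i j φ = -cOm j i φ) ∧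
    (∀ i j k, D i (cOm j k φ) + D j (cOm k i φ) + D k (cOm i j φ) = 0) ∧
    (∀ a b, cA a b φ = -cA b a φ)}
  add_mem' := by
    rintro x y ⟨h1, h2, h3, h4⟩ ⟨k1, k2, k3, k4⟩
    refine ⟨?_, ?_, ?_, ?_⟩
    · simp only [map_add, Finset.sum_add_distrib, h1, k1, add_zero]
    · intro i j
      rw [map_add, map_add, h2 i j, k2 i j]; abel
    · intro i j k
      have := congrArg₂ (· + ·) (h3 i j k) (k3 i j k)
      simp only [map_add]
      simp only [add_zero] at this
      rw [← this]; abel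
    · intro a b
      rw [map_add, map_add, h4 a b, k4 a b]; abel
  zero_mem' := by simp
  smul_mem' := by
    rintro c x ⟨h1, h2, h3, h4⟩
    refine ⟨?_, ?_, ?_, ?_⟩
    · simp only [map_smul, ← Finset.smul_sum, h1, smul_zero]
    · intro i j
      rw [map_smul, map_smul, h2 i j, smul_neg]
    · intro i j k
      simp only [map_smul, ← smul_add, h3 i j k, smul_zero]
    · intro a b
      rw [map_smul, map_smul, h4 a b, smul_neg]

noncomputable instance : AddCommGroup Fields := inferInstance
noncomputable instance : Module ℂ Fields := inferInstance

/-- Apply an operator to all components of a field. -/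
noncomputable def onComponents (T : Dol →ₗ[ℂ] Dol) : RawField →ₗ[ℂ] RawField :=
  LinearMap.prodMap (T.compLeft (Fin 5))
    (LinearMap.prodMap ((T.compLeft (Fin 5)).compLeft (Fin 5)) T.mapMatrix)

/-- The linear BRST operator, which is the Dolbeault operator `∂̄`. -/
noncomputable def brst : Fields →ₗ[ℂ] Fields :=
  (onComponents dbar).restrict (by
    rintro x ⟨h1, h2, h3, h4⟩
    refine ⟨?_, fun i j => ?_, fun i j k => ?_, fun a b => ?_⟩
    · change ∑ i, D i (dbar (cMu i x)) = 0
      simp only [D_dbar, ← map_sum, h1, map_zero]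
    · change dbar (cOm i j x) = -dbar (cOm j i x)
      rw [h2 i j, map_neg]
    · change D i (dbar (cOm j k x)) + D j (dbar (cOm k i x)) + D k (dbar (cOm i j x)) = 0
      simp only [D_dbar, ← map_add, h3, map_zero]
    · change dbar (cA a b x) = -dbar (cA b a x)
      rw [h4 a b, map_neg])

/-- `φ` has parity `p` modulo 2. -/
def HasParity (p : ℕ) (φ : Fields) : Prop := onComponents par φ.1 = (-1 : ℂ) ^ p • φ.1

/-- Fields whose components have coefficients that are polynomials in `zⁱ` and `z̄ⁱ`. -/
def PolyFields : Submodule ℂ Fields where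
  carrier := {φ | (∀ i, cMu i φ.1 ∈ DolPoly) ∧ (∀ i j, cOm i j φ.1 ∈ DolPoly) ∧
    ∀ a b, cA a b φ.1 ∈ DolPoly}
  add_mem' := by
    rintro x y ⟨h1, h2, h3⟩ ⟨k1, k2, k3⟩
    exact ⟨fun i => add_mem (h1 i) (k1 i), fun i j => add_mem (h2 i j) (k2 i j),
      fun a b => add_mem (h3 a b) (k3 a b)⟩
  zero_mem' := ⟨fun _ => zero_mem _, fun _ _ => zero_mem _, fun _ _ => zero_mem _⟩
  smul_mem' := by
    rintro c x ⟨h1, h2, h3⟩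
    exact ⟨fun i => DolPoly.smul_mem c (h1 i), fun i j => DolPoly.smul_mem c (h2 i j),
      fun a b => DolPoly.smul_mem c (h3 a b)⟩

/-! ### The action functional and its `L_∞` brackets -/

/-- Polarization of a cubic monomial `(T₀ Φ) (T₁ Φ) (T₂ Φ)` in a superfield `Φ`.
The components of `Φ` are odd: the `(0, q)`-form components of `Φ` have parity `q + 1`. So three
factors anticommute, and the coefficient of `ε₀ ε₁ ε₂` at `Φ = ε₀ φ₀ + ε₁ φ₁ + ε₂ φ₂`, with
parameters `ε_i` that make each `ε_i φ_i` odd, is up to an overall sign this alternating sum. -/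
noncomputable def polar (T : Fin 3 → RawField →ₗ[ℂ] Dol) (φ : Fin 3 → RawField) : Dol :=
  ∑ σ : Equiv.Perm (Fin 3),
    (Equiv.Perm.sign σ : ℤ) •
      (T (σ 0) (φ 0) * T (σ 1) (φ 1) * T (σ 2) (φ 2))

/-- The polarization of the cubic Lagrangian density
`⅙ tr (A [A, A]) + ½ μⁱ tr (A ∂_i A) + ½ ⟨η, μ ∧ μ⟩ + κ μᵏ ∂_i μʲ ∂_k ∂_j μⁱ`.
Here `[A, A] = 2 A²` as `A` is odd, and `⟨η, μ ∧ μ⟩` is the contraction `ω_{ij} μⁱ μʲ`. -/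
noncomputable def cubicLagrangian (κ : ℂ) (φ : Fin 3 → RawField) : Dol :=
  (1 / 3 : ℂ) • (∑ a, ∑ b, ∑ c, polar ![cA a b, cA b c, cA c a] φ)
  + (1 / 2 : ℂ) • (∑ i, ∑ a, ∑ b, polar ![cMu i, cA a b, D i ∘ₗ cA b a] φ)
  + (1 / 2 : ℂ) • (∑ i, ∑ j, polar ![cOm i j, cMu i, cMu j] φ)
  + κ • (∑ i, ∑ j, ∑ k, polar ![cMu k, D i ∘ₗ cMu j, D k ∘ₗ D j ∘ₗ cMu i] φ)

/-- Parameters of a compactly supported variation of the fields: a bivector field `b^{ij}`, a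
one-form `γ_i` (which is a four-vector field contracted with `Ω`), and a matrix `a`. -/
structure Variation where
  b : Fin 5 → Fin 5 → Dol
  γ : Fin 5 → Dol
  a : Matrix (Fin 32) (Fin 32) Dol
  b_skew : ∀ i j, b i j = -b j i
  a_skew : ∀ i j, a i j = -a j i
  b_compact : ∀ i j, b i j ∈ DolCompact
  γ_compact : ∀ i, γ i ∈ DolCompact
  a_compact : ∀ i j, a i j ∈ DolCompact

/-- The variation of the fields with the given parameters: `δμ` is the divergence of `b`,
`δη` corresponds to `δω = ∂γ`, and `δA = a`. -/
noncomputable def Variation.field (v : Variation) : RawField :=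
  (fun i => ∑ j, D j (v.b i j), fun i j => D i (v.γ j) - D j (v.γ i), v.a)

/-- The odd symplectic pairing of a variation with a field. The Kodaira-Spencer part is
`∫ η ∂⁻¹ μ`, the inverse of the Poisson kernel `∂ δ`; it is evaluated on the potentials
`b` and `γ` of the variation: `∫ (½ b^{ij} ω_{ij} + γ_i μⁱ + tr (a A))`. With it the quadratic term
`∫ (η ∂⁻¹ ∂̄ μ + ½ tr (A ∂̄ A))` of the action generates the differential `∂̄`. -/
noncomputable def Variation.pairing (v : Variation) (φ : RawField) : Dol :=
  (1 / 2 : ℂ) • (∑ i, ∑ j, v.b i j * cOm i j φ) + (∑ i, v.γ i * cMu i φ)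
    + ∑ i, ∑ j, v.a i j * cA j i φ

/-- `l₂` is the bracket given by the BV anti-bracket with the cubic term `S³` of the action, that
is, `∂̄Φ + ½ l₂(Φ, Φ) = 0` are the equations of motion up to quadratic order: the first variation
of `S³` is the pairing with `½ l₂(Φ, Φ)`. Both sides are polarized in `Φ`. -/
def IsBVBracket (κ : ℂ) (l₂ : Fields →ₗ[ℂ] Fields →ₗ[ℂ] Fields) : Prop :=
  ∀ (v : Variation) (φ ψ : Fields),
    integral (cubicLagrangian κ ![v.field, φ.1, ψ.1]) = integral (v.pairing (l₂ φ ψ).1)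

/-- `(Fields, ∂̄, l₂)` is a `ℤ/2`-graded dg Lie algebra. -/
structure IsDGLie (l₂ : Fields →ₗ[ℂ] Fields →ₗ[ℂ] Fields) : Prop where
  brst_brst : ∀ φ, brst (brst φ) = 0
  brst_parity : ∀ p φ, HasParity p φ → HasParity (p + 1) (brst φ)
  bracket_parity : ∀ p q φ ψ, HasParity p φ → HasParity q ψ → HasParity (p + q) (l₂ φ ψ)
  bracket_skew : ∀ p q φ ψ, HasParity p φ → HasParity q ψ →
    l₂ φ ψ = -((-1 : ℂ) ^ (p * q) • l₂ ψ φ)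
  brst_bracket : ∀ p φ ψ, HasParity p φ →
    brst (l₂ φ ψ) = l₂ (brst φ) ψ + (-1 : ℂ) ^ p • l₂ φ (brst ψ)
  jacobi : ∀ p q φ ψ χ, HasParity p φ → HasParity q ψ →
    l₂ φ (l₂ ψ χ) = l₂ (l₂ φ ψ) χ + (-1 : ℂ) ^ (p * q) • l₂ ψ (l₂ φ χ)

/-- The closed elements of a subspace of the space of fields. -/
noncomputable def Cocycles (N : Submodule ℂ Fields) : Submodule ℂ Fields :=
  LinearMap.ker brst ⊓ N

/-- The boundaries of elements of a subspace of the space of fields. -/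
noncomputable def Coboundaries (N : Submodule ℂ Fields) : Submodule ℂ Fields := N.map brst

/-- The `∂̄`-cohomology of a subcomplex `N` of the complex of fields. -/
abbrev Cohomology (N : Submodule ℂ Fields) : Type :=
  Cocycles N ⧸ (Coboundaries N).submoduleOf (Cocycles N)

/-- `N` is a sub-dg Lie algebra whose cohomology, with the bracket induced by `l₂`, is
concentrated in even degree and is isomorphic to the Lie algebra `G`. -/
def CohomologyIsoLie (l₂ : Fields →ₗ[ℂ] Fields →ₗ[ℂ] Fields) (N : Submodule ℂ Fields)
    (G : Type) [LieRing G] [LieAlgebra ℂ G] : Prop :=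
  (∀ φ ∈ N, brst φ ∈ N) ∧
  (∀ φ ∈ N, ∀ ψ ∈ N, l₂ φ ψ ∈ N) ∧
  (∀ φ ∈ Cocycles N, HasParity 1 φ → φ ∈ Coboundaries N) ∧
  ∃ e : Cohomology N ≃ₗ[ℂ] G, ∀ φ ψ : Cocycles N, ∃ h : l₂ φ.1 ψ.1 ∈ Cocycles N,
    e (Submodule.Quotient.mk ⟨l₂ φ.1 ψ.1, h⟩)
      = ⁅e (Submodule.Quotient.mk φ), e (Submodule.Quotient.mk ψ)⁆

end TypeOneHet

/-!
The bracket has an explicit formula. On triples `(μ, ω, A)` it is a bidifferential operator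
`rawBr` built from an arbitrary bilinear product `m` of the components: minus the commutator on
`μ`, the exterior derivative of a one-form `θ` on `ω`, and the matrix commutator together with
the derivative along `μ` on `A`. The
one-form `θ` contains `½ (tr (A ∂B) - tr (∂A B))` and the cocycle `∂μ ∂∂ν - ∂∂μ ∂ν`. The bracket
`ell` of fields is the case of the product of Dolbeault forms. For a commutative algebra with
partial derivatives, `(X, [w], α) ↦ (-X, ∂w, α)` carries the heterotic bracket to `rawBr`, since the
two one-forms differ by an exact one (`rawBr_toRaw`).

*dg Lie algebra.* As `rawBr` is natural in `m` (`rawBr_natural`), its parity, its skew symmetry and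
the Leibniz rule for `∂̄` follow from those of the product of forms. For the Jacobi identity, odd
parameters are adjoined: the products of fields with parameters of the same parity lie in the even
part of a larger exterior algebra, which is commutative. By the Poincaré lemma for `∂` these products
come from its heterotic Lie algebra, where the Jacobi identity is known (`ell_jacobi`).

*BV bracket.* Integration by parts in each of the terms of the cubic action, with the divergence
constraints on `μ`, gives the first variation (`variation_cubicLagrangian`); the three factors of
`μᵏ ∂_i μʲ ∂_k ∂_j μⁱ` contribute equally, which is where the coefficient `⅓` enters. The bracket is
unique because the variations `∂_Ω b`, `∂γ`, `a` are paired with a field through `b`, `γ`, `a`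
themselves, and the integral of products of forms is nondegenerate (`eq_zero_of_integral`).

*Cohomology.* Everything rests on one analytic property of a space of coefficients (`Solvable`):
each of the ten equations `∂g/∂zᵏ = f`, `∂g/∂z̄ᵏ = f` has a solution in the space that is annihilated
by every other Wirtinger derivative that annihilates `f`. For polynomials this is the termwise
antiderivative (`solvable_polySmooth`). For all smooth functions (`solvable_top`) the equation in
`z̄ᵏ` is solved on annuli by the Cauchy transform. Its kernel `1/(π (z - ζ))` is damped by a factor
`(z/ζ)ᴺ`, which subtracts a function entire in `zᵏ` and makes the sum over the annuli converge with
all derivatives; the remaining variables are untouched (`exists_dzbar_eq`). As this solution need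
not be annihilated by `∂/∂zᵏ` when `f` is, functions antiholomorphic in `zᵏ` are treated by a radial
integral instead (`exists_dzbar_eq_of_antiholomorphic`). Conjugation gives the equation in `zᵏ`. A Koszul homotopy argument then yields the
`∂̄`-Poincaré lemma, also inside the common kernel of some of the `∂/∂zⁱ` (`Solvable.dolbeault`), and
the `∂`-Poincaré lemmas.

With these, a cocycle is a holomorphic field up to the boundary of a field that satisfies the
constraints (`IsHolPart.exists_brst_add`): a potential of `ω`, the divergence of `μ` and the
transpose of `A` are corrected in turn. Holomorphic fields are the image of the heterotic Lie
algebra. They are even, and they are no boundaries, as the term of degree zero in the `dz̄ⁱ` of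
`∂̄ψ` vanishes. So the cohomology is the heterotic Lie algebra, for entire and for polynomial
coefficients alike (`IsHolPart.cohomologyIsoLie`).
-/

namespace TypeOneHet

open scoped ContDiff TensorProduct
open MeasureTheory

/-! ### Exterior algebras and forms with smooth coefficients -/

section Exterior

variable {M N : Type} [AddCommGroup M] [Module ℂ M] [AddCommGroup N] [Module ℂ N]

/-- The grading involution of the exterior algebra. -/
noncomputable def invol : ExteriorAlgebra ℂ M →ₐ[ℂ] ExteriorAlgebra ℂ M :=
  CliffordAlgebra.involute (Q := (0 : QuadraticForm ℂ M))

theorem invol_ι (v : M) : invol (ExteriorAlgebra.ι ℂ v) = -ExteriorAlgebra.ι ℂ v :=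
  CliffordAlgebra.involute_ι v

theorem invol_invol (x : ExteriorAlgebra ℂ M) : invol (invol x) = x :=
  CliffordAlgebra.involute_involute x

theorem exterior_induction {P : ExteriorAlgebra ℂ M → Prop}
    (algebraMap : ∀ r : ℂ, P (algebraMap _ _ r)) (add : ∀ x y, P x → P y → P (x + y))
    (ι_mul : ∀ x m, P x → P (ExteriorAlgebra.ι ℂ m * x)) (x : ExteriorAlgebra ℂ M) : P x :=
  CliffordAlgebra.left_induction (Q := (0 : QuadraticForm ℂ M)) algebraMap add ι_mul x

theorem mul_ι_eq (v : M) (x : ExteriorAlgebra ℂ M) :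
    x * ExteriorAlgebra.ι ℂ v = ExteriorAlgebra.ι ℂ v * invol x := by
  induction x using exterior_induction with
  | algebraMap r => rw [AlgHom.commutes, Algebra.commutes]
  | add x y hx hy => rw [add_mul, hx, hy, map_add, mul_add]
  | ι_mul x m hx =>
    have h := ExteriorAlgebra.ι_add_mul_swap (R := ℂ) m v
    rw [mul_assoc, hx, map_mul, invol_ι, ← mul_assoc, neg_mul, mul_neg, ← mul_assoc,
      eq_neg_of_add_eq_zero_left h, neg_mul]

/-- Graded commutativity, for a factor `x` split into its even and odd parts. -/
theorem exterior_mul_comm (x y : ExteriorAlgebra ℂ M) :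
    (2 : ℂ) • (y * x) = (x + invol x) * y + (x - invol x) * invol y := by
  induction x using exterior_induction generalizing y with
  | algebraMap r =>
    rw [AlgHom.commutes, ← Algebra.commutes r y, sub_self, zero_mul, add_zero, two_smul, add_mul]
  | add x x' hx hx' =>
    rw [mul_add, smul_add, hx, hx', map_add]; noncomm_ring
  | ι_mul x v hx =>
    have h := hx (invol y)
    rw [invol_invol] at h
    rw [← mul_assoc, mul_ι_eq, mul_assoc, ← mul_smul_comm, h, map_mul, invol_ι]
    noncomm_ring

/-- Contraction with a linear form. -/
noncomputable def con (d : Module.Dual ℂ M) : ExteriorAlgebra ℂ M →ₗ[ℂ] ExteriorAlgebra ℂ M :=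
  CliffordAlgebra.contractLeft (Q := (0 : QuadraticForm ℂ M)) d

theorem con_ι_mul (d : Module.Dual ℂ M) (v : M) (x : ExteriorAlgebra ℂ M) :
    con d (ExteriorAlgebra.ι ℂ v * x) = d v • x - ExteriorAlgebra.ι ℂ v * con d x :=
  CliffordAlgebra.contractLeft_ι_mul (Q := (0 : QuadraticForm ℂ M)) (d := d) v x

theorem con_algebraMap (d : Module.Dual ℂ M) (r : ℂ) :
    con d (algebraMap ℂ (ExteriorAlgebra ℂ M) r) = 0 :=
  CliffordAlgebra.contractLeft_algebraMap (Q := (0 : QuadraticForm ℂ M)) (d := d) r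

theorem con_con (d d' : Module.Dual ℂ M) (x : ExteriorAlgebra ℂ M) :
    con d (con d' x) = -con d' (con d x) :=
  CliffordAlgebra.contractLeft_comm (Q := (0 : QuadraticForm ℂ M)) (d := d) (d' := d') x

theorem con_con_self (d : Module.Dual ℂ M) (x : ExteriorAlgebra ℂ M) : con d (con d x) = 0 :=
  CliffordAlgebra.contractLeft_contractLeft (Q := (0 : QuadraticForm ℂ M)) (d := d) x

theorem con_map (f : N →ₗ[ℂ] M) (d : Module.Dual ℂ M) (h : d ∘ₗ f = 0)
    (x : ExteriorAlgebra ℂ N) : con d (ExteriorAlgebra.map f x) = 0 := by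
  induction x using exterior_induction with
  | algebraMap r => rw [AlgHom.commutes, con_algebraMap]
  | add x y hx hy => rw [map_add, map_add, hx, hy, add_zero]
  | ι_mul x v hx =>
    have hv : d (f v) = 0 := LinearMap.congr_fun h v
    rw [map_mul, ExteriorAlgebra.map_apply_ι, con_ι_mul, hx, hv, zero_smul, mul_zero, sub_zero]

theorem con_mul (d : Module.Dual ℂ M) (x y : ExteriorAlgebra ℂ M) :
    con d (x * y) = con d x * y + invol x * con d y := by
  induction x using exterior_induction with
  | algebraMap r =>
    rw [con_algebraMap, AlgHom.commutes, ← Algebra.smul_def, map_smul, zero_mul, zero_add,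
      Algebra.smul_def]
  | add x x' hx hx' => rw [add_mul, map_add, hx, hx', map_add, map_add]; noncomm_ring
  | ι_mul x v hx =>
    rw [mul_assoc, con_ι_mul, hx, con_ι_mul, map_mul, invol_ι, sub_mul, smul_mul_assoc]
    noncomm_ring

end Exterior

section SuperForms

variable (M : Type) [AddCommGroup M] [Module ℂ M]

/-- The algebra `C^∞(ℂ⁵) ⊗ Λ M`. -/
abbrev SForm : Type := Smooth ⊗[ℂ] ExteriorAlgebra ℂ M

variable {M}
variable {N : Type} [AddCommGroup N] [Module ℂ N]

/-- An operator on smooth functions, applied to the coefficients. -/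
noncomputable def coef (T : Smooth →ₗ[ℂ] Smooth) : SForm M →ₗ[ℂ] SForm M :=
  LinearMap.rTensor _ T

/-- A linear map of exterior algebras, extended linearly over the coefficients. -/
noncomputable def extn (S : ExteriorAlgebra ℂ M →ₗ[ℂ] ExteriorAlgebra ℂ N) :
    SForm M →ₗ[ℂ] SForm N :=
  LinearMap.lTensor _ S

@[simp] theorem coef_tmul (T : Smooth →ₗ[ℂ] Smooth) (f : Smooth) (w : ExteriorAlgebra ℂ M) :
    coef T (f ⊗ₜ[ℂ] w) = T f ⊗ₜ[ℂ] w := rfl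

@[simp] theorem extn_tmul (S : ExteriorAlgebra ℂ M →ₗ[ℂ] ExteriorAlgebra ℂ N) (f : Smooth)
    (w : ExteriorAlgebra ℂ M) : extn S (f ⊗ₜ[ℂ] w) = f ⊗ₜ[ℂ] S w := rfl

theorem coef_extn (T : Smooth →ₗ[ℂ] Smooth) (S : ExteriorAlgebra ℂ M →ₗ[ℂ] ExteriorAlgebra ℂ N)
    (x : SForm M) : coef T (extn S x) = extn S (coef T x) := by
  induction x using TensorProduct.induction_on with
  | zero => simp only [map_zero]
  | add x y hx hy => simp only [map_add, hx, hy]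
  | tmul f w => rfl

theorem coef_comm {T T' : Smooth →ₗ[ℂ] Smooth} (h : ∀ f, T (T' f) = T' (T f)) (x : SForm M) :
    coef T (coef T' x) = coef T' (coef T x) := by
  induction x using TensorProduct.induction_on with
  | zero => simp only [map_zero]
  | add x y hx hy => simp only [map_add, hx, hy]
  | tmul f w => simp only [coef_tmul, h]

/-- The grading involution. -/
noncomputable def spar : SForm M →ₗ[ℂ] SForm M := extn invol.toLinearMap

theorem spar_tmul (f : Smooth) (w : ExteriorAlgebra ℂ M) :
    spar (f ⊗ₜ[ℂ] w) = f ⊗ₜ[ℂ] invol w := rfl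

theorem spar_spar (x : SForm M) : spar (spar x) = x := by
  induction x using TensorProduct.induction_on with
  | zero => simp only [map_zero]
  | add x y hx hy => simp only [map_add, hx, hy]
  | tmul f w => rw [spar_tmul, spar_tmul, invol_invol]

theorem spar_mul (x y : SForm M) : spar (x * y) = spar x * spar y := by
  induction x using TensorProduct.induction_on with
  | zero => simp only [map_zero, zero_mul]
  | add x x' hx hx' => simp only [map_add, add_mul, hx, hx']
  | tmul f w =>
    induction y using TensorProduct.induction_on with
    | zero => simp only [map_zero, mul_zero]
    | add x x' hx hx' => simp only [map_add, mul_add, hx, hx']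
    | tmul g u =>
      simp only [Algebra.TensorProduct.tmul_mul_tmul, spar_tmul, map_mul]

theorem coef_spar (T : Smooth →ₗ[ℂ] Smooth) (x : SForm M) : coef T (spar x) = spar (coef T x) :=
  coef_extn T _ x

theorem coef_mul (d : Derivation ℂ Smooth Smooth) (x y : SForm M) :
    coef d.toLinearMap (x * y) = coef d.toLinearMap x * y + x * coef d.toLinearMap y := by
  induction x using TensorProduct.induction_on with
  | zero => simp only [map_zero, zero_mul, add_zero]
  | add x x' hx hx' => simp only [map_add, add_mul, hx, hx']; abel
  | tmul f w =>
    induction y using TensorProduct.induction_on with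
    | zero => simp only [map_zero, mul_zero, add_zero]
    | add x x' hx hx' => simp only [map_add, mul_add, hx, hx']; abel
    | tmul g u =>
      simp only [Algebra.TensorProduct.tmul_mul_tmul, coef_tmul, Derivation.coeFn_coe,
        Derivation.leibniz, smul_eq_mul, TensorProduct.add_tmul]
      rw [add_comm, mul_comm g]

/-- Graded commutativity, for a factor `x` split into its even and odd parts. -/
theorem sform_mul_comm (x y : SForm M) :
    (2 : ℂ) • (y * x) = (x + spar x) * y + (x - spar x) * spar y := by
  induction x using TensorProduct.induction_on with
  | zero => simp only [map_zero, mul_zero, smul_zero, add_zero, sub_zero, zero_mul]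
  | add x x' hx hx' =>
    rw [mul_add, smul_add, hx, hx', map_add]
    simp only [add_mul, sub_mul]
    abel
  | tmul f w =>
    induction y using TensorProduct.induction_on with
    | zero => simp only [map_zero, mul_zero, zero_mul, smul_zero, add_zero]
    | add x x' hx hx' => rw [add_mul, smul_add, hx, hx', map_add]; noncomm_ring
    | tmul g u =>
      rw [spar_tmul, spar_tmul, ← TensorProduct.tmul_add, ← TensorProduct.tmul_sub,
        Algebra.TensorProduct.tmul_mul_tmul, Algebra.TensorProduct.tmul_mul_tmul,
        Algebra.TensorProduct.tmul_mul_tmul, ← TensorProduct.tmul_smul, exterior_mul_comm,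
        TensorProduct.tmul_add, mul_comm g]

/-- The projection onto the component of parity `p`. -/
noncomputable def proj (p : ℕ) : SForm M →ₗ[ℂ] SForm M :=
  (1 / 2 : ℂ) • (LinearMap.id + (-1 : ℂ) ^ p • spar)

theorem proj_apply (p : ℕ) (x : SForm M) :
    proj p x = (1 / 2 : ℂ) • (x + (-1 : ℂ) ^ p • spar x) := rfl

theorem neg_one_pow_sq (p : ℕ) : (-1 : ℂ) ^ p * (-1 : ℂ) ^ p = 1 := by
  rw [← mul_pow]; norm_num

theorem spar_proj (p : ℕ) (x : SForm M) : spar (proj p x) = (-1 : ℂ) ^ p • proj p x := by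
  rw [proj_apply, map_smul, map_add, map_smul, spar_spar, smul_comm ((-1 : ℂ) ^ p) (1 / 2 : ℂ),
    smul_add ((-1 : ℂ) ^ p) x, smul_smul ((-1 : ℂ) ^ p), neg_one_pow_sq, one_smul, add_comm]

theorem proj_eq_self {p : ℕ} {x : SForm M} (h : spar x = (-1 : ℂ) ^ p • x) : proj p x = x := by
  rw [proj_apply, h, smul_smul, neg_one_pow_sq]; module

theorem coef_proj (T : Smooth →ₗ[ℂ] Smooth) (p : ℕ) (x : SForm M) :
    coef T (proj p x) = proj p (coef T x) := by
  rw [proj_apply, proj_apply, map_smul, map_add, map_smul, coef_spar]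

theorem proj_zero_add_proj_one (x : SForm M) : proj 0 x + proj 1 x = x := by
  rw [proj_apply, proj_apply]; simp only [pow_zero, pow_one]; module

theorem sform_comm_of_parity {p q : ℕ} {x y : SForm M} (hx : spar x = (-1 : ℂ) ^ p • x)
    (hy : spar y = (-1 : ℂ) ^ q • y) : x * y = (-1 : ℂ) ^ (p * q) • (y * x) := by
  have h := sform_mul_comm y x
  rw [hx, hy] at h
  have h2 : x * y = (1 / 2 : ℂ) • ((2 : ℂ) • (x * y)) := by module
  rw [h2, h]
  rw [pow_mul]
  simp only [add_mul, sub_mul, smul_mul_assoc, mul_smul_comm]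
  rcases neg_one_pow_eq_or ℂ p with hp | hp <;> rcases Nat.even_or_odd q with hq | hq <;>
    rw [hp, hq.neg_one_pow] <;> module

end SuperForms

/-! ### Koszul complexes -/

/-- Exactness of a Koszul complex `∑ e_k T_k`, in terms of exterior multiplications `e_k`,
contractions `c_k` and commuting operators `T_k` such that each `T_m` is surjective on the common
kernel of its predecessors: a closed element is cohomologous to one that is free of the generators
and annihilated by all the `T_k`. The generators are removed from the element one by one. -/
theorem koszul_exact {X : Type} [AddCommGroup X] [Module ℂ X] (e c T : Fin 5 → X →ₗ[ℂ] X)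
    (d : X →ₗ[ℂ] X) (hd : ∀ x, d x = ∑ k, e k (T k x)) (hdd : ∀ x, d (d x) = 0)
    (hce : ∀ i k x, c i (e k x) = (if i = k then x else 0) - e k (c i x))
    (hcc : ∀ i k x, c i (c k x) = -c k (c i x))
    (hcc' : ∀ i x, c i (c i x) = 0)
    (hcT : ∀ i k x, c i (T k x) = T k (c i x)) (heT : ∀ i k x, e i (T k x) = T k (e i x))
    (S : Submodule ℂ X) (hSe : ∀ i, ∀ x ∈ S, e i x ∈ S) (hSc : ∀ i, ∀ x ∈ S, c i x ∈ S)
    (hST : ∀ i, ∀ x ∈ S, T i x ∈ S)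
    (hreg : ∀ m, ∀ u ∈ S, (∀ i < m, T i u = 0) → ∃ v ∈ S, T m v = u ∧ ∀ i < m, T i v = 0)
    (x : X) (hxS : x ∈ S) (hx : d x = 0) :
    ∃ y ∈ S, (∀ i, c i (x - d y) = 0) ∧ ∀ i, T i (x - d y) = 0 := by
  have hcd : ∀ i x, c i (d x) = T i x - d (c i x) := by
    intro i x
    simp only [hd, map_sum, hce, Finset.sum_sub_distrib, hcT, Finset.sum_ite_eq, Finset.mem_univ,
      if_true]
  have key : ∀ n ≤ 5, ∃ y ∈ S, ∀ i : Fin 5, i.val < n → c i (x - d y) = 0 := by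
    intro n
    induction n with
    | zero => exact fun _ => ⟨0, S.zero_mem, fun i hi => absurd hi (Nat.not_lt_zero _)⟩
    | succ n ih =>
      intro hn
      obtain ⟨y, hyS, hy⟩ := ih (by omega)
      obtain ⟨m, hm⟩ : ∃ m : Fin 5, m.val = n := ⟨⟨n, by omega⟩, rfl⟩
      subst hm
      have hdx' : d (x - d y) = 0 := by rw [map_sub, hx, hdd, sub_zero]
      have hSd : ∀ z ∈ S, d z ∈ S := by
        intro z hz; rw [hd]; exact S.sum_mem fun k _ => hSe _ _ (hST _ _ hz)
      have hx'S : x - d y ∈ S := S.sub_mem hxS (hSd _ hyS)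
      obtain ⟨x', hx'⟩ : ∃ x', x' = x - d y := ⟨_, rfl⟩
      rw [← hx'] at hy hdx' hx'S
      -- `c i` anticommutes with `d` up to `T i`, and `x'` is closed and free of the generators below
      -- `m`
      have hTx' : ∀ i < m, T i x' = 0 := by
        intro i hi
        have h := hcd i x'
        rw [hdx', hy i hi, map_zero, map_zero, sub_zero] at h
        exact h.symm
      have hcu : ∀ i ≤ m, c i (c m x') = 0 := by
        intro i hi
        rcases hi.lt_or_eq with h | h
        · rw [hcc, hy i h, map_zero, neg_zero]
        · rw [h, hcc']
      -- the operators `c j ∘ e j` make a solution `v` of `T m v = c m x'` free of the generators up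
      -- to `m`, one by one, without changing `T m v`
      have hv : ∀ k ≤ m.val + 1, ∃ v ∈ S, T m v = c m x' ∧ (∀ i < m, T i v = 0) ∧
          ∀ i : Fin 5, i.val < k → c i v = 0 := by
        intro k
        induction k with
        | zero =>
          intro _
          obtain ⟨v, hvS, h1, h2⟩ := hreg m (c m x') (hSc _ _ hx'S)
            (fun i hi => by rw [← hcT, hTx' i hi, map_zero])
          exact ⟨v, hvS, h1, h2, fun i hi => absurd hi (Nat.not_lt_zero _)⟩
        | succ k ihk =>
          intro hk
          obtain ⟨v, hvS, h1, h2, h3⟩ := ihk (by omega)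
          obtain ⟨j, hj⟩ : ∃ j : Fin 5, j.val = k := ⟨⟨k, by omega⟩, rfl⟩
          subst hj
          refine ⟨c j (e j v), hSc _ _ (hSe _ _ hvS), ?_, fun i hi => ?_, fun i hi => ?_⟩
          · rw [← hcT, ← heT, h1, hce, if_pos rfl, hcu j (by rw [Fin.le_def]; omega), map_zero,
              sub_zero]
          · rw [← hcT, ← heT, h2 i hi, map_zero, map_zero]
          · rcases Nat.lt_succ_iff_lt_or_eq.1 hi with h | h
            · have hij : i ≠ j := fun hh => by rw [hh] at h; exact lt_irrefl _ h
              rw [hcc, hce, if_neg hij, h3 i h, map_zero, sub_zero, map_zero, neg_zero]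
            · rw [Fin.ext h, hcc']
      obtain ⟨v, hvS, h1, h2, h3⟩ := hv _ le_rfl
      refine ⟨y + v, S.add_mem hyS hvS, fun i hi => ?_⟩
      rw [map_add, ← sub_sub, ← hx', map_sub, hcd, h3 i hi, map_zero, sub_zero]
      rcases Nat.lt_succ_iff_lt_or_eq.1 hi with h | h
      · rw [hy i h, h2 i h, sub_zero]
      · rw [Fin.ext h, h1, sub_self]
  obtain ⟨y, hyS, hy⟩ := key 5 le_rfl
  refine ⟨y, hyS, fun i => hy i i.isLt, fun i => ?_⟩
  have h := hcd i (x - d y)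
  rw [map_sub, hx, hdd, sub_zero, map_zero, hy i i.isLt, map_zero, sub_zero] at h
  exact h.symm

/-! ### Coordinates of forms -/

section Coordinates

variable {M N : Type} [AddCommGroup M] [Module ℂ M] [AddCommGroup N] [Module ℂ N]

/-- The value of a form at a point, an element of the exterior algebra. -/
noncomputable def ev (z : Fin 5 → ℂ) : SForm M →ₗ[ℂ] ExteriorAlgebra ℂ M :=
  (TensorProduct.lid ℂ _).toLinearMap ∘ₗ
    LinearMap.rTensor _ ((LinearMap.proj z : ((Fin 5 → ℂ) → ℂ) →ₗ[ℂ] ℂ) ∘ₗ Smooth.val.toLinearMap)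

theorem ev_tmul (z : Fin 5 → ℂ) (f : Smooth) (w : ExteriorAlgebra ℂ M) :
    ev z (f ⊗ₜ[ℂ] w) = f.1 z • w := rfl

theorem ev_mul (z : Fin 5 → ℂ) (x y : SForm M) : ev z (x * y) = ev z x * ev z y := by
  induction x using TensorProduct.induction_on with
  | zero => simp only [map_zero, zero_mul]
  | add x x' hx hx' => simp only [map_add, add_mul, hx, hx']
  | tmul f w =>
    induction y using TensorProduct.induction_on with
    | zero => simp only [map_zero, mul_zero]
    | add x x' hx hx' => simp only [map_add, mul_add, hx, hx']
    | tmul g u =>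
      rw [Algebra.TensorProduct.tmul_mul_tmul, ev_tmul, ev_tmul, ev_tmul, smul_mul_smul_comm]
      rfl

theorem ev_extn (z : Fin 5 → ℂ) (S : ExteriorAlgebra ℂ M →ₗ[ℂ] ExteriorAlgebra ℂ N)
    (x : SForm M) : ev z (extn S x) = S (ev z x) := by
  induction x using TensorProduct.induction_on with
  | zero => simp only [map_zero]
  | add x y hx hy => simp only [map_add, hx, hy]
  | tmul f w => rw [extn_tmul, ev_tmul, ev_tmul, map_smul]

/-- A basis of the exterior algebra. -/
noncomputable def extBasis : Module.Basis (Module.Basis.ofVectorSpaceIndex ℂ (ExteriorAlgebra ℂ M)) ℂ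
    (ExteriorAlgebra ℂ M) := Module.Basis.ofVectorSpace ℂ _

/-- The coefficients of a form with respect to a basis of the exterior algebra. -/
noncomputable def crd (i : Module.Basis.ofVectorSpaceIndex ℂ (ExteriorAlgebra ℂ M)) :
    SForm M →ₗ[ℂ] Smooth :=
  (TensorProduct.rid ℂ Smooth).toLinearMap ∘ₗ LinearMap.lTensor _ (extBasis.coord i)

theorem crd_tmul (i : Module.Basis.ofVectorSpaceIndex ℂ (ExteriorAlgebra ℂ M)) (f : Smooth)
    (w : ExteriorAlgebra ℂ M) : crd i (f ⊗ₜ[ℂ] w) = extBasis.coord i w • f := rfl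

theorem crd_coef (i : Module.Basis.ofVectorSpaceIndex ℂ (ExteriorAlgebra ℂ M))
    (T : Smooth →ₗ[ℂ] Smooth) (x : SForm M) : crd i (coef T x) = T (crd i x) := by
  induction x using TensorProduct.induction_on with
  | zero => simp only [map_zero]
  | add x y hx hy => simp only [map_add, hx, hy]
  | tmul f w => rw [coef_tmul, crd_tmul, crd_tmul, map_smul]

theorem crd_apply (i : Module.Basis.ofVectorSpaceIndex ℂ (ExteriorAlgebra ℂ M)) (x : SForm M)
    (z : Fin 5 → ℂ) : (crd i x).1 z = extBasis.coord i (ev z x) := by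
  induction x using TensorProduct.induction_on with
  | zero => simp only [map_zero]; rfl
  | add x y hx hy =>
    rw [map_add, map_add, map_add, ← hx, ← hy]; rfl
  | tmul f w => rw [crd_tmul, ev_tmul, map_smul, smul_eq_mul, mul_comm]; rfl

theorem crd_expansion (x : SForm M) :
    ∃ s : Finset (Module.Basis.ofVectorSpaceIndex ℂ (ExteriorAlgebra ℂ M)),
      x = ∑ i ∈ s, crd i x ⊗ₜ[ℂ] extBasis i := by
  classical
  refine ⟨(TensorProduct.equivFinsuppOfBasisRight extBasis x).support, ?_⟩
  conv_lhs => rw [← (TensorProduct.equivFinsuppOfBasisRight (extBasis (M := M))).symm_apply_apply x,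
    TensorProduct.equivFinsuppOfBasisRight_symm_apply]
  rw [Finsupp.sum]
  refine Finset.sum_congr rfl fun i _ => ?_
  rw [TensorProduct.equivFinsuppOfBasisRight_apply]
  rfl

theorem crd_ext {x y : SForm M} (h : ∀ i, crd i x = crd i y) : x = y := by
  rw [← sub_eq_zero]
  obtain ⟨s, hs⟩ := crd_expansion (x - y)
  rw [hs]
  refine Finset.sum_eq_zero fun i _ => ?_
  rw [map_sub, h, sub_self, TensorProduct.zero_tmul]

theorem ev_ext {x y : SForm M} (h : ∀ z, ev z x = ev z y) : x = y :=
  crd_ext fun i => Subtype.ext (funext fun z => by rw [crd_apply, crd_apply, h])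

/-- Forms with coefficients in a space `V` of smooth functions. -/
noncomputable def coefIn (V : Submodule ℂ Smooth) : Submodule ℂ (SForm M) :=
  Submodule.span ℂ {x | ∃ (f : Smooth) (w : ExteriorAlgebra ℂ M), f ∈ V ∧ x = f ⊗ₜ[ℂ] w}

variable {V : Submodule ℂ Smooth}

theorem tmul_mem_coefIn {f : Smooth} (hf : f ∈ V) (w : ExteriorAlgebra ℂ M) :
    f ⊗ₜ[ℂ] w ∈ coefIn (M := M) V := Submodule.subset_span ⟨f, w, hf, rfl⟩

theorem coefIn_le {S : Submodule ℂ (SForm M)} (h : ∀ f ∈ V, ∀ w, f ⊗ₜ[ℂ] w ∈ S) :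
    coefIn V ≤ S := by
  refine Submodule.span_le.2 ?_
  rintro _ ⟨f, w, hf, rfl⟩
  exact h f hf w

theorem mem_coefIn_iff {x : SForm M} : x ∈ coefIn V ↔ ∀ i, crd i x ∈ V := by
  constructor
  · intro hx i
    exact coefIn_le (S := V.comap (crd i)) (fun f hf w => V.smul_mem _ hf) hx
  · intro h
    obtain ⟨s, hs⟩ := crd_expansion x
    rw [hs]
    exact Submodule.sum_mem _ fun i _ => tmul_mem_coefIn (h i) _

theorem mem_coefIn_top (x : SForm M) : x ∈ coefIn (M := M) (⊤ : Submodule ℂ Smooth) :=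
  mem_coefIn_iff.2 fun _ => Submodule.mem_top

theorem extn_mem_coefIn (S : ExteriorAlgebra ℂ M →ₗ[ℂ] ExteriorAlgebra ℂ N) {x : SForm M}
    (hx : x ∈ coefIn V) : extn S x ∈ coefIn V :=
  coefIn_le (S := (coefIn V).comap (extn S)) (fun _ hf _ => tmul_mem_coefIn hf _) hx

theorem coef_mem_coefIn {T : Smooth →ₗ[ℂ] Smooth} (hT : ∀ f ∈ V, T f ∈ V) {x : SForm M}
    (hx : x ∈ coefIn V) : coef T x ∈ coefIn V :=
  coefIn_le (S := (coefIn V).comap (coef T)) (fun _ hf _ => tmul_mem_coefIn (hT _ hf) _) hx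

theorem mul_mem_coefIn (hV : ∀ f ∈ V, ∀ g ∈ V, f * g ∈ V) {x y : SForm M}
    (hx : x ∈ coefIn V) (hy : y ∈ coefIn V) : x * y ∈ coefIn V := by
  refine coefIn_le (S := (coefIn V).comap (LinearMap.mulRight ℂ y)) (fun f hf w => ?_) hx
  refine coefIn_le (S := (coefIn V).comap (LinearMap.mulLeft ℂ (f ⊗ₜ[ℂ] w))) (fun g hg u => ?_) hy
  change (f ⊗ₜ[ℂ] w) * (g ⊗ₜ[ℂ] u) ∈ coefIn (M := M) V
  rw [Algebra.TensorProduct.tmul_mul_tmul]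
  exact tmul_mem_coefIn (hV f hf g hg) _

/-- The operators `∂/∂zⁱ` and `∂/∂z̄ⁱ` as one family. -/
noncomputable def wir : Fin 5 ⊕ Fin 5 → Derivation ℂ Smooth Smooth := Sum.elim dz dzbar

theorem wir_comm (k l : Fin 5 ⊕ Fin 5) (f : Smooth) :
    wir k (wir l f) = wir l (wir k f) := by
  rcases k with k | k <;> rcases l with l | l
  · exact dz_dz k l f
  · exact dz_dzbar k l f
  · exact (dz_dzbar l k f).symm
  · exact dzbar_dzbar k l f

/-- A space of smooth functions, stable under differentiation, in which each of the equations
`∂g/∂zᵏ = f` and `∂g/∂z̄ᵏ = f` has a solution `g` that is annihilated by all the other Wirtinger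
derivatives that annihilate `f`. -/
structure Solvable (V : Submodule ℂ Smooth) : Prop where
  stable : ∀ k, ∀ f ∈ V, wir k f ∈ V
  solve : ∀ k, ∀ f ∈ V, ∃ g ∈ V, wir k g = f ∧ ∀ l ≠ k, wir l f = 0 → wir l g = 0

/-- The Wirtinger derivatives of the coefficients of a form. -/
noncomputable def cwir (k : Fin 5 ⊕ Fin 5) : SForm M →ₗ[ℂ] SForm M := coef (wir k).toLinearMap

theorem cwir_comm (k l : Fin 5 ⊕ Fin 5) (x : SForm M) : cwir k (cwir l x) = cwir l (cwir k x) :=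
  coef_comm (wir_comm k l) x

theorem Solvable.cwir_mem (hV : Solvable V) (k : Fin 5 ⊕ Fin 5) {x : SForm M}
    (hx : x ∈ coefIn V) : cwir k x ∈ coefIn V := coef_mem_coefIn (hV.stable k) hx

theorem Solvable.solve_form (hV : Solvable V) (k : Fin 5 ⊕ Fin 5) {x : SForm M}
    (hx : x ∈ coefIn V) :
    ∃ y ∈ coefIn (M := M) V, cwir k y = x ∧ ∀ l ≠ k, cwir l x = 0 → cwir l y = 0 := by
  rw [mem_coefIn_iff] at hx
  choose g hgV hg hgl using fun i => hV.solve k (crd i x) (hx i)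
  obtain ⟨s, hs⟩ := crd_expansion x
  refine ⟨∑ i ∈ s, g i ⊗ₜ[ℂ] extBasis i, Submodule.sum_mem _ fun i _ => tmul_mem_coefIn (hgV i) _,
    ?_, fun l hl h => ?_⟩
  · rw [map_sum]
    conv_rhs => rw [hs]
    exact Finset.sum_congr rfl fun i _ => by rw [cwir, coef_tmul, Derivation.coeFn_coe, hg]
  · rw [map_sum]
    refine Finset.sum_eq_zero fun i _ => ?_
    rw [cwir, coef_tmul, Derivation.coeFn_coe, hgl i l hl, TensorProduct.zero_tmul]
    have h2 := congrArg (crd i) h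
    rwa [cwir, crd_coef, map_zero] at h2

end Coordinates

/-! ### Contractions and the constant component -/

/-- Contraction with the `i`-th coordinate form. -/
noncomputable def conE (i : Fin 5) : AntiHol →ₗ[ℂ] AntiHol := con (LinearMap.proj i)

theorem conE_dzb_mul (i k : Fin 5) (x : AntiHol) :
    conE i (dzb k * x) = (if i = k then x else 0) - dzb k * conE i x := by
  rw [conE, dzb, con_ι_mul]
  congr 1
  simp [Pi.single_apply]

theorem dzb_mul_dzb (i k : Fin 5) (x : AntiHol) : dzb i * (dzb k * x) = -(dzb k * (dzb i * x)) := by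
  have h : dzb i * dzb k = -(dzb k * dzb i) :=
    eq_neg_of_add_eq_zero_left (ExteriorAlgebra.ι_add_mul_swap (R := ℂ) _ _)
  rw [← mul_assoc, ← mul_assoc, h, neg_mul]

theorem dzb_sq (k : Fin 5) (x : AntiHol) : dzb k * (dzb k * x) = 0 := by
  rw [← mul_assoc, dzb, ExteriorAlgebra.ι_sq_zero, zero_mul]

theorem antiHol_induction {P : AntiHol → Prop} (x : AntiHol)
    (algebraMap : ∀ r : ℂ, P (algebraMap _ _ r)) (add : ∀ x y, P x → P y → P (x + y))
    (smul : ∀ (r : ℂ) x, P x → P (r • x))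
    (dzb_mul : ∀ k x, P x → P (dzb k * x)) : P x := by
  induction x using exterior_induction with
  | algebraMap r => exact algebraMap r
  | add x y hx hy => exact add x y hx hy
  | ι_mul x v hx =>
    have hv : v = ∑ k, v k • Pi.single k (1 : ℂ) := by
      funext j; simp [Finset.sum_apply, Pi.single_apply]
    rw [hv, map_sum, Finset.sum_mul]
    refine Finset.sum_induction _ P add ?_ fun k _ => ?_
    · have := algebraMap 0; rwa [map_zero] at this
    · rw [map_smul, smul_mul_assoc]
      exact smul _ _ (dzb_mul k x hx)

/-- An element of the exterior algebra annihilated by all contractions is a constant: apply the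
projections `1 - dz̄ⁱ c_i`, which annihilate all the products `dz̄ᵏ x`. -/
theorem eq_const_of_conE (x : AntiHol) (h : ∀ i, conE i x = 0) :
    x = algebraMap ℂ _ (ExteriorAlgebra.algebraMapInv x) := by
  let L : Fin 5 → AntiHol →ₗ[ℂ] AntiHol := fun i => LinearMap.id - LinearMap.mulLeft ℂ (dzb i) ∘ₗ conE i
  have hL : ∀ i y, L i y = y - dzb i * conE i y := fun _ _ => rfl
  have hL1 : ∀ i y, L i (dzb i * y) = 0 := by
    intro i y
    rw [hL, conE_dzb_mul, if_pos rfl, mul_sub, dzb_sq, sub_zero, sub_self]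
  have hL2 : ∀ i k y, i ≠ k → L i (dzb k * y) = dzb k * L i y := by
    intro i k y hik
    rw [hL, hL, conE_dzb_mul, if_neg hik, zero_sub, mul_neg, mul_sub, dzb_mul_dzb i k]
    abel
  have hR : ∀ y, L 0 (L 1 (L 2 (L 3 (L 4 y)))) = algebraMap ℂ _ (ExteriorAlgebra.algebraMapInv y) := by
    intro y
    induction y using antiHol_induction with
    | algebraMap r =>
      have hr : ∀ i, L i (algebraMap ℂ _ r) = algebraMap ℂ _ r := by
        intro i; rw [hL, conE, con_algebraMap, mul_zero, sub_zero]
      rw [hr, hr, hr, hr, hr, ExteriorAlgebra.algebraMap_leftInverse]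
    | add x y hx hy => simp only [map_add] at hx hy ⊢; rw [hx, hy]
    | smul r x hx =>
      simp only [map_smul] at hx ⊢
      rw [hx, smul_eq_mul, map_mul, Algebra.smul_def]
    | dzb_mul k x hx =>
      have h0 : ExteriorAlgebra.algebraMapInv (dzb k * x) = 0 := by
        rw [map_mul, dzb]
        have : ExteriorAlgebra.algebraMapInv (ExteriorAlgebra.ι ℂ (Pi.single k (1 : ℂ) : Fin 5 → ℂ)) = (0 : ℂ) := by
          simp [ExteriorAlgebra.algebraMapInv]
        rw [this, zero_mul]
      rw [h0, map_zero]
      fin_cases k <;> simp [hL1, hL2]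
  have hx : ∀ i, L i x = x := fun i => by rw [hL, h, mul_zero, sub_zero]
  rw [← hR, hx, hx, hx, hx, hx]

/-- The component of form degree zero. -/
noncomputable def cst : Dol →ₗ[ℂ] Smooth :=
  (TensorProduct.rid ℂ Smooth).toLinearMap ∘ₗ
    LinearMap.lTensor _ ExteriorAlgebra.algebraMapInv.toLinearMap

theorem cst_tmul (f : Smooth) (w : AntiHol) :
    cst (f ⊗ₜ[ℂ] w) = ExteriorAlgebra.algebraMapInv w • f := rfl

theorem cst_tmul_one (f : Smooth) : cst (f ⊗ₜ[ℂ] 1) = f := by rw [cst_tmul, map_one, one_smul]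

theorem cst_coef (T : Smooth →ₗ[ℂ] Smooth) (x : Dol) : cst (coef T x) = T (cst x) := by
  induction x using TensorProduct.induction_on with
  | zero => simp only [map_zero]
  | add x y hx hy => simp only [map_add, hx, hy]
  | tmul f w => rw [coef_tmul, cst_tmul, cst_tmul, map_smul]

theorem eq_cst_of_conE (x : Dol) (h : ∀ i, extn (conE i) x = 0) : x = cst x ⊗ₜ[ℂ] 1 := by
  refine ev_ext fun z => ?_
  have h1 := eq_const_of_conE (ev z x) (fun i => by rw [← ev_extn, h, map_zero])
  have h2 : ∀ y : Dol, ev z (cst y ⊗ₜ[ℂ] (1 : AntiHol))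
      = algebraMap ℂ _ (ExteriorAlgebra.algebraMapInv (ev z y)) := by
    intro y
    induction y using TensorProduct.induction_on with
    | zero => simp only [map_zero, TensorProduct.zero_tmul]
    | add x y hx hy => simp only [map_add, TensorProduct.add_tmul, hx, hy]
    | tmul f w =>
      rw [cst_tmul, ev_tmul, ev_tmul, map_smul, Algebra.algebraMap_eq_smul_one, smul_eq_mul, mul_comm]
      rfl
  rw [h2, ← h1]

theorem cst_mem {V : Submodule ℂ Smooth} {x : Dol} (hx : x ∈ coefIn V) : cst x ∈ V :=
  coefIn_le (S := V.comap cst) (fun _ hf _ => V.smul_mem _ hf) hx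

theorem par_eq (x : Dol) : par x = spar x := rfl

theorem D_eq (i : Fin 5) (x : Dol) : D i x = cwir (Sum.inl i) x := rfl

theorem dbar_eq (x : Dol) :
    dbar x = ∑ k, extn (LinearMap.mulLeft ℂ (dzb k)) (cwir (Sum.inr k) x) := by
  induction x using TensorProduct.induction_on with
  | zero => simp only [map_zero, Finset.sum_const_zero]
  | add x y hx hy => simp only [map_add, Finset.sum_add_distrib, hx, hy]
  | tmul f w => rw [dbar, LinearMap.sum_apply]; rfl

theorem cst_par (x : Dol) : cst (par x) = cst x := by
  induction x using TensorProduct.induction_on with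
  | zero => simp only [map_zero]
  | add x y hx hy => simp only [map_add, hx, hy]
  | tmul f w =>
    rw [par_eq, spar_tmul, cst_tmul, cst_tmul]
    congr 1
    induction w using exterior_induction with
    | algebraMap r => rw [AlgHom.commutes]
    | add x y hx hy => rw [map_add, map_add, map_add, hx, hy]
    | ι_mul x v hx => rw [map_mul, map_mul, map_mul, invol_ι]; simp [ExteriorAlgebra.algebraMapInv]

theorem cst_dbar (x : Dol) : cst (dbar x) = 0 := by
  rw [dbar_eq, map_sum]
  refine Finset.sum_eq_zero fun k _ => ?_
  generalize cwir (Sum.inr k) x = y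
  induction y using TensorProduct.induction_on with
  | zero => simp only [map_zero]
  | add x y hx hy => simp only [map_add, hx, hy, add_zero]
  | tmul f w =>
    rw [extn_tmul, cst_tmul, LinearMap.mulLeft_apply, map_mul, dzb]
    simp [ExteriorAlgebra.algebraMapInv]

theorem dbar_dbar (x : Dol) : dbar (dbar x) = 0 := by
  have h : ∀ k l (y : Dol), extn (LinearMap.mulLeft ℂ (dzb k)) (extn (LinearMap.mulLeft ℂ (dzb l)) y)
      = -extn (LinearMap.mulLeft ℂ (dzb l)) (extn (LinearMap.mulLeft ℂ (dzb k)) y) := by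
    intro k l y
    induction y using TensorProduct.induction_on with
    | zero => simp only [map_zero, neg_zero]
    | add x y hx hy => simp only [map_add, hx, hy, neg_add]
    | tmul f w =>
      simp only [extn_tmul, LinearMap.mulLeft_apply]
      rw [dzb_mul_dzb, TensorProduct.tmul_neg]
  have h2 : dbar (dbar x) = -dbar (dbar x) := by
    conv_lhs => rw [dbar_eq, dbar_eq]
    conv_rhs => rw [dbar_eq, dbar_eq]
    simp only [map_sum]
    conv_lhs => rw [Finset.sum_comm]
    rw [← Finset.sum_neg_distrib]
    refine Finset.sum_congr rfl fun k _ => ?_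
    rw [← Finset.sum_neg_distrib]
    refine Finset.sum_congr rfl fun l _ => ?_
    have e : ∀ a b (y : Dol), cwir a (extn (LinearMap.mulLeft ℂ (dzb b)) y)
      = extn (LinearMap.mulLeft ℂ (dzb b)) (cwir a y) := fun a b y => coef_extn _ _ _
    rw [e, e, h, cwir_comm]
  have h3 : (2 : ℂ) • dbar (dbar x) = 0 := by
    rw [two_smul]; exact add_eq_zero_iff_eq_neg.2 h2
  exact (smul_eq_zero.1 h3).resolve_left two_ne_zero

theorem extn_mulLeft (w : AntiHol) (x : Dol) :
    extn (LinearMap.mulLeft ℂ w) x = ((1 : Smooth) ⊗ₜ[ℂ] w) * x := by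
  induction x using TensorProduct.induction_on with
  | zero => simp only [map_zero, mul_zero]
  | add x y hx hy => simp only [map_add, mul_add, hx, hy]
  | tmul f w => rw [Algebra.TensorProduct.tmul_mul_tmul, one_mul]; rfl

theorem mul_dzb (k : Fin 5) (x : Dol) :
    spar x * ((1 : Smooth) ⊗ₜ[ℂ] dzb k) = ((1 : Smooth) ⊗ₜ[ℂ] dzb k) * x := by
  induction x using TensorProduct.induction_on with
  | zero => simp only [map_zero, mul_zero, zero_mul]
  | add x y hx hy => simp only [map_add, mul_add, add_mul, hx, hy]
  | tmul f w =>
    rw [spar_tmul, Algebra.TensorProduct.tmul_mul_tmul, Algebra.TensorProduct.tmul_mul_tmul,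
      one_mul, mul_one, dzb, mul_ι_eq, invol_invol]

/-- The Dolbeault operator is an odd derivation. -/
theorem dbar_mul (x y : Dol) : dbar (x * y) = dbar x * y + par x * dbar y := by
  simp only [dbar_eq, extn_mulLeft, Finset.sum_mul, Finset.mul_sum, ← Finset.sum_add_distrib]
  refine Finset.sum_congr rfl fun k _ => ?_
  rw [cwir, coef_mul, mul_add, par_eq, ← mul_assoc (spar x), mul_dzb, mul_assoc, mul_assoc]

theorem extn_conE_dzb (i k : Fin 5) (x : Dol) :
    extn (conE i) (extn (LinearMap.mulLeft ℂ (dzb k)) x)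
      = (if i = k then x else 0) - extn (LinearMap.mulLeft ℂ (dzb k)) (extn (conE i) x) := by
  induction x using TensorProduct.induction_on with
  | zero => simp only [map_zero, ite_self, sub_zero]
  | add x y hx hy => simp only [map_add, hx, hy]; split_ifs <;> abel
  | tmul f w =>
    simp only [extn_tmul, LinearMap.mulLeft_apply, conE_dzb_mul, TensorProduct.tmul_sub]
    split_ifs
    · rfl
    · rw [TensorProduct.tmul_zero]

theorem extn_conE_conE (i k : Fin 5) (x : Dol) :
    extn (conE i) (extn (conE k) x) = -extn (conE k) (extn (conE i) x) := by
  induction x using TensorProduct.induction_on with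
  | zero => simp only [map_zero, neg_zero]
  | add x y hx hy => simp only [map_add, hx, hy, neg_add]
  | tmul f w =>
    simp only [extn_tmul]
    rw [conE, conE, con_con, TensorProduct.tmul_neg]

theorem extn_conE_sq (i : Fin 5) (x : Dol) : extn (conE i) (extn (conE i) x) = 0 := by
  induction x using TensorProduct.induction_on with
  | zero => simp only [map_zero]
  | add x y hx hy => simp only [map_add, hx, hy, add_zero]
  | tmul f w =>
    simp only [extn_tmul]
    rw [conE, con_con_self, TensorProduct.tmul_zero]

/-- Solvability inside the subspace of forms annihilated by the operators in `Z`: closed forms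
are cohomologous to functions. -/
theorem Solvable.dolbeault {V : Submodule ℂ Smooth} (hV : Solvable V) (Z : Set (Fin 5))
    {x : Dol} (hx : x ∈ coefIn V) (hZ : ∀ i ∈ Z, D i x = 0) (hd : dbar x = 0) :
    ∃ y ∈ coefIn (M := Fin 5 → ℂ) V, (∀ i ∈ Z, D i y = 0) ∧ ∃ f ∈ V,
      (∀ k, dzbar k f = 0) ∧ (∀ i ∈ Z, dz i f = 0) ∧ x = dbar y + f ⊗ₜ[ℂ] 1 := by
  -- the forms with coefficients in `V` that are annihilated by the operators in `Z`
  let S : Submodule ℂ Dol := coefIn V ⊓ ⨅ i ∈ Z, LinearMap.ker (D i)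
  have hS : ∀ x, x ∈ S ↔ x ∈ coefIn V ∧ ∀ i ∈ Z, D i x = 0 := by
    intro x; simp [S, Submodule.mem_iInf]
  have hext : ∀ (R : AntiHol →ₗ[ℂ] AntiHol), ∀ x ∈ S, extn R x ∈ S := by
    intro R x hx
    rw [hS] at hx ⊢
    refine ⟨extn_mem_coefIn R hx.1, fun i hi => ?_⟩
    rw [D_eq, cwir, coef_extn, ← cwir, ← D_eq, hx.2 i hi, map_zero]
  obtain ⟨y, hyS, h1, h2⟩ := koszul_exact
    (fun k => extn (LinearMap.mulLeft ℂ (dzb k))) (fun k => extn (conE k))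
    (fun k => cwir (Sum.inr k)) dbar dbar_eq dbar_dbar
    extn_conE_dzb extn_conE_conE extn_conE_sq
    (fun i k x => (coef_extn _ _ _).symm) (fun i k x => (coef_extn _ _ _).symm)
    S (fun i => hext _) (fun i => hext _)
    (fun i x hx => by
      rw [hS] at hx ⊢
      refine ⟨hV.cwir_mem _ hx.1, fun j hj => ?_⟩
      rw [D_eq, cwir_comm, ← D_eq, hx.2 j hj, map_zero])
    (fun m u hu h => by
      rw [hS] at hu
      obtain ⟨v, hv, h1, h2⟩ := hV.solve_form (Sum.inr m) hu.1
      refine ⟨v, (hS v).2 ⟨hv, fun i hi => h2 (Sum.inl i) (by simp) (hu.2 i hi)⟩, h1,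
        fun i hi => h2 (Sum.inr i) (by simpa using hi.ne) (h i hi)⟩)
    x ((hS x).2 ⟨hx, hZ⟩) hd
  rw [hS] at hyS
  have h3 := eq_cst_of_conE _ h1
  have hdy : dbar y ∈ coefIn (M := Fin 5 → ℂ) V := by
    rw [dbar_eq]
    exact Submodule.sum_mem _ fun k _ => extn_mem_coefIn _ (hV.cwir_mem _ hyS.1)
  refine ⟨y, hyS.1, hyS.2, cst (x - dbar y), cst_mem (sub_mem hx hdy), fun k => ?_, fun i hi => ?_,
    ?_⟩
  · have := cst_coef (dzbar k).toLinearMap (x - dbar y)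
    have h4 : coef (dzbar k).toLinearMap (x - dbar y) = 0 := h2 k
    rw [h4, map_zero] at this
    exact this.symm
  · have := cst_coef (dz i).toLinearMap (x - dbar y)
    have h4 : coef (dz i).toLinearMap (x - dbar y) = 0 := by
      change D i _ = 0
      rw [map_sub, hZ i hi, D_dbar, hyS.2 i hi, map_zero, sub_zero]
    rw [h4, map_zero] at this
    exact this.symm
  · rw [← h3, add_sub_cancel]

/-! ### The bracket as a bidifferential operator -/

/-- Triples `(μⁱ, ω_{ij}, A_{ab})` with components in a vector space `U`. -/
abbrev Raw (U : Type) : Type :=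
  (Fin 5 → U) × (Fin 5 → Fin 5 → U) × Matrix (Fin 32) (Fin 32) U

section Bracket

variable {U V W : Type} [AddCommGroup U] [Module ℂ U] [AddCommGroup V] [Module ℂ V]
  [AddCommGroup W] [Module ℂ W]
variable {U' V' W' : Type} [AddCommGroup U'] [Module ℂ U'] [AddCommGroup V'] [Module ℂ V']
  [AddCommGroup W'] [Module ℂ W']

/-- Apply a linear map to all components. -/
def rawMap (f : U →ₗ[ℂ] V) : Raw U →ₗ[ℂ] Raw V where
  toFun φ := (fun i => f (φ.1 i), fun i j => f (φ.2.1 i j), fun a b => f (φ.2.2 a b))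
  map_add' _ _ := Prod.ext (funext fun _ => map_add f _ _)
    (Prod.ext (funext fun _ => funext fun _ => map_add f _ _)
      (funext fun _ => funext fun _ => map_add f _ _))
  map_smul' _ _ := Prod.ext (funext fun _ => map_smul f _ _)
    (Prod.ext (funext fun _ => funext fun _ => map_smul f _ _)
      (funext fun _ => funext fun _ => map_smul f _ _))

variable (DU : Fin 5 → U →ₗ[ℂ] U) (DV : Fin 5 → V →ₗ[ℂ] V) (DW : Fin 5 → W →ₗ[ℂ] W)
  (m : U →ₗ[ℂ] V →ₗ[ℂ] W)

/-- The vector field component of the bracket: up to sign, the commutator of vector fields. -/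
def brMu (φ : Raw U) (ψ : Raw V) (j : Fin 5) : W :=
  -∑ i, (m (φ.1 i) (DV i (ψ.1 j)) - m (DU i (φ.1 j)) (ψ.1 i))

/-- A one-form whose exterior derivative is the two-form component of the bracket. -/
noncomputable def brTheta (φ : Raw U) (ψ : Raw V) (i : Fin 5) : W :=
  ∑ k, (m (φ.1 k) (ψ.2.1 i k) - m (φ.2.1 i k) (ψ.1 k))
  + (1 / 2 : ℂ) • (∑ a, ∑ b,
      (m (φ.2.2 a b) (DV i (ψ.2.2 b a)) - m (DU i (φ.2.2 b a)) (ψ.2.2 a b)))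
  + ∑ j, ∑ l, (m (DU l (φ.1 j)) (DV i (DV j (ψ.1 l))) - m (DU i (DU j (φ.1 l))) (DV l (ψ.1 j)))

/-- The matrix component of the bracket. -/
def brA (φ : Raw U) (ψ : Raw V) (a b : Fin 32) : W :=
  ∑ c, (m (φ.2.2 a c) (ψ.2.2 c b) - m (φ.2.2 b c) (ψ.2.2 c a))
  + ∑ i, (m (DU i (φ.2.2 a b)) (ψ.1 i) - m (φ.1 i) (DV i (ψ.2.2 a b)))

/-- The bracket of triples, for an arbitrary bilinear product `m` of the components. -/
noncomputable def rawBr (φ : Raw U) (ψ : Raw V) : Raw W :=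
  (brMu DU DV m φ ψ,
    fun i j => DW i (brTheta DU DV m φ ψ j) - DW j (brTheta DU DV m φ ψ i),
    brA DU DV m φ ψ)

/-- The bracket is natural in the product `m`. Its symmetry, its compatibility with the gradings
and with `∂̄`, and the sign rule for odd parameters are all instances of this. -/
theorem rawBr_natural
    {DU : Fin 5 → U →ₗ[ℂ] U} {DV : Fin 5 → V →ₗ[ℂ] V} {DW : Fin 5 → W →ₗ[ℂ] W}
    (m : U →ₗ[ℂ] V →ₗ[ℂ] W)
    {DU' : Fin 5 → U' →ₗ[ℂ] U'} {DV' : Fin 5 → V' →ₗ[ℂ] V'} {DW' : Fin 5 → W' →ₗ[ℂ] W'}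
    (m' : U' →ₗ[ℂ] V' →ₗ[ℂ] W') {f : U →ₗ[ℂ] U'} {g : V →ₗ[ℂ] V'} {h : W →ₗ[ℂ] W'}
    (hf : ∀ i u, DU' i (f u) = f (DU i u)) (hg : ∀ i u, DV' i (g u) = g (DV i u))
    (hh : ∀ i u, DW' i (h u) = h (DW i u)) (hm : ∀ u v, m' (f u) (g v) = h (m u v))
    (φ : Raw U) (ψ : Raw V) :
    rawBr DU' DV' DW' m' (rawMap f φ) (rawMap g ψ) = rawMap h (rawBr DU DV DW m φ ψ) := by
  have hθ : brTheta DU' DV' m' (rawMap f φ) (rawMap g ψ)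
      = fun i => h (brTheta DU DV m φ ψ i) := by
    funext i
    simp only [brTheta, rawMap, LinearMap.coe_mk, AddHom.coe_mk, hf, hg, hm, map_add, map_sum,
      map_sub, map_smul]
  refine Prod.ext ?_ (Prod.ext ?_ ?_)
  · funext j
    simp only [rawBr, brMu, rawMap, LinearMap.coe_mk, AddHom.coe_mk, hf, hg, hm, map_neg, map_sum,
      map_sub]
  · funext i j
    simp only [rawBr, hθ, hh]
    simp only [rawMap, LinearMap.coe_mk, AddHom.coe_mk, map_sub]
  · funext a b
    simp only [rawBr, brA, rawMap, LinearMap.coe_mk, AddHom.coe_mk, hf, hg, hm, map_add, map_sum,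
      map_sub]

theorem brTheta_add_left (φ φ' : Raw U) (ψ : Raw V) :
    brTheta DU DV m (φ + φ') ψ = brTheta DU DV m φ ψ + brTheta DU DV m φ' ψ := by
  funext i
  simp only [brTheta, Prod.fst_add, Prod.snd_add, Pi.add_apply, Matrix.add_apply, map_add,
    LinearMap.add_apply, add_sub_add_comm, Finset.sum_add_distrib, smul_add]
  abel

theorem brTheta_add_right (φ : Raw U) (ψ ψ' : Raw V) :
    brTheta DU DV m φ (ψ + ψ') = brTheta DU DV m φ ψ + brTheta DU DV m φ ψ' := by
  funext i
  simp only [brTheta, Prod.fst_add, Prod.snd_add, Pi.add_apply, Matrix.add_apply, map_add,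
    add_sub_add_comm, Finset.sum_add_distrib, smul_add]
  abel

theorem brTheta_smul_left (c : ℂ) (φ : Raw U) (ψ : Raw V) :
    brTheta DU DV m (c • φ) ψ = c • brTheta DU DV m φ ψ := by
  funext i
  simp only [brTheta, Prod.smul_fst, Prod.smul_snd, Pi.smul_apply, Matrix.smul_apply, map_smul,
    LinearMap.smul_apply, ← smul_sub, ← Finset.smul_sum, smul_add, smul_comm c (1 / 2 : ℂ)]

theorem brTheta_smul_right (c : ℂ) (φ : Raw U) (ψ : Raw V) :
    brTheta DU DV m φ (c • ψ) = c • brTheta DU DV m φ ψ := by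
  funext i
  simp only [brTheta, Prod.smul_fst, Prod.smul_snd, Pi.smul_apply, Matrix.smul_apply, map_smul,
    ← smul_sub, ← Finset.smul_sum, smul_add, smul_comm c (1 / 2 : ℂ)]

theorem rawBr_add_left (φ φ' : Raw U) (ψ : Raw V) :
    rawBr DU DV DW m (φ + φ') ψ = rawBr DU DV DW m φ ψ + rawBr DU DV DW m φ' ψ := by
  refine Prod.ext (funext fun j => ?_) (Prod.ext (funext fun i => funext fun j => ?_)
    (funext fun a => funext fun b => ?_))
  · simp only [rawBr, brMu, Prod.fst_add, Pi.add_apply, map_add, LinearMap.add_apply,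
      add_sub_add_comm, Finset.sum_add_distrib, neg_add]
  · simp only [rawBr, brTheta_add_left, Prod.fst_add, Prod.snd_add, Pi.add_apply, map_add]
    abel
  · change brA DU DV m (φ + φ') ψ a b = brA DU DV m φ ψ a b + brA DU DV m φ' ψ a b
    simp only [brA, Prod.fst_add, Prod.snd_add, Pi.add_apply, Matrix.add_apply, map_add,
      LinearMap.add_apply, add_sub_add_comm, Finset.sum_add_distrib]
    abel

theorem rawBr_add_right (φ : Raw U) (ψ ψ' : Raw V) :
    rawBr DU DV DW m φ (ψ + ψ') = rawBr DU DV DW m φ ψ + rawBr DU DV DW m φ ψ' := by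
  refine Prod.ext (funext fun j => ?_) (Prod.ext (funext fun i => funext fun j => ?_)
    (funext fun a => funext fun b => ?_))
  · simp only [rawBr, brMu, Prod.fst_add, Pi.add_apply, map_add,
      add_sub_add_comm, Finset.sum_add_distrib, neg_add]
  · simp only [rawBr, brTheta_add_right, Prod.fst_add, Prod.snd_add, Pi.add_apply, map_add]
    abel
  · change brA DU DV m φ (ψ + ψ') a b = brA DU DV m φ ψ a b + brA DU DV m φ ψ' a b
    simp only [brA, Prod.fst_add, Prod.snd_add, Pi.add_apply, Matrix.add_apply, map_add,
      add_sub_add_comm, Finset.sum_add_distrib]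
    abel

theorem rawBr_smul_left (c : ℂ) (φ : Raw U) (ψ : Raw V) :
    rawBr DU DV DW m (c • φ) ψ = c • rawBr DU DV DW m φ ψ := by
  refine Prod.ext (funext fun j => ?_) (Prod.ext (funext fun i => funext fun j => ?_)
    (funext fun a => funext fun b => ?_))
  · simp only [rawBr, brMu, Prod.smul_fst, Pi.smul_apply, map_smul, LinearMap.smul_apply,
      ← smul_sub, ← Finset.smul_sum, smul_neg]
  · simp only [rawBr, brTheta_smul_left, Prod.smul_fst, Prod.smul_snd, Pi.smul_apply, map_smul,
      smul_sub]
  · change brA DU DV m (c • φ) ψ a b = c • brA DU DV m φ ψ a b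
    simp only [brA, Prod.smul_fst, Prod.smul_snd, Pi.smul_apply, Matrix.smul_apply, map_smul,
      LinearMap.smul_apply, ← smul_sub, ← Finset.smul_sum, smul_add]

theorem rawBr_smul_right (c : ℂ) (φ : Raw U) (ψ : Raw V) :
    rawBr DU DV DW m φ (c • ψ) = c • rawBr DU DV DW m φ ψ := by
  refine Prod.ext (funext fun j => ?_) (Prod.ext (funext fun i => funext fun j => ?_)
    (funext fun a => funext fun b => ?_))
  · simp only [rawBr, brMu, Prod.smul_fst, Pi.smul_apply, map_smul,
      ← smul_sub, ← Finset.smul_sum, smul_neg]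
  · simp only [rawBr, brTheta_smul_right, Prod.smul_fst, Prod.smul_snd, Pi.smul_apply, map_smul,
      smul_sub]
  · change brA DU DV m φ (c • ψ) a b = c • brA DU DV m φ ψ a b
    simp only [brA, Prod.smul_fst, Prod.smul_snd, Pi.smul_apply, Matrix.smul_apply, map_smul,
      ← smul_sub, ← Finset.smul_sum, smul_add]

theorem rawBr_add_product (m' : U →ₗ[ℂ] V →ₗ[ℂ] W) (φ : Raw U) (ψ : Raw V) :
    rawBr DU DV DW (m + m') φ ψ = rawBr DU DV DW m φ ψ + rawBr DU DV DW m' φ ψ := by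
  have hθ : brTheta DU DV (m + m') φ ψ = brTheta DU DV m φ ψ + brTheta DU DV m' φ ψ := by
    funext i
    simp only [brTheta, Pi.add_apply, LinearMap.add_apply, add_sub_add_comm,
      Finset.sum_add_distrib, smul_add]
    abel
  refine Prod.ext (funext fun j => ?_) (Prod.ext (funext fun i => funext fun j => ?_)
    (funext fun a => funext fun b => ?_))
  · simp only [rawBr, brMu, Prod.fst_add, Pi.add_apply, LinearMap.add_apply,
      add_sub_add_comm, Finset.sum_add_distrib, neg_add]
  · simp only [rawBr, hθ, Prod.fst_add, Prod.snd_add, Pi.add_apply, map_add]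
    abel
  · change brA DU DV (m + m') φ ψ a b = brA DU DV m φ ψ a b + brA DU DV m' φ ψ a b
    simp only [brA, LinearMap.add_apply, add_sub_add_comm, Finset.sum_add_distrib]
    abel

theorem rawBr_flip (φ : Raw U) (ψ : Raw V) (hφ : ∀ a b, φ.2.2 a b = -φ.2.2 b a)
    (hψ : ∀ a b, ψ.2.2 a b = -ψ.2.2 b a) :
    rawBr DU DV DW m φ ψ = -rawBr DV DU DW m.flip ψ φ := by
  have hθ : brTheta DU DV m φ ψ = -brTheta DV DU m.flip ψ φ := by
    funext i
    simp only [brTheta, LinearMap.flip_apply, Pi.neg_apply, neg_add, ← smul_neg,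
      ← Finset.sum_neg_distrib, neg_sub]
  refine Prod.ext ?_ (Prod.ext ?_ ?_)
  · funext j
    change brMu DU DV m φ ψ j = -brMu DV DU m.flip ψ φ j
    simp only [brMu, LinearMap.flip_apply, ← Finset.sum_neg_distrib, neg_sub]
  · funext i j
    change _ = -(DW i (brTheta DV DU m.flip ψ φ j) - DW j (brTheta DV DU m.flip ψ φ i))
    simp only [rawBr, hθ, Pi.neg_apply, map_neg]
    abel
  · funext a b
    change brA DU DV m φ ψ a b = -brA DV DU m.flip ψ φ a b
    simp only [brA, LinearMap.flip_apply, neg_add, ← Finset.sum_neg_distrib, neg_sub]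
    congr 1
    refine Finset.sum_congr rfl fun c _ => ?_
    rw [hφ c a, hφ c b, hψ b c, hψ a c]
    simp only [map_neg, LinearMap.neg_apply, neg_neg]

/-- The conditions that cut out the fields among the triples. -/
def Constraint (φ : Raw U) : Prop :=
  (∑ i, DU i (φ.1 i) = 0) ∧ (∀ i j, φ.2.1 i j = -φ.2.1 j i) ∧
  (∀ i j k, DU i (φ.2.1 j k) + DU j (φ.2.1 k i) + DU k (φ.2.1 i j) = 0) ∧
  (∀ a b, φ.2.2 a b = -φ.2.2 b a)

variable {DU DV DW m}

theorem Constraint.rawBr {φ : Raw U} {ψ : Raw V} (hφ : Constraint DU φ) (hψ : Constraint DV ψ)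
    (hU : ∀ i j u, DU i (DU j u) = DU j (DU i u)) (hV : ∀ i j u, DV i (DV j u) = DV j (DV i u))
    (hW : ∀ i j u, DW i (DW j u) = DW j (DW i u))
    (hm : ∀ i u v, DW i (m u v) = m (DU i u) v + m u (DV i v)) :
    Constraint DW (rawBr DU DV DW m φ ψ) := by
  refine ⟨?_, fun i j => ?_, fun i j k => ?_, fun a b => ?_⟩
  · have h1 : ∀ i, ∑ j, DV j (DV i (ψ.1 j)) = 0 := fun i => by
      simp only [fun j => hV j i (ψ.1 j), ← map_sum, hψ.1, map_zero]
    have h2 : ∀ i, ∑ j, DU j (DU i (φ.1 j)) = 0 := fun i => by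
      simp only [fun j => hU j i (φ.1 j), ← map_sum, hφ.1, map_zero]
    change ∑ j, DW j (-∑ i, (m (φ.1 i) (DV i (ψ.1 j)) - m (DU i (φ.1 j)) (ψ.1 i))) = 0
    simp only [map_neg, map_sum, map_sub, hm, Finset.sum_sub_distrib, Finset.sum_add_distrib,
      Finset.sum_neg_distrib]
    rw [Finset.sum_comm (f := fun j i => m (φ.1 i) (DV j (DV i (ψ.1 j)))),
      Finset.sum_comm (f := fun j i => m (DU j (DU i (φ.1 j))) (ψ.1 i)),
      Finset.sum_comm (f := fun j i => m (DU j (φ.1 i)) (DV i (ψ.1 j)))]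
    simp only [← map_sum, ← LinearMap.sum_apply, h1, h2, map_zero, LinearMap.zero_apply,
      Finset.sum_const_zero]
    abel
  · simp only [TypeOneHet.rawBr, neg_sub]
  · simp only [TypeOneHet.rawBr, map_sub]
    rw [hW i j, hW i k, hW j k]
    abel
  · change brA DU DV m φ ψ a b = -brA DU DV m φ ψ b a
    simp only [brA, neg_add, ← Finset.sum_neg_distrib, neg_sub]
    congr 1
    refine Finset.sum_congr rfl fun i _ => ?_
    rw [hφ.2.2.2 a b, hψ.2.2.2 a b]
    simp only [map_neg, LinearMap.neg_apply]
    abel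

end Bracket

/-! ### The bracket of fields -/

theorem D_mul (i : Fin 5) (x y : Dol) : D i (x * y) = D i x * y + x * D i y := coef_mul (dz i) x y

theorem D_comm (i j : Fin 5) (x : Dol) : D i (D j x) = D j (D i x) := coef_comm (dz_dz i j) x

/-- The bracket of two fields, as a triple. -/
noncomputable abbrev dolBr : RawField → RawField → RawField :=
  rawBr D D D (LinearMap.mul ℂ Dol)

theorem dolBr_mem (φ ψ : Fields) : dolBr φ.1 ψ.1 ∈ Fields :=
  Constraint.rawBr (DU := D) (DV := D) (DW := D) (m := LinearMap.mul ℂ Dol) φ.2 ψ.2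
    D_comm D_comm D_comm D_mul

/-- The bracket of fields. -/
noncomputable def ell : Fields →ₗ[ℂ] Fields →ₗ[ℂ] Fields :=
  LinearMap.mk₂ ℂ (fun φ ψ => ⟨dolBr φ.1 ψ.1, dolBr_mem φ ψ⟩)
    (fun _ _ _ => Subtype.ext (rawBr_add_left _ _ _ _ _ _ _))
    (fun _ _ _ => Subtype.ext (rawBr_smul_left _ _ _ _ _ _ _))
    (fun _ _ _ => Subtype.ext (rawBr_add_right _ _ _ _ _ _ _))
    (fun _ _ _ => Subtype.ext (rawBr_smul_right _ _ _ _ _ _ _))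

theorem ell_val (φ ψ : Fields) : (ell φ ψ).1 = dolBr φ.1 ψ.1 := rfl

theorem brst_val (φ : Fields) : (brst φ).1 = rawMap dbar φ.1 := rfl

theorem hasParity_iff (p : ℕ) (φ : Fields) :
    HasParity p φ ↔ rawMap par φ.1 = (-1 : ℂ) ^ p • φ.1 := Iff.rfl

theorem par_mul (x y : Dol) : par (x * y) = par x * par y := spar_mul x y

theorem D_par (i : Fin 5) (x : Dol) : D i (par x) = par (D i x) := coef_spar _ x

theorem par_dbar (x : Dol) : par (dbar x) = -dbar (par x) := by
  have h : ∀ k, par ((1 : Smooth) ⊗ₜ[ℂ] dzb k) = -((1 : Smooth) ⊗ₜ[ℂ] dzb k) := by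
    intro k
    rw [par_eq, spar_tmul, dzb, invol_ι, TensorProduct.tmul_neg]
  simp only [dbar_eq, extn_mulLeft, map_sum, par_mul, h, neg_mul, Finset.sum_neg_distrib]
  congr 1
  exact Finset.sum_congr rfl fun k _ => by rw [cwir, par_eq, par_eq, coef_spar]

theorem rawMap_rawMap {U V W : Type} [AddCommGroup U] [Module ℂ U] [AddCommGroup V] [Module ℂ V]
    [AddCommGroup W] [Module ℂ W] (f : U →ₗ[ℂ] V) (g : V →ₗ[ℂ] W) (φ : Raw U) :
    rawMap g (rawMap f φ) = rawMap (g ∘ₗ f) φ := rfl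

theorem rawMap_eq_zero {U V : Type} [AddCommGroup U] [Module ℂ U] [AddCommGroup V] [Module ℂ V]
    {f : U →ₗ[ℂ] V} (h : ∀ x, f x = 0) (φ : Raw U) : rawMap f φ = 0 :=
  Prod.ext (funext fun _ => h _) (Prod.ext (funext fun _ => funext fun _ => h _)
    (funext fun _ => funext fun _ => h _))

theorem brst_brst (φ : Fields) : brst (brst φ) = 0 :=
  Subtype.ext (rawMap_eq_zero (f := dbar ∘ₗ dbar) dbar_dbar φ.1)

theorem brst_parity (p : ℕ) (φ : Fields) (h : HasParity p φ) : HasParity (p + 1) (brst φ) := by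
  rw [hasParity_iff] at h ⊢
  have h2 : rawMap par (rawMap dbar φ.1) = -rawMap dbar (rawMap par φ.1) :=
    Prod.ext (funext fun _ => par_dbar _) (Prod.ext (funext fun _ => funext fun _ => par_dbar _)
      (funext fun _ => funext fun _ => par_dbar _))
  rw [brst_val, h2, h, map_smul, pow_succ, mul_neg, mul_one, neg_smul]

theorem ell_parity (p q : ℕ) (φ ψ : Fields) (hφ : HasParity p φ) (hψ : HasParity q ψ) :
    HasParity (p + q) (ell φ ψ) := by
  rw [hasParity_iff] at hφ hψ ⊢
  rw [ell_val, dolBr, ← rawBr_natural (LinearMap.mul ℂ Dol) (LinearMap.mul ℂ Dol) (f := par)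
    (g := par) D_par D_par D_par (fun u v => (par_mul u v).symm), hφ, hψ, rawBr_smul_left,
    rawBr_smul_right, smul_smul, pow_add]

theorem rawMap_proj_eq_self {M : Type} [AddCommGroup M] [Module ℂ M] {p : ℕ} {φ : Raw (SForm M)}
    (h : rawMap spar φ = (-1 : ℂ) ^ p • φ) : rawMap (proj p) φ = φ :=
  Prod.ext (funext fun i => proj_eq_self (congrFun (congrArg Prod.fst h) i))
    (Prod.ext (funext fun i => funext fun j =>
      proj_eq_self (congrFun (congrFun (congrArg (fun x => x.2.1) h) i) j))
      (funext fun a => funext fun b =>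
        proj_eq_self (congrFun (congrFun (congrArg (fun x => x.2.2) h) a) b)))

theorem D_proj (p : ℕ) (i : Fin 5) (x : Dol) : D i (proj p x) = proj p (D i x) := coef_proj _ p x

theorem rawBr_mul_flip {p q : ℕ} {φ ψ : RawField} (hφ : rawMap spar φ = (-1 : ℂ) ^ p • φ)
    (hψ : rawMap spar ψ = (-1 : ℂ) ^ q • ψ) :
    rawBr D D D (LinearMap.mul ℂ Dol).flip φ ψ = (-1 : ℂ) ^ (p * q) • dolBr φ ψ := by
  have h1 := rawBr_natural ((LinearMap.mul ℂ Dol).compl₁₂ (proj p) (proj q)) (LinearMap.mul ℂ Dol)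
    (h := LinearMap.id) (fun i x => D_proj p i x) (fun i x => D_proj q i x) (DW := D) (DW' := D)
    (fun _ _ => rfl) (fun _ _ => rfl) φ ψ
  have h2 := rawBr_natural ((LinearMap.mul ℂ Dol).compl₁₂ (proj p) (proj q))
    (LinearMap.mul ℂ Dol).flip
    (h := (-1 : ℂ) ^ (p * q) • LinearMap.id) (fun i x => D_proj p i x) (fun i x => D_proj q i x)
    (DW := D) (DW' := D) (fun i x => map_smul (D i) _ x)
    (fun u v => by
      rw [mul_comm p q]
      exact sform_comm_of_parity (spar_proj q v) (spar_proj p u)) φ ψ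
  rw [rawMap_proj_eq_self hφ, rawMap_proj_eq_self hψ] at h1 h2
  rw [h2, dolBr, h1]
  rfl

theorem ell_skew (p q : ℕ) (φ ψ : Fields) (hφ : HasParity p φ) (hψ : HasParity q ψ) :
    ell φ ψ = -((-1 : ℂ) ^ (p * q) • ell ψ φ) := by
  refine Subtype.ext ?_
  change dolBr φ.1 ψ.1 = -((-1 : ℂ) ^ (p * q) • dolBr ψ.1 φ.1)
  rw [dolBr, rawBr_flip _ _ _ _ _ _ φ.2.2.2.2 ψ.2.2.2.2, rawBr_mul_flip hψ hφ, mul_comm p q]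

theorem dbar_dolBr (φ ψ : RawField) :
    rawMap dbar (dolBr φ ψ) = dolBr (rawMap dbar φ) ψ + dolBr (rawMap par φ) (rawMap dbar ψ) := by
  have hD : ∀ (i : Fin 5) (x : Dol), D i (dbar x) = dbar (D i x) := D_dbar
  have hI : ∀ (i : Fin 5) (x : Dol), D i ((LinearMap.id : Dol →ₗ[ℂ] Dol) x)
    = (LinearMap.id : Dol →ₗ[ℂ] Dol) (D i x) := fun _ _ => rfl
  have h1 := rawBr_natural (LinearMap.mul ℂ Dol)
    ((LinearMap.mul ℂ Dol).compl₁₂ dbar LinearMap.id + (LinearMap.mul ℂ Dol).compl₁₂ par dbar)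
    hI hI hD (fun u v => (dbar_mul u v).symm) φ ψ
  have h2 := rawBr_natural ((LinearMap.mul ℂ Dol).compl₁₂ dbar LinearMap.id) (LinearMap.mul ℂ Dol)
    (h := LinearMap.id) hD hI hI (fun _ _ => rfl) φ ψ
  have h3 := rawBr_natural ((LinearMap.mul ℂ Dol).compl₁₂ par dbar) (LinearMap.mul ℂ Dol)
    (h := LinearMap.id) D_par hD hI (fun _ _ => rfl) φ ψ
  rw [← h1, rawBr_add_product]
  exact congrArg₂ (· + ·) h2.symm h3.symm

theorem brst_ell (p : ℕ) (φ ψ : Fields) (hφ : HasParity p φ) :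
    brst (ell φ ψ) = ell (brst φ) ψ + (-1 : ℂ) ^ p • ell φ (brst ψ) := by
  refine Subtype.ext ?_
  change rawMap dbar (dolBr φ.1 ψ.1)
    = dolBr (rawMap dbar φ.1) ψ.1 + (-1 : ℂ) ^ p • dolBr φ.1 (rawMap dbar ψ.1)
  have h4 : rawMap par φ.1 = (-1 : ℂ) ^ p • φ.1 := hφ
  rw [dbar_dolBr, h4]
  exact congrArg _ (rawBr_smul_left _ _ _ _ _ _ _)

/-! ### The heterotic Lie algebra in terms of triples -/

section Het

variable {F : Type} [CommRing F] [Algebra ℂ F] [PartialDerivatives F]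

open PartialDerivatives

/-- The partial derivatives as linear maps. -/
def pdL (F : Type) [CommRing F] [Algebra ℂ F] [PartialDerivatives F] (i : Fin 5) : F →ₗ[ℂ] F :=
  (pd (F := F) i).toLinearMap

theorem pdL_apply (i : Fin 5) (f : F) : pdL F i f = pd i f := rfl

/-- The exterior derivative of a one-form. -/
def curl (F : Type) [CommRing F] [Algebra ℂ F] [PartialDerivatives F] :
    (Fin 5 → F) →ₗ[ℂ] (Fin 5 → Fin 5 → F) where
  toFun w i j := pd i (w j) - pd j (w i)
  map_add' v w := by funext i j; simp only [Pi.add_apply, map_add]; abel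
  map_smul' c w := by funext i j; simp [smul_sub]

theorem curl_apply (w : Fin 5 → F) (i j : Fin 5) : curl F w i j = pd i (w j) - pd j (w i) := rfl

theorem curl_gradient (f : F) : curl F (gradient F f) = 0 := by
  funext i j
  rw [curl_apply]
  exact sub_eq_zero.2 (pd_comm i j f)

/-- The exterior derivative on one-forms modulo exact ones. -/
def curlQ (F : Type) [CommRing F] [Algebra ℂ F] [PartialDerivatives F] :
    ((Fin 5 → F) ⧸ ExactForms F) →ₗ[ℂ] (Fin 5 → Fin 5 → F) :=
  (ExactForms F).liftQ (curl F) (by rintro _ ⟨f, rfl⟩; exact curl_gradient f)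

theorem curlQ_mk (w : Fin 5 → F) : curlQ F ((ExactForms F).mkQ w) = curl F w := rfl

/-- The triple `(-X, ∂w, α)` of an element `(X, [w], α)` of the heterotic Lie algebra. -/
def toRaw : GHet F →ₗ[ℂ] Raw F where
  toFun x := (-x.vec, curlQ F x.form, x.mat)
  map_add' x y := Prod.ext (neg_add _ _) (Prod.ext (map_add (curlQ F) x.form y.form) rfl)
  map_smul' c x := Prod.ext (smul_neg c x.vec).symm
    (Prod.ext (map_smul (curlQ F) c x.form) rfl)

theorem toRaw_apply (x : GHet F) : toRaw x = (-x.vec, curlQ F x.form, x.mat) := rfl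

/-- The bracket of triples is the bracket of the heterotic Lie algebra. The one-forms agree up
to the differential of the function `s` below, which the exterior derivative annihilates. -/
theorem rawBr_toRaw (x y : GHet F) :
    rawBr (pdL F) (pdL F) (pdL F) (LinearMap.mul ℂ F) (toRaw x) (toRaw y) = toRaw ⁅x, y⁆ := by
  obtain ⟨w, hw⟩ := (ExactForms F).mkQ_surjective x.form
  obtain ⟨w', hw'⟩ := (ExactForms F).mkQ_surjective y.form
  have hform : (⁅x, y⁆ : GHet F).form = (ExactForms F).mkQ (lieDer x.vec w' - lieDer y.vec w
      + ((2 : ℂ) • vecCocycle x.vec y.vec + trCocycle x.mat y.mat)) := by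
    rw [lie_form, ← hw, ← hw', lieDerQ_mk, lieDerQ_mk, ← map_sub, ← map_add]
  have hskew : ∀ a b, y.mat b a = -y.mat a b := fun a b =>
    congrFun (congrFun (show y.mat.transpose = -y.mat from y.mat_mem) a) b
  rw [toRaw_apply, toRaw_apply, toRaw_apply, hform, ← hw, ← hw', curlQ_mk, curlQ_mk, curlQ_mk]
  refine Prod.ext ?_ (Prod.ext ?_ ?_)
  · funext j
    change -∑ i, (-x.vec i * pd i (-y.vec j) - pd i (-x.vec j) * -y.vec i)
      = -(vecDer x.vec (y.vec j) - vecDer y.vec (x.vec j))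
    rw [vecDer_apply, vecDer_apply, ← Finset.sum_sub_distrib]
    congr 1
    refine Finset.sum_congr rfl fun i _ => ?_
    rw [map_neg, map_neg]; ring
  · have key : brTheta (pdL F) (pdL F) (LinearMap.mul ℂ F) (-x.vec, curl F w, x.mat)
        (-y.vec, curl F w', y.mat) = (lieDer x.vec w' - lieDer y.vec w
      + ((2 : ℂ) • vecCocycle x.vec y.vec + trCocycle x.mat y.mat))
        - gradient F ((∑ k, x.vec k * w' k) - (∑ k, y.vec k * w k)
          + (1 / 2 : ℂ) • (∑ a, ∑ b, x.mat a b * y.mat b a)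
          + ∑ j, ∑ l, pd l (x.vec j) * pd j (y.vec l)) := by
      funext i
      have e1 : ∑ k, ((-x.vec) k * curl F w' i k - curl F w i k * (-y.vec) k)
          = lieDer x.vec w' i - lieDer y.vec w i
            - pd i ((∑ k, x.vec k * w' k) - ∑ k, y.vec k * w k) := by
        simp only [lieDer, vecDer_apply, map_sub, map_sum, Derivation.leibniz, smul_eq_mul,
          ← Finset.sum_add_distrib, ← Finset.sum_sub_distrib, curl_apply, Pi.neg_apply]
        refine Finset.sum_congr rfl fun k _ => ?_
        ring
      have e2 : (1 / 2 : ℂ) • (∑ a, ∑ b, (x.mat a b * pd i (y.mat b a) - pd i (x.mat b a) * y.mat a b))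
          = trCocycle x.mat y.mat i
            - pd i ((1 / 2 : ℂ) • (∑ a, ∑ b, x.mat a b * y.mat b a)) := by
        have e3 : trCocycle x.mat y.mat i = ∑ a, ∑ b, x.mat a b * pd i (y.mat b a) := by
          simp [trCocycle, Matrix.trace, Matrix.mul_apply]
        have e4 : (∑ a, ∑ b, pd i (x.mat b a) * y.mat a b)
            = ∑ a, ∑ b, pd i (x.mat a b) * y.mat b a := Finset.sum_comm
        have e5 : pd i (∑ a, ∑ b, x.mat a b * y.mat b a)
            = (∑ a, ∑ b, x.mat a b * pd i (y.mat b a)) + ∑ a, ∑ b, pd i (x.mat a b) * y.mat b a := by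
          simp only [map_sum, Derivation.leibniz, smul_eq_mul, ← Finset.sum_add_distrib]
          refine Finset.sum_congr rfl fun a _ => Finset.sum_congr rfl fun b _ => ?_
          ring
        rw [e3, Derivation.map_smul, e5]
        simp only [Finset.sum_sub_distrib]
        rw [e4]
        module
      have e6 : ∑ j, ∑ l, (pd l ((-x.vec) j) * pd i (pd j ((-y.vec) l))
            - pd i (pd j ((-x.vec) l)) * pd l ((-y.vec) j))
          = (2 : ℂ) • vecCocycle x.vec y.vec i
            - pd i (∑ j, ∑ l, pd l (x.vec j) * pd j (y.vec l)) := by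
        have e7 : (∑ j, ∑ l, pd i (pd j (x.vec l)) * pd l (y.vec j))
            = ∑ j, ∑ l, pd i (pd l (x.vec j)) * pd j (y.vec l) := Finset.sum_comm
        have e8 : pd i (∑ j, ∑ l, pd l (x.vec j) * pd j (y.vec l))
            = (∑ j, ∑ l, pd l (x.vec j) * pd i (pd j (y.vec l)))
              + ∑ j, ∑ l, pd i (pd l (x.vec j)) * pd j (y.vec l) := by
          simp only [map_sum, Derivation.leibniz, smul_eq_mul, ← Finset.sum_add_distrib]
          refine Finset.sum_congr rfl fun a _ => Finset.sum_congr rfl fun b _ => ?_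
          ring
        simp only [Pi.neg_apply, map_neg, neg_mul_neg, Finset.sum_sub_distrib]
        rw [e7, e8, vecCocycle]
        module
      rw [map_add, map_add]
      simp only [Pi.sub_apply, Pi.add_apply, Pi.smul_apply]
      change _ = _ - (pd i _ + pd i _ + pd i _)
      refine (congrArg₂ (· + ·) (congrArg₂ (· + ·) e1 e2) e6).trans ?_
      abel
    funext i j
    change pd i (brTheta _ _ _ _ _ j) - pd j (brTheta _ _ _ _ _ i) = _
    rw [key, ← curl_apply, map_sub, curl_gradient, sub_zero]
  · funext a b
    change ∑ c, (x.mat a c * y.mat c b - x.mat b c * y.mat c a)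
        + ∑ i, (pd i (x.mat a b) * (-y.vec) i - (-x.vec) i * pd i (y.mat a b)) = _
    rw [lie_mat]
    simp only [Matrix.add_apply, Matrix.sub_apply, Matrix.map_apply, vecDer_apply, Matrix.mul_apply,
      ← Finset.sum_sub_distrib, Pi.neg_apply]
    rw [add_comm]
    congr 1
    · refine Finset.sum_congr rfl fun i _ => ?_
      ring
    · refine Finset.sum_congr rfl fun c _ => ?_
      have hskew' : x.mat b c = -x.mat c b :=
        congrFun (congrFun (show x.mat.transpose = -x.mat from x.mat_mem) c) b
      rw [hskew a c, hskew']; ring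

theorem toRaw_constraint (x : GHet F) : Constraint (pdL F) (toRaw x) := by
  obtain ⟨w, hw⟩ := (ExactForms F).mkQ_surjective x.form
  rw [toRaw_apply, ← hw, curlQ_mk]
  refine ⟨?_, fun i j => ?_, fun i j k => ?_, fun a b => ?_⟩
  · have h := (mem_vectDiv x.vec).1 x.vec_mem
    simp only [Pi.neg_apply, map_neg, Finset.sum_neg_distrib]
    exact neg_eq_zero.2 h
  · exact (neg_sub _ _).symm
  · simp only [curl_apply, map_sub, pdL_apply]
    rw [pd_comm i j, pd_comm i k, pd_comm j k]; abel
  · exact congrFun (congrFun (show x.mat.transpose = -x.mat from x.mat_mem) b) a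

end Het

/-! ### Poincaré lemmas in degrees one and two -/

section Poincare

variable {X : Type} [AddCommGroup X] [Module ℂ X] {T : Fin 5 → X →ₗ[ℂ] X} {S : Submodule ℂ X}

/-- The Poincaré lemma for one-forms, for commuting operators each of which is surjective on the
common kernel of its predecessors. -/
theorem poincare_one (hT : ∀ i j x, T i (T j x) = T j (T i x))
    (hST : ∀ i, ∀ x ∈ S, T i x ∈ S)
    (hreg : ∀ m, ∀ u ∈ S, (∀ i < m, T i u = 0) → ∃ v ∈ S, T m v = u ∧ ∀ i < m, T i v = 0)
    (u : Fin 5 → X) (huS : ∀ i, u i ∈ S) (hu : ∀ i j, T i (u j) = T j (u i)) :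
    ∃ f ∈ S, ∀ i, T i f = u i := by
  have key : ∀ n ≤ 5, ∃ f ∈ S, ∀ i : Fin 5, i.val < n → T i f = u i := by
    intro n
    induction n with
    | zero => exact fun _ => ⟨0, S.zero_mem, fun i hi => absurd hi (Nat.not_lt_zero _)⟩
    | succ n ih =>
      intro hn
      obtain ⟨f, hfS, hf⟩ := ih (by omega)
      obtain ⟨m, rfl⟩ : ∃ m : Fin 5, m.val = n := ⟨⟨n, by omega⟩, rfl⟩
      obtain ⟨v, hvS, hv, hv'⟩ := hreg m (u m - T m f) (S.sub_mem (huS m) (hST m f hfS))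
        (fun i hi => by rw [map_sub, hu i m, hT i m, hf i hi, sub_self])
      refine ⟨f + v, S.add_mem hfS hvS, fun i hi => ?_⟩
      rcases Nat.lt_succ_iff_lt_or_eq.1 hi with h | h
      · rw [map_add, hf i h, hv' i h, add_zero]
      · rw [Fin.ext h, map_add, hv, add_sub_cancel]
  obtain ⟨f, hfS, hf⟩ := key 5 le_rfl
  exact ⟨f, hfS, fun i => hf i i.isLt⟩

/-- The Poincaré lemma for two-forms. -/
theorem poincare_two (hT : ∀ i j x, T i (T j x) = T j (T i x))
    (hST : ∀ i, ∀ x ∈ S, T i x ∈ S)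
    (hreg : ∀ m, ∀ u ∈ S, (∀ i < m, T i u = 0) → ∃ v ∈ S, T m v = u ∧ ∀ i < m, T i v = 0)
    (w : Fin 5 → Fin 5 → X) (hwS : ∀ i j, w i j ∈ S) (hskew : ∀ i j, w i j = -w j i)
    (hw : ∀ i j k, T i (w j k) + T j (w k i) + T k (w i j) = 0) :
    ∃ a : Fin 5 → X, (∀ i, a i ∈ S) ∧ ∀ i j, w i j = T i (a j) - T j (a i) := by
  have key : ∀ n ≤ 5, ∃ a : Fin 5 → X, (∀ i, a i ∈ S) ∧
      ∀ i : Fin 5, i.val < n → ∀ j, w i j = T i (a j) - T j (a i) := by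
    intro n
    induction n with
    | zero =>
      exact fun _ => ⟨0, fun _ => S.zero_mem, fun i hi => absurd hi (Nat.not_lt_zero _)⟩
    | succ n ih =>
      intro hn
      obtain ⟨a, haS, ha⟩ := ih (by omega)
      obtain ⟨m, rfl⟩ : ∃ m : Fin 5, m.val = n := ⟨⟨n, by omega⟩, rfl⟩
      -- the remainder `r = w - da` has no components with an index below `m`
      let r : Fin 5 → Fin 5 → X := fun i j => w i j - (T i (a j) - T j (a i))
      have hr : ∀ i j, r i j = w i j - (T i (a j) - T j (a i)) := fun _ _ => rfl
      have hr0 : ∀ i, i < m → ∀ j, r i j = 0 := fun i hi j => sub_eq_zero.2 (ha i hi j)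
      have hrskew : ∀ i j, r i j = -r j i := by
        intro i j; rw [hr, hr, hskew i j]; abel
      have hrclosed : ∀ i j k, T i (r j k) + T j (r k i) + T k (r i j) = 0 := by
        intro i j k
        rw [← hw i j k]
        simp only [hr, map_sub]
        rw [hT i j, hT i k, hT j k]; abel
      have hrm : r m m = 0 := by
        have h : (2 : ℂ) • r m m = 0 := by
          rw [two_smul]; exact add_eq_zero_iff_eq_neg.2 (hrskew m m)
        exact (smul_eq_zero.1 h).resolve_left two_ne_zero
      have hex : ∀ j, ∃ v ∈ S, T m v = r m j ∧ (∀ i < m, T i v = 0) ∧ (j ≤ m → v = 0) := by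
        intro j
        by_cases hj : j ≤ m
        · refine ⟨0, S.zero_mem, ?_, fun i _ => map_zero _, fun _ => rfl⟩
          rw [map_zero]
          rcases hj.lt_or_eq with h | h
          · rw [hrskew, hr0 j h, neg_zero]
          · rw [h, hrm]
        · obtain ⟨v, hvS, hv, hv'⟩ := hreg m (r m j)
            (S.sub_mem (hwS m j) (S.sub_mem (hST _ _ (haS _)) (hST _ _ (haS _))))
            (fun i hi => by
              have h := hrclosed i m j
              rw [hrskew j i, hr0 i hi, hr0 i hi, neg_zero, map_zero, map_zero, add_zero,
                add_zero] at h
              exact h)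
          exact ⟨v, hvS, hv, hv', fun h => absurd h hj⟩
      choose v hvS hv hv' hv0 using hex
      refine ⟨a + v, fun i => S.add_mem (haS i) (hvS i), fun i hi j => ?_⟩
      have hsum : T i ((a + v) j) - T j ((a + v) i)
          = (T i (a j) - T j (a i)) + (T i (v j) - T j (v i)) := by
        simp only [Pi.add_apply, map_add]; abel
      rw [hsum]
      rcases Nat.lt_succ_iff_lt_or_eq.1 hi with h | h
      · rw [hv' j i h, hv0 i (le_of_lt h), map_zero, sub_zero, add_zero, ha i h]
      · rw [Fin.ext h, hv, hv0 m le_rfl, map_zero, sub_zero, hr]; abel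
  obtain ⟨a, haS, ha⟩ := key 5 le_rfl
  exact ⟨a, haS, fun i j => ha i i.isLt j⟩

end Poincare

theorem Solvable.poincare_two_form {V : Submodule ℂ Smooth} (hV : Solvable V)
    (w : Fin 5 → Fin 5 → Dol) (hwS : ∀ i j, w i j ∈ coefIn (M := Fin 5 → ℂ) V)
    (hskew : ∀ i j, w i j = -w j i)
    (hw : ∀ i j k, D i (w j k) + D j (w k i) + D k (w i j) = 0) :
    ∃ a : Fin 5 → Dol, (∀ i, a i ∈ coefIn (M := Fin 5 → ℂ) V) ∧
      ∀ i j, w i j = D i (a j) - D j (a i) :=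
  poincare_two (T := D) D_comm (fun i x hx => hV.cwir_mem (Sum.inl i) hx)
    (fun m u hu h => by
      obtain ⟨v, hv, h1, h2⟩ := hV.solve_form (Sum.inl m) hu
      exact ⟨v, hv, h1, fun i hi => h2 (Sum.inl i) (by simpa using hi.ne) (h i hi)⟩)
    w hwS hskew hw

theorem Solvable.poincare_one_form {V : Submodule ℂ Smooth} (hV : Solvable V)
    (w : Fin 5 → Dol) (hwS : ∀ i, w i ∈ coefIn (M := Fin 5 → ℂ) V)
    (hw : ∀ i j, D i (w j) = D j (w i)) :
    ∃ f ∈ coefIn (M := Fin 5 → ℂ) V, ∀ i, D i f = w i :=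
  poincare_one (T := D) D_comm (fun i x hx => hV.cwir_mem (Sum.inl i) hx)
    (fun m u hu h => by
      obtain ⟨v, hv, h1, h2⟩ := hV.solve_form (Sum.inl m) hu
      exact ⟨v, hv, h1, fun i hi => h2 (Sum.inl i) (by simpa using hi.ne) (h i hi)⟩)
    w hwS hw

/-! ### The Jacobi identity -/

section Envelope

variable {M : Type} [AddCommGroup M] [Module ℂ M]

/-- The even part of `C^∞(ℂ⁵) ⊗ Λ M`, which is commutative. -/
noncomputable def EvenForm (M : Type) [AddCommGroup M] [Module ℂ M] : Subalgebra ℂ (SForm M) where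
  carrier := {x | spar x = x}
  mul_mem' := by
    intro x y hx hy
    simp only [Set.mem_ofPred_eq] at *
    rw [spar_mul, hx, hy]
  add_mem' := by
    intro x y hx hy
    simp only [Set.mem_ofPred_eq] at *
    rw [map_add, hx, hy]
  algebraMap_mem' := by
    intro c
    simp only [Set.mem_ofPred_eq]
    rw [Algebra.TensorProduct.algebraMap_apply, spar_tmul, map_one]

noncomputable instance : CommRing (EvenForm M) where
  mul_comm x y := by
    refine Subtype.ext ?_
    have h := sform_comm_of_parity (p := 0) (q := 0) (x := x.1) (y := y.1)
      (by rw [pow_zero, one_smul]; exact x.2) (by rw [pow_zero, one_smul]; exact y.2)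
    rwa [zero_mul, pow_zero, one_smul] at h

noncomputable instance : PartialDerivatives (EvenForm M) where
  pd := fun i => Derivation.mk'
    { toFun := fun x => ⟨cwir (Sum.inl i) x.1, by
        change spar (coef _ x.1) = coef _ x.1
        have h : spar x.1 = x.1 := x.2
        rw [← coef_spar, h]⟩
      map_add' := fun x y => Subtype.ext (map_add _ x.1 y.1)
      map_smul' := fun c x => Subtype.ext (map_smul _ c x.1) }
    (fun x y => by
      refine Subtype.ext ?_
      change coef (dz i).toLinearMap (x.1 * y.1)
        = (x * (⟨coef (dz i).toLinearMap y.1, _⟩ : EvenForm M)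
          + y * (⟨coef (dz i).toLinearMap x.1, _⟩ : EvenForm M) : EvenForm M).1
      rw [mul_comm y, coef_mul, add_comm]
      rfl)
  pd_comm := fun i j x => Subtype.ext (cwir_comm _ _ x.1)

end Envelope

/-- The generators `dz̄ⁱ` together with three additional odd parameters. -/
abbrev EnvGen : Type := (Fin 5 → ℂ) × (Fin 3 → ℂ)

/-- The inclusion of `(0, •)`-forms into forms with three additional odd parameters. -/
noncomputable def inclForm : Dol →ₗ[ℂ] SForm EnvGen :=
  extn (ExteriorAlgebra.map (LinearMap.inl ℂ (Fin 5 → ℂ) (Fin 3 → ℂ))).toLinearMap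

theorem inclForm_tmul (f : Smooth) (w : AntiHol) : inclForm (f ⊗ₜ[ℂ] w)
    = f ⊗ₜ[ℂ] ExteriorAlgebra.map (LinearMap.inl ℂ (Fin 5 → ℂ) (Fin 3 → ℂ)) w := rfl

theorem inclForm_mul (x y : Dol) : inclForm (x * y) = inclForm x * inclForm y := by
  induction x using TensorProduct.induction_on with
  | zero => simp only [map_zero, zero_mul]
  | add x x' hx hx' => simp only [map_add, add_mul, hx, hx']
  | tmul f w =>
    induction y using TensorProduct.induction_on with
    | zero => simp only [map_zero, mul_zero]
    | add x x' hx hx' => simp only [map_add, mul_add, hx, hx']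
    | tmul g u =>
      simp only [Algebra.TensorProduct.tmul_mul_tmul, inclForm_tmul, map_mul]

theorem cwir_inclForm (k : Fin 5 ⊕ Fin 5) (x : Dol) :
    cwir k (inclForm x) = inclForm (cwir k x) := coef_extn _ _ x

theorem spar_inclForm (x : Dol) : spar (inclForm x) = inclForm (spar x) := by
  induction x using TensorProduct.induction_on with
  | zero => simp only [map_zero]
  | add x y hx hy => simp only [map_add, hx, hy]
  | tmul f w =>
    rw [spar_tmul, inclForm_tmul, inclForm_tmul, spar_tmul]
    congr 1
    induction w using exterior_induction with
    | algebraMap r => simp only [AlgHom.commutes]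
    | add x y hx hy => simp only [map_add, hx, hy]
    | ι_mul x v hx =>
      simp only [map_mul, invol_ι, ExteriorAlgebra.map_apply_ι, map_neg, hx]

theorem inclForm_injective (x : Dol) (h : inclForm x = 0) : x = 0 := by
  -- the projection of the generators is a left inverse of their inclusion
  have h2 : ∀ y : Dol, extn (ExteriorAlgebra.map
      (LinearMap.fst ℂ (Fin 5 → ℂ) (Fin 3 → ℂ))).toLinearMap (inclForm y) = y := by
    intro y
    induction y using TensorProduct.induction_on with
    | zero => simp only [map_zero]
    | add x y hx hy => simp only [map_add, hx, hy]
    | tmul f w =>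
      rw [inclForm_tmul, extn_tmul]
      congr 1
      induction w using exterior_induction with
      | algebraMap r => simp only [AlgHom.toLinearMap_apply, AlgHom.commutes]
      | add x y hx hy => simp only [map_add, hx, hy]
      | ι_mul x v hx =>
        simp only [AlgHom.toLinearMap_apply] at hx
        simp only [AlgHom.toLinearMap_apply, map_mul, ExteriorAlgebra.map_apply_ι, hx]
        rfl
  rw [← h2 x, h, map_zero]

/-- The `k`-th odd parameter. -/
noncomputable def oddGen (k : Fin 3) : SForm EnvGen :=
  (1 : Smooth) ⊗ₜ[ℂ] ExteriorAlgebra.ι ℂ ((0, Pi.single k 1) : EnvGen)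

/-- A parameter of parity `p`. -/
noncomputable def param (k : Fin 3) (p : ℕ) : SForm EnvGen := if Even p then 1 else oddGen k

/-- Contraction with the form dual to the `k`-th odd parameter. -/
noncomputable def conGen (k : Fin 3) : SForm EnvGen →ₗ[ℂ] SForm EnvGen :=
  extn (con (LinearMap.proj k ∘ₗ LinearMap.snd ℂ (Fin 5 → ℂ) (Fin 3 → ℂ)))

theorem conGen_oddGen_mul (k l : Fin 3) (x : SForm EnvGen) :
    conGen k (oddGen l * x) = (if k = l then x else 0) - oddGen l * conGen k x := by
  induction x using TensorProduct.induction_on with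
  | zero => simp only [map_zero, mul_zero, ite_self, sub_zero]
  | add x y hx hy => simp only [mul_add, map_add, hx, hy]; split_ifs <;> abel
  | tmul f w =>
    simp only [oddGen, conGen, Algebra.TensorProduct.tmul_mul_tmul, extn_tmul, one_mul, con_ι_mul,
      TensorProduct.tmul_sub]
    congr 1
    have h : (LinearMap.proj k ∘ₗ LinearMap.snd ℂ (Fin 5 → ℂ) (Fin 3 → ℂ)) (0, Pi.single l 1)
      = if k = l then (1 : ℂ) else 0 := by simp [Pi.single_apply]
    rw [h]
    split_ifs
    · rw [one_smul]
    · rw [zero_smul, TensorProduct.tmul_zero]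

theorem conGen_inclForm (k : Fin 3) (x : Dol) : conGen k (inclForm x) = 0 := by
  induction x using TensorProduct.induction_on with
  | zero => simp only [map_zero]
  | add x y hx hy => simp only [map_add, hx, hy, add_zero]
  | tmul f w =>
    rw [inclForm_tmul, conGen, extn_tmul, con_map, TensorProduct.tmul_zero]
    rfl

theorem spar_param (k : Fin 3) (p : ℕ) : spar (param k p) = (-1 : ℂ) ^ p • param k p := by
  rw [param]
  split_ifs with h
  · rw [h.neg_one_pow, one_smul, Algebra.TensorProduct.one_def, spar_tmul, map_one]
  · have h2 : spar (oddGen k) = -oddGen k := by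
      rw [oddGen, spar_tmul, invol_ι, TensorProduct.tmul_neg]
    rw [(Nat.not_even_iff_odd.1 h).neg_one_pow, h2]
    exact (neg_one_smul ℂ (oddGen k)).symm

theorem cwir_param (l : Fin 5 ⊕ Fin 5) (k : Fin 3) (p : ℕ) : cwir l (param k p) = 0 := by
  have h : ∀ w : ExteriorAlgebra ℂ EnvGen, cwir l ((1 : Smooth) ⊗ₜ[ℂ] w) = 0 := by
    intro w
    rw [cwir, coef_tmul, Derivation.coeFn_coe, Derivation.map_one_eq_zero, TensorProduct.zero_tmul]
  rw [param]
  split_ifs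
  · exact h 1
  · exact h _

theorem conGen_param_mul (k l : Fin 3) (hkl : k ≠ l) (p : ℕ) (x : SForm EnvGen)
    (h : conGen k x = 0) : conGen k (param l p * x) = 0 := by
  rw [param]
  split_ifs
  · rw [one_mul, h]
  · rw [conGen_oddGen_mul, if_neg hkl, h, mul_zero, sub_zero]

theorem param_mul_cancel (k : Fin 3) (p : ℕ) (x : SForm EnvGen)
    (h : conGen k x = 0) (h2 : param k p * x = 0) : x = 0 := by
  rw [param] at h2
  split_ifs at h2
  · rwa [one_mul] at h2
  · have h3 := conGen_oddGen_mul k k x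
    rw [h2, h, map_zero, if_pos rfl, mul_zero, sub_zero] at h3
    exact h3.symm

theorem param_mul_inclForm_cancel (p q r : ℕ) (x : Dol)
    (h : param 0 p * param 1 q * param 2 r * inclForm x = 0) : x = 0 := by
  refine inclForm_injective x (param_mul_cancel 2 r _ (conGen_inclForm _ _) ?_)
  refine param_mul_cancel 1 q _ (conGen_param_mul _ _ (by decide) _ _ (conGen_inclForm _ _)) ?_
  refine param_mul_cancel 0 p _ (conGen_param_mul _ _ (by decide) _ _
    (conGen_param_mul _ _ (by decide) _ _ (conGen_inclForm _ _))) ?_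
  rw [← mul_assoc, ← mul_assoc, h]

/-- Multiply a form by a parameter. -/
noncomputable def twist (s : SForm EnvGen) : Dol →ₗ[ℂ] SForm EnvGen :=
  LinearMap.mulLeft ℂ s ∘ₗ inclForm

theorem twist_apply (s : SForm EnvGen) (x : Dol) : twist s x = s * inclForm x := rfl

theorem cwir_twist {s : SForm EnvGen} (i : Fin 5) (hs : cwir (Sum.inl i) s = 0) (x : Dol) :
    cwir (Sum.inl i) (twist s x) = twist s (D i x) := by
  rw [twist_apply, cwir, coef_mul, ← cwir, hs, zero_mul, zero_add, cwir_inclForm]; rfl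

/-- The bracket of triples of forms with additional odd parameters. -/
noncomputable def envBr : Raw (SForm EnvGen) → Raw (SForm EnvGen) → Raw (SForm EnvGen) :=
  rawBr (fun i => cwir (Sum.inl i)) (fun i => cwir (Sum.inl i)) (fun i => cwir (Sum.inl i))
    (LinearMap.mul ℂ (SForm EnvGen))

/-- The sign rule for taking parameters out of the bracket. -/
theorem envBr_twist {s t : SForm EnvGen} {p d : ℕ} {φ ψ : RawField}
    (hs : ∀ i, cwir (Sum.inl i) s = 0) (ht : ∀ i, cwir (Sum.inl i) t = 0)
    (htp : spar t = (-1 : ℂ) ^ d • t) (hφ : rawMap spar φ = (-1 : ℂ) ^ p • φ) :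
    envBr (rawMap (twist s) φ) (rawMap (twist t) ψ)
      = (-1 : ℂ) ^ (p * d) • rawMap (twist (s * t)) (dolBr φ ψ) := by
  have hst : ∀ i, cwir (Sum.inl i) (s * t) = 0 := by
    intro i
    rw [cwir, coef_mul, ← cwir, hs, ht, zero_mul, mul_zero, add_zero]
  have h1 := rawBr_natural ((LinearMap.mul ℂ Dol).compl₁₂ (proj p) LinearMap.id)
    (LinearMap.mul ℂ Dol) (h := LinearMap.id) (fun i x => D_proj p i x)
    (DV := D) (DV' := D) (fun _ _ => rfl) (DW := D) (DW' := D)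
    (fun _ _ => rfl) (fun _ _ => rfl) φ ψ
  have h2 := rawBr_natural ((LinearMap.mul ℂ Dol).compl₁₂ (proj p) LinearMap.id)
    (LinearMap.mul ℂ (SForm EnvGen)) (f := twist s ∘ₗ proj p) (g := twist t)
    (h := (-1 : ℂ) ^ (p * d) • twist (s * t))
    (DU := D) (DU' := fun i => cwir (Sum.inl i)) (DV := D) (DV' := fun i => cwir (Sum.inl i))
    (DW := D) (DW' := fun i => cwir (Sum.inl i))
    (fun i x => by
      rw [LinearMap.comp_apply, cwir_twist i (hs i), D_proj]; rfl)
    (fun i x => cwir_twist i (ht i) x)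
    (fun i x => by
      rw [LinearMap.smul_apply, map_smul, cwir_twist i (hst i)]; rfl)
    (fun u v => by
      change s * inclForm (proj p u) * (t * inclForm v)
        = (-1 : ℂ) ^ (p * d) • (s * t * inclForm (proj p u * v))
      have hc := sform_comm_of_parity (p := p) (q := d) (x := inclForm (proj p u)) (y := t)
        (by rw [spar_inclForm, spar_proj, map_smul]) htp
      rw [mul_assoc, ← mul_assoc (inclForm (proj p u)), hc, inclForm_mul, smul_mul_assoc,
        mul_smul_comm]
      simp only [mul_assoc]) φ ψ
  rw [← rawMap_rawMap, rawMap_proj_eq_self hφ] at h2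
  rw [rawMap_proj_eq_self hφ] at h1
  rw [envBr, h2, dolBr]
  change _ = _ • rawMap _ (rawBr D D D (LinearMap.mul ℂ Dol) φ (rawMap LinearMap.id ψ))
  rw [h1]
  rfl

theorem envBr_smul_left (c : ℂ) (x y : Raw (SForm EnvGen)) :
    envBr (c • x) y = c • envBr x y := rawBr_smul_left _ _ _ _ _ _ _

theorem envBr_smul_right (c : ℂ) (x y : Raw (SForm EnvGen)) :
    envBr x (c • y) = c • envBr x y := rawBr_smul_right _ _ _ _ _ _ _

theorem rawMap_twist_smul (c : ℂ) (a : SForm EnvGen) (b : RawField) :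
    rawMap (twist (c • a)) b = c • rawMap (twist a) b := by
  have h : ∀ x, twist (c • a) x = c • twist a x := fun x => smul_mul_assoc c a (inclForm x)
  exact Prod.ext (funext fun _ => h _) (Prod.ext (funext fun _ => funext fun _ => h _)
    (funext fun _ => funext fun _ => h _))

theorem cwir_mul_eq_zero {s t : SForm EnvGen} (hs : ∀ i, cwir (Sum.inl i) s = 0)
    (ht : ∀ i, cwir (Sum.inl i) t = 0) (i : Fin 5) : cwir (Sum.inl i) (s * t) = 0 := by
  rw [cwir, coef_mul, ← cwir, hs, ht, zero_mul, mul_zero, add_zero]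

theorem spar_mul_parity {s t : SForm EnvGen} {m n : ℕ} (hs : spar s = (-1 : ℂ) ^ m • s)
    (ht : spar t = (-1 : ℂ) ^ n • t) : spar (s * t) = (-1 : ℂ) ^ (m + n) • (s * t) := by
  rw [spar_mul, hs, ht, smul_mul_smul_comm, pow_add]

theorem envBr_twist_right {s t u : SForm EnvGen} {p q r : ℕ} {φ ψ χ : RawField}
    (hs : ∀ i, cwir (Sum.inl i) s = 0) (ht : ∀ i, cwir (Sum.inl i) t = 0)
    (hu : ∀ i, cwir (Sum.inl i) u = 0) (htp : spar t = (-1 : ℂ) ^ q • t)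
    (hup : spar u = (-1 : ℂ) ^ r • u) (hφ : rawMap spar φ = (-1 : ℂ) ^ p • φ)
    (hψ : rawMap spar ψ = (-1 : ℂ) ^ q • ψ) :
    envBr (rawMap (twist s) φ) (envBr (rawMap (twist t) ψ) (rawMap (twist u) χ))
      = (-1 : ℂ) ^ (q * r) • (-1 : ℂ) ^ (p * (q + r)) • rawMap (twist (s * (t * u)))
        (dolBr φ (dolBr ψ χ)) := by
  rw [envBr_twist ht hu hup hψ, envBr_smul_right,
    envBr_twist hs (cwir_mul_eq_zero ht hu) (spar_mul_parity htp hup) hφ]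

theorem envBr_twist_left {s t u : SForm EnvGen} {p q r : ℕ} {φ ψ χ : RawField}
    (hs : ∀ i, cwir (Sum.inl i) s = 0) (ht : ∀ i, cwir (Sum.inl i) t = 0)
    (hu : ∀ i, cwir (Sum.inl i) u = 0) (htp : spar t = (-1 : ℂ) ^ q • t)
    (hup : spar u = (-1 : ℂ) ^ r • u) (hφ : rawMap spar φ = (-1 : ℂ) ^ p • φ)
    (hφψ : rawMap spar (dolBr φ ψ) = (-1 : ℂ) ^ (p + q) • dolBr φ ψ) :
    envBr (envBr (rawMap (twist s) φ) (rawMap (twist t) ψ)) (rawMap (twist u) χ)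
      = (-1 : ℂ) ^ (p * q) • (-1 : ℂ) ^ ((p + q) * r) • rawMap (twist (s * t * u))
        (dolBr (dolBr φ ψ) χ) := by
  rw [envBr_twist (ψ := ψ) hs ht htp hφ, envBr_smul_left,
    envBr_twist (cwir_mul_eq_zero hs ht) hu hup hφψ]

/-- The commutative ring of even forms with three additional odd parameters. It is not reducible,
which keeps the search for instances away from the construction of the forms. -/
def EnvRing : Type := EvenForm EnvGen

noncomputable instance : CommRing EnvRing := inferInstanceAs (CommRing (EvenForm EnvGen))

noncomputable instance : Algebra ℂ EnvRing := inferInstanceAs (Algebra ℂ (EvenForm EnvGen))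

noncomputable instance : PartialDerivatives EnvRing :=
  inferInstanceAs (PartialDerivatives (EvenForm EnvGen))

/-- The inclusion of the even forms. -/
noncomputable def evenVal : EnvRing →ₗ[ℂ] SForm EnvGen where
  toFun x := x.1
  map_add' _ _ := rfl
  map_smul' _ _ := rfl

theorem evenVal_pd (i : Fin 5) (x : EnvRing) :
    cwir (Sum.inl i) (evenVal x) = evenVal (pdL EnvRing i x) := rfl

theorem evenVal_mul (x y : EnvRing) :
    LinearMap.mul ℂ (SForm EnvGen) (evenVal x) (evenVal y)
      = evenVal (LinearMap.mul ℂ EnvRing x y) := rfl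

theorem envBr_toRaw (x y : GHet EnvRing) :
    envBr (rawMap evenVal (toRaw x)) (rawMap evenVal (toRaw y))
      = rawMap evenVal (toRaw ⁅x, y⁆) := by
  rw [← rawBr_toRaw]
  exact rawBr_natural (LinearMap.mul ℂ EnvRing) (LinearMap.mul ℂ (SForm EnvGen)) evenVal_pd
    evenVal_pd evenVal_pd evenVal_mul _ _

theorem rawMap_toRaw_leibniz {F S : Type} [CommRing F] [Algebra ℂ F] [PartialDerivatives F]
    [AddCommGroup S] [Module ℂ S] (j : F →ₗ[ℂ] S) (x y z : GHet F) :
    rawMap j (toRaw ⁅x, ⁅y, z⁆⁆)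
      = rawMap j (toRaw ⁅⁅x, y⁆, z⁆) + rawMap j (toRaw ⁅y, ⁅x, z⁆⁆) := by
  rw [ghet_leibniz, map_add, map_add]

/-- The Jacobi identity for those triples that come from the heterotic Lie algebra. -/
theorem envBr_leibniz {φ ψ χ : Raw (SForm EnvGen)} {x y z : GHet EnvRing}
    (hx : rawMap evenVal (toRaw x) = φ) (hy : rawMap evenVal (toRaw y) = ψ)
    (hz : rawMap evenVal (toRaw z) = χ) :
    envBr φ (envBr ψ χ) = envBr (envBr φ ψ) χ + envBr ψ (envBr φ χ) := by
  have h1 : envBr ψ χ = rawMap evenVal (toRaw ⁅y, z⁆) := by rw [← hy, ← hz, envBr_toRaw]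
  have h2 : envBr φ ψ = rawMap evenVal (toRaw ⁅x, y⁆) := by rw [← hx, ← hy, envBr_toRaw]
  have h3 : envBr φ χ = rawMap evenVal (toRaw ⁅x, z⁆) := by rw [← hx, ← hz, envBr_toRaw]
  have h4 : envBr φ (envBr ψ χ) = rawMap evenVal (toRaw ⁅x, ⁅y, z⁆⁆) := by
    rw [h1, ← hx, envBr_toRaw]
  have h5 : envBr (envBr φ ψ) χ = rawMap evenVal (toRaw ⁅⁅x, y⁆, z⁆) := by
    rw [h2, ← hz, envBr_toRaw]
  have h6 : envBr ψ (envBr φ χ) = rawMap evenVal (toRaw ⁅y, ⁅x, z⁆⁆) := by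
    rw [h3, ← hy, envBr_toRaw]
  rw [h4, h5, h6]
  exact rawMap_toRaw_leibniz evenVal x y z

/-- The even form obtained from a form by taking the component of parity `p` and multiplying by a
parameter of parity `p`. -/
noncomputable def evenTwist (s : SForm EnvGen) (p : ℕ) (hsp : spar s = (-1 : ℂ) ^ p • s) :
    Dol →ₗ[ℂ] EnvRing where
  toFun y := ⟨twist s (proj p y), by
    change spar (s * inclForm (proj p y)) = s * inclForm (proj p y)
    rw [spar_mul, hsp, spar_inclForm, spar_proj, map_smul, smul_mul_smul_comm,
      neg_one_pow_sq, one_smul]⟩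
  map_add' x y := Subtype.ext ((congrArg (twist s) (map_add (proj p) x y)).trans (map_add _ _ _))
  map_smul' c y := Subtype.ext ((congrArg (twist s) (map_smul (proj p) c y)).trans (map_smul _ _ _))

theorem pd_evenTwist {s : SForm EnvGen} {p : ℕ} (hsp : spar s = (-1 : ℂ) ^ p • s)
    (hs : ∀ i, cwir (Sum.inl i) s = 0) (i : Fin 5) (y : Dol) :
    pdL EnvRing i (evenTwist s p hsp y) = evenTwist s p hsp (D i y) := by
  refine Subtype.ext ?_
  change cwir (Sum.inl i) (twist s (proj p y)) = twist s (proj p (D i y))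
  rw [cwir_twist i (hs i), D_proj]

/-- A triple with a potential for its two-form comes from the heterotic Lie algebra. -/
theorem exists_ghet_of_map {U F : Type} [AddCommGroup U] [Module ℂ U] [CommRing F] [Algebra ℂ F]
    [PartialDerivatives F] {DU : Fin 5 → U →ₗ[ℂ] U} (E : U →ₗ[ℂ] F)
    (hE : ∀ i y, pdL F i (E y) = E (DU i y)) {φ : Raw U} (hφ : Constraint DU φ) (w : Fin 5 → U)
    (hw : ∀ i j, φ.2.1 i j = DU i (w j) - DU j (w i)) :
    ∃ x : GHet F, toRaw x = rawMap E φ := by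
  refine ⟨(⟨fun i => -E (φ.1 i), ?_⟩, (ExactForms F).mkQ (fun i => E (w i)),
    ⟨fun a b => E (φ.2.2 a b), ?_⟩), ?_⟩
  · rw [mem_vectDiv]
    simp only [map_neg, ← pdL_apply, hE, Finset.sum_neg_distrib, ← map_sum]
    rw [hφ.1, map_zero, neg_zero]
  · change Matrix.transpose _ = -_
    funext a b
    change E (φ.2.2 b a) = -E (φ.2.2 a b)
    rw [← map_neg]
    exact congrArg E (hφ.2.2.2 b a)
  · refine Prod.ext (funext fun i => ?_) (Prod.ext (funext fun i => funext fun j => ?_) ?_)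
    · change (-(-E (φ.1 i))) = E (φ.1 i)
      rw [neg_neg]
    · change pdL F i (E (w j)) - pdL F j (E (w i)) = E (φ.2.1 i j)
      rw [hE, hE, ← map_sub, ← hw]
    · rfl

/-- A field multiplied by a parameter of its parity comes from the heterotic Lie algebra of the
even forms. -/
theorem exists_ghet_twist (hV : Solvable ⊤) {s : SForm EnvGen} {p : ℕ}
    (hs : ∀ i, cwir (Sum.inl i) s = 0) (hsp : spar s = (-1 : ℂ) ^ p • s) (φ : Fields)
    (hφ : HasParity p φ) :
    ∃ x : GHet EnvRing, rawMap evenVal (toRaw x) = rawMap (twist s) φ.1 := by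
  obtain ⟨w, -, hw⟩ := hV.poincare_two_form φ.1.2.1 (fun i j => mem_coefIn_top _) φ.2.2.1 φ.2.2.2.1
  obtain ⟨x, hx⟩ := exists_ghet_of_map (DU := D) (evenTwist s p hsp) (pd_evenTwist hsp hs) φ.2 w hw
  refine ⟨x, ?_⟩
  conv_rhs => rw [← rawMap_proj_eq_self hφ]
  rw [hx]
  rfl

theorem rawMap_injective {U V : Type} [AddCommGroup U] [Module ℂ U] [AddCommGroup V] [Module ℂ V]
    {f : U →ₗ[ℂ] V} (h : ∀ x, f x = 0 → x = 0) (φ : Raw U) (hφ : rawMap f φ = 0) : φ = 0 :=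
  Prod.ext (funext fun i => h _ (congrFun (congrArg Prod.fst hφ) i))
    (Prod.ext (funext fun i => funext fun j =>
      h _ (congrFun (congrFun (congrArg (fun x => x.2.1) hφ) i) j))
      (funext fun a => funext fun b =>
        h _ (congrFun (congrFun (congrArg (fun x => x.2.2) hφ) a) b)))

theorem rawMap_cancel {U V : Type} [AddCommGroup U] [Module ℂ U] [AddCommGroup V] [Module ℂ V]
    {f : U →ₗ[ℂ] V} (hf : ∀ x, f x = 0 → x = 0) {c : ℂ} {x y z : Raw U}
    (h : rawMap f x = rawMap f y + c • rawMap f z) : x = y + c • z := by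
  rw [← map_smul, ← map_add, ← sub_eq_zero, ← map_sub] at h
  exact sub_eq_zero.1 (rawMap_injective hf _ h)

/-- Removal of the signs in the Jacobi identity with parameters. -/
theorem jacobi_signs {X : Type} [AddCommGroup X] [Module ℂ X] (p q r : ℕ) (A B C : X)
    (h : (-1 : ℂ) ^ (q * r) • (-1 : ℂ) ^ (p * (q + r)) • A
      = (-1 : ℂ) ^ (p * q) • (-1 : ℂ) ^ ((p + q) * r) • B
        + (-1 : ℂ) ^ (p * r) • (-1 : ℂ) ^ (q * (p + r)) • (-1 : ℂ) ^ (p * q) • C) :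
    A = B + (-1 : ℂ) ^ (p * q) • C := by
  simp only [smul_smul, ← pow_add] at h
  have hsign1 : (-1 : ℂ) ^ (q * r + p * (q + r)) = (-1 : ℂ) ^ (p * q + q * r + p * r) := by
    congr 1; ring
  have hsign2 : (-1 : ℂ) ^ (p * q + (p + q) * r) = (-1 : ℂ) ^ (p * q + q * r + p * r) := by
    congr 1; ring
  have hsign3 : (-1 : ℂ) ^ (p * r + (q * (p + r) + p * q))
      = (-1 : ℂ) ^ (p * q + q * r + p * r) * (-1 : ℂ) ^ (p * q) := by
    rw [← pow_add]; congr 1; ring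
  rw [hsign1, hsign2, hsign3, mul_smul, ← smul_add] at h
  have h2 := congrArg (fun v => (-1 : ℂ) ^ (p * q + q * r + p * r) • v) h
  simpa only [smul_smul, neg_one_pow_sq, one_smul] using h2

set_option maxHeartbeats 1000000 in
theorem ell_jacobi_of_parity (hV : Solvable ⊤) (p q r : ℕ) (φ ψ χ : Fields) (hφ : HasParity p φ)
    (hψ : HasParity q ψ) (hχ : HasParity r χ) :
    ell φ (ell ψ χ) = ell (ell φ ψ) χ + (-1 : ℂ) ^ (p * q) • ell ψ (ell φ χ) := by
  obtain ⟨s, hs⟩ : ∃ s, s = param 0 p := ⟨_, rfl⟩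
  obtain ⟨t, ht⟩ : ∃ t, t = param 1 q := ⟨_, rfl⟩
  obtain ⟨u, hu⟩ : ∃ u, u = param 2 r := ⟨_, rfl⟩
  have hsp : spar s = (-1 : ℂ) ^ p • s := by rw [hs, spar_param]
  have htp : spar t = (-1 : ℂ) ^ q • t := by rw [ht, spar_param]
  have hup : spar u = (-1 : ℂ) ^ r • u := by rw [hu, spar_param]
  have hsD : ∀ i, cwir (Sum.inl i) s = 0 := fun i => by rw [hs, cwir_param]
  have htD : ∀ i, cwir (Sum.inl i) t = 0 := fun i => by rw [ht, cwir_param]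
  have huD : ∀ i, cwir (Sum.inl i) u = 0 := fun i => by rw [hu, cwir_param]
  obtain ⟨x, hx⟩ := exists_ghet_twist hV hsD hsp φ hφ
  obtain ⟨y, hy⟩ := exists_ghet_twist hV htD htp ψ hψ
  obtain ⟨z, hz⟩ := exists_ghet_twist hV huD hup χ hχ
  -- the Jacobi identity for the elements with parameters
  have hJ : envBr (rawMap (twist s) φ.1) (envBr (rawMap (twist t) ψ.1) (rawMap (twist u) χ.1))
      = envBr (envBr (rawMap (twist s) φ.1) (rawMap (twist t) ψ.1)) (rawMap (twist u) χ.1)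
        + envBr (rawMap (twist t) ψ.1)
          (envBr (rawMap (twist s) φ.1) (rawMap (twist u) χ.1)) := envBr_leibniz hx hy hz
  have hφψ : rawMap spar (dolBr φ.1 ψ.1) = (-1 : ℂ) ^ (p + q) • dolBr φ.1 ψ.1 :=
    ell_parity p q φ ψ hφ hψ
  have hts : t * s = (-1 : ℂ) ^ (p * q) • (s * t) := by
    rw [sform_comm_of_parity htp hsp, mul_comm p q]
  have h4 : t * (s * u) = (-1 : ℂ) ^ (p * q) • (s * t * u) := by
    rw [← mul_assoc, hts, smul_mul_assoc]
  rw [envBr_twist_right hsD htD huD htp hup hφ hψ, envBr_twist_left hsD htD huD htp hup hφ hφψ,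
    envBr_twist_right htD hsD huD hsp hup hψ hφ, h4, rawMap_twist_smul, ← mul_assoc] at hJ
  have hJ2 := jacobi_signs (X := Raw (SForm EnvGen)) p q r _ _ _ hJ
  refine Subtype.ext (rawMap_cancel (f := twist (s * t * u)) (fun x hx => ?_) hJ2)
  rw [twist_apply, hs, ht, hu] at hx
  exact param_mul_inclForm_cancel p q r x hx

theorem exists_parity_decomposition (χ : Fields) :
    ∃ χ₀ χ₁ : Fields, HasParity 0 χ₀ ∧ HasParity 1 χ₁ ∧ χ = χ₀ + χ₁ := by
  have hmem : ∀ p, rawMap (proj p) χ.1 ∈ Fields := by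
    intro p
    have hD : ∀ i (x : Dol), D i (proj p x) = proj p (D i x) := D_proj p
    refine ⟨?_, fun i j => ?_, fun i j k => ?_, fun a b => ?_⟩
    · change ∑ i, D i (proj p (χ.1.1 i)) = 0
      have h : ∑ i, D i (χ.1.1 i) = 0 := χ.2.1
      simp only [hD, ← map_sum, h, map_zero]
    · have h : χ.1.2.1 i j = -χ.1.2.1 j i := χ.2.2.1 i j
      change proj p (χ.1.2.1 i j) = -proj p (χ.1.2.1 j i)
      rw [h, map_neg]
    · have h : D i (χ.1.2.1 j k) + D j (χ.1.2.1 k i) + D k (χ.1.2.1 i j) = 0 := χ.2.2.2.1 i j k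
      change D i (proj p (χ.1.2.1 j k)) + D j (proj p (χ.1.2.1 k i))
        + D k (proj p (χ.1.2.1 i j)) = 0
      simp only [hD, ← map_add, h, map_zero]
    · have h : χ.1.2.2 a b = -χ.1.2.2 b a := χ.2.2.2.2 a b
      change proj p (χ.1.2.2 a b) = -proj p (χ.1.2.2 b a)
      rw [h, map_neg]
  have hpar : ∀ p, HasParity p ⟨_, hmem p⟩ := fun p =>
    Prod.ext (funext fun _ => spar_proj p _) (Prod.ext (funext fun _ => funext fun _ =>
      spar_proj p _) (funext fun _ => funext fun _ => spar_proj p _))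
  refine ⟨⟨_, hmem 0⟩, ⟨_, hmem 1⟩, hpar 0, hpar 1, Subtype.ext ?_⟩
  exact Prod.ext (funext fun _ => (proj_zero_add_proj_one _).symm)
    (Prod.ext (funext fun _ => funext fun _ => (proj_zero_add_proj_one _).symm)
      (funext fun _ => funext fun _ => (proj_zero_add_proj_one _).symm))

theorem ell_jacobi (hV : Solvable ⊤) (p q : ℕ) (φ ψ χ : Fields) (hφ : HasParity p φ)
    (hψ : HasParity q ψ) :
    ell φ (ell ψ χ) = ell (ell φ ψ) χ + (-1 : ℂ) ^ (p * q) • ell ψ (ell φ χ) := by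
  obtain ⟨χ₀, χ₁, h0, h1, rfl⟩ := exists_parity_decomposition χ
  simp only [map_add, smul_add]
  rw [ell_jacobi_of_parity hV p q 0 φ ψ χ₀ hφ hψ h0, ell_jacobi_of_parity hV p q 1 φ ψ χ₁ hφ hψ h1]
  abel

theorem isDGLie_ell (hV : Solvable ⊤) : IsDGLie ell where
  brst_brst := brst_brst
  brst_parity := brst_parity
  bracket_parity := ell_parity
  bracket_skew := ell_skew
  brst_bracket := brst_ell
  jacobi := ell_jacobi hV

/-! ### Integrals depending on parameters -/

section Parameters

variable {E : Type} [NormedAddCommGroup E] [NormedSpace ℝ E] [FiniteDimensional ℝ E]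

/-- A set of differentiable functions that is stable under directional derivatives consists of
smooth functions. -/
theorem contDiff_of_fderiv_mem (S : Set (E → ℂ)) (hd : ∀ F ∈ S, Differentiable ℝ F)
    (hS : ∀ F ∈ S, ∀ v, (fun z => fderiv ℝ F z v) ∈ S) (F : E → ℂ) (hF : F ∈ S) :
    ContDiff ℝ ∞ F := by
  rw [contDiff_infty]
  intro n
  induction n generalizing F with
  | zero => exact contDiff_zero.2 (hd F hF).continuous
  | succ n ih =>
    rw [Nat.cast_add, Nat.cast_one, contDiff_succ_iff_fderiv_apply]
    exact ⟨hd F hF, fun h => absurd h (by simp), fun v => ih _ (hS F hF v)⟩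

variable {Y : Type} [NormedAddCommGroup Y] [NormedSpace ℝ Y] [FiniteDimensional ℝ Y]
  [MeasurableSpace Y] [BorelSpace Y] {μ : Measure Y} {k : Y → ℂ}

theorem integrable_kernel_smul {G : Type} [NormedAddCommGroup G] [NormedSpace ℂ G]
    (hk : LocallyIntegrable k μ) {g : Y → G} (hg : Continuous g) {R : ℝ}
    (h : ∀ y, R < ‖y‖ → k y = 0 ∨ g y = 0) : Integrable (fun y => k y • g y) μ := by
  have : ProperSpace Y := FiniteDimensional.proper ℝ Y
  have hc : IsCompact (Metric.closedBall (0 : Y) R) := isCompact_closedBall 0 R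
  rw [← integrableOn_iff_integrable_of_support_subset (s := Metric.closedBall (0 : Y) R)]
  · exact (hk.integrableOn_isCompact hc).smul_continuousOn hg.continuousOn hc
  · intro y hy
    by_contra hy2
    rw [Metric.mem_closedBall, dist_zero_right, not_le] at hy2
    refine hy ?_
    rcases h y hy2 with h | h
    · simp [h]
    · simp [h]

/-- The support condition on a kernel `k` and an integrand `Φ` that makes the integrals
`∫ k(y) Φ(y, z)` locally integrals over a fixed compact set. -/
def LocallySupported (k : Y → ℂ) (Φ : Y → E → ℂ) : Prop :=
  ∀ R : ℝ, ∃ R' : ℝ, ∀ y z, ‖z‖ < R → R' < ‖y‖ → k y = 0 ∨ Φ y z = 0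

omit [FiniteDimensional ℝ E] [FiniteDimensional ℝ Y] [MeasurableSpace Y] [BorelSpace Y] in
theorem fderiv_slice {Φ : Y → E → ℂ} (hΦ : ContDiff ℝ ∞ (Function.uncurry Φ)) (y : Y) (z : E) :
    HasFDerivAt (Φ y) ((fderiv ℝ (Function.uncurry Φ) (y, z)).comp
      (ContinuousLinearMap.inr ℝ Y E)) z := by
  have h1 : HasFDerivAt (Function.uncurry Φ) (fderiv ℝ (Function.uncurry Φ) (y, z)) (y, z) :=
    (hΦ.differentiable (by simp) _).hasFDerivAt
  exact h1.comp z (hasFDerivAt_prodMk_right y z)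

theorem hasFDerivAt_kernel_integral (hk : LocallyIntegrable k μ) {Φ : Y → E → ℂ}
    (hΦ : ContDiff ℝ ∞ (Function.uncurry Φ)) (hs : LocallySupported k Φ) (z : E) :
    HasFDerivAt (fun z => ∫ y, k y * Φ y z ∂μ) (∫ y, k y • fderiv ℝ (Φ y) z ∂μ) z ∧
      Integrable (fun y => k y • fderiv ℝ (Φ y) z) μ := by
  have : ProperSpace Y := FiniteDimensional.proper ℝ Y
  have : ProperSpace E := FiniteDimensional.proper ℝ E
  obtain ⟨R', hR'⟩ := hs (‖z‖ + 1)
  have hfd : ∀ y z, fderiv ℝ (Φ y) z = (fderiv ℝ (Function.uncurry Φ) (y, z)).comp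
      (ContinuousLinearMap.inr ℝ Y E) := fun y z => (fderiv_slice hΦ y z).fderiv
  have hc : Continuous fun p : Y × E => fderiv ℝ (Φ p.1) p.2 := by
    simp only [hfd]
    exact (hΦ.continuous_fderiv (by simp)).clm_comp continuous_const
  have hball : ∀ w ∈ Metric.ball z 1, ‖w‖ < ‖z‖ + 1 := by
    intro w hw
    have h1 : ‖w - z‖ < 1 := by rwa [← dist_eq_norm]
    have h2 := norm_le_norm_add_norm_sub' w z
    linarith
  -- for all parameters in the unit ball around `z` the integrand is supported in one compact ball
  have hdz : ∀ w ∈ Metric.ball z 1, ∀ y, R' < ‖y‖ → k y = 0 ∨ fderiv ℝ (Φ y) w = 0 := by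
    intro w hw y hy
    by_cases hky : k y = 0
    · exact Or.inl hky
    · right
      have h : Φ y =ᶠ[nhds w] fun _ => 0 :=
        Filter.eventually_of_mem (Metric.isOpen_ball.mem_nhds hw) fun x hx =>
          (hR' y x (hball x hx) hy).resolve_left hky
      rw [h.fderiv_eq]
      simp
  have hcy : ∀ w, Continuous fun y => fderiv ℝ (Φ y) w := fun w =>
    hc.comp (continuous_id.prodMk continuous_const)
  have hint : Integrable (fun y => k y • fderiv ℝ (Φ y) z) μ :=
    integrable_kernel_smul hk (hcy z) (hdz z (Metric.mem_ball_self one_pos))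
  refine ⟨?_, hint⟩
  obtain ⟨M, hM⟩ := ((isCompact_closedBall (0 : Y) R').prod
    (isCompact_closedBall z 1)).exists_bound_of_continuousOn hc.continuousOn
  have hΦc : ∀ w, Continuous fun y => Φ y w := fun w =>
    hΦ.continuous.comp (continuous_id.prodMk continuous_const)
  refine hasFDerivAt_integral_of_dominated_of_fderiv_le (𝕜 := ℝ) (s := Metric.ball z 1)
    (bound := (Metric.closedBall (0 : Y) R').indicator fun y => ‖k y‖ * M)
    (F' := fun w y => k y • fderiv ℝ (Φ y) w) (Metric.ball_mem_nhds z one_pos) ?_ ?_ ?_ ?_ ?_ ?_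
  · exact Filter.Eventually.of_forall fun w =>
      hk.aestronglyMeasurable.mul (hΦc w).aestronglyMeasurable
  · exact integrable_kernel_smul hk (hΦc z)
      (fun y hy => hR' y z (hball z (Metric.mem_ball_self one_pos)) hy)
  · exact hint.aestronglyMeasurable
  · refine Filter.Eventually.of_forall fun y w hw => ?_
    by_cases hy : y ∈ Metric.closedBall (0 : Y) R'
    · rw [Set.indicator_of_mem hy, norm_smul]
      exact mul_le_mul_of_nonneg_left (hM (y, w) ⟨hy, Metric.ball_subset_closedBall hw⟩)
        (norm_nonneg _)
    · rw [Set.indicator_of_notMem hy]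
      rw [Metric.mem_closedBall, dist_zero_right, not_le] at hy
      rcases hdz w hw y hy with h | h
      · simp [h]
      · simp [h]
  · rw [integrable_indicator_iff Metric.isClosed_closedBall.measurableSet]
    exact ((hk.integrableOn_isCompact (isCompact_closedBall 0 R')).norm).mul_const M
  · refine Filter.Eventually.of_forall fun y w _ => ?_
    exact (fderiv_slice hΦ y w).differentiableAt.hasFDerivAt.const_smul (k y)

theorem fderiv_kernel_integral (hk : LocallyIntegrable k μ) {Φ : Y → E → ℂ}
    (hΦ : ContDiff ℝ ∞ (Function.uncurry Φ)) (hs : LocallySupported k Φ) (z v : E) :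
    fderiv ℝ (fun z => ∫ y, k y * Φ y z ∂μ) z v = ∫ y, k y * fderiv ℝ (Φ y) z v ∂μ := by
  obtain ⟨h1, h2⟩ := hasFDerivAt_kernel_integral hk hΦ hs z
  rw [h1.fderiv, ContinuousLinearMap.integral_apply h2]
  rfl

/-- Integrals of smooth functions against a locally integrable kernel are smooth. -/
theorem contDiff_kernel_integral (hk : LocallyIntegrable k μ) {Φ : Y → E → ℂ}
    (hΦ : ContDiff ℝ ∞ (Function.uncurry Φ)) (hs : LocallySupported k Φ) :
    ContDiff ℝ ∞ (fun z => ∫ y, k y * Φ y z ∂μ) := by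
  refine contDiff_of_fderiv_mem {F | ∃ Φ : Y → E → ℂ, ContDiff ℝ ∞ (Function.uncurry Φ) ∧
    LocallySupported k Φ ∧ F = fun z => ∫ y, k y * Φ y z ∂μ} ?_ ?_ _ ⟨Φ, hΦ, hs, rfl⟩
  · rintro _ ⟨Φ, hΦ, hs, rfl⟩ z
    exact (hasFDerivAt_kernel_integral hk hΦ hs z).1.differentiableAt
  · rintro _ ⟨Φ, hΦ, hs, rfl⟩ v
    refine ⟨fun y z => fderiv ℝ (Φ y) z v, ?_, ?_,
      funext fun z => fderiv_kernel_integral hk hΦ hs z v⟩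
    · have h : Function.uncurry (fun y z => fderiv ℝ (Φ y) z v)
          = fun p => fderiv ℝ (Function.uncurry Φ) p (0, v) := by
        funext p
        simp only [Function.uncurry, (fderiv_slice hΦ p.1 p.2).fderiv]
        rfl
      rw [h]
      exact (hΦ.fderiv_right (m := ∞) (by simp)).clm_apply contDiff_const
    · intro R
      obtain ⟨R', hR'⟩ := hs R
      refine ⟨R', fun y z hz hy => ?_⟩
      by_cases hky : k y = 0
      · exact Or.inl hky
      · right
        have h : Φ y =ᶠ[nhds z] fun _ => 0 :=
          Filter.eventually_of_mem ((isOpen_lt continuous_norm continuous_const).mem_nhds hz)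
            fun x hx => (hR' y x hx hy).resolve_left hky
        change fderiv ℝ (Φ y) z v = 0
        rw [h.fderiv_eq]
        simp

end Parameters

/-! ### The Cauchy transform -/

/-- The unit complex number with a given argument. -/
noncomputable def unitC (t : ℝ) : ℂ := Real.cos t + Real.sin t * Complex.I

theorem continuous_unitC : Continuous unitC := by unfold unitC; fun_prop

theorem hasDerivAt_unitC (t : ℝ) : HasDerivAt unitC (Complex.I * unitC t) t := by
  have h1 := (Real.hasDerivAt_cos t).ofReal_comp
  have h2 := ((Real.hasDerivAt_sin t).ofReal_comp).mul_const Complex.I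
  refine (h1.add h2).congr_deriv ?_
  simp only [unitC, Complex.ofReal_neg]
  linear_combination (-(Real.sin t : ℂ)) * Complex.I_sq

theorem unitC_norm (t : ℝ) : ‖unitC t‖ = 1 := by
  rw [unitC, Complex.norm_add_mul_I, Real.cos_sq_add_sin_sq, Real.sqrt_one]

theorem unitC_ne_zero (t : ℝ) : unitC t ≠ 0 := by
  intro h
  have := unitC_norm t
  rw [h, norm_zero] at this
  exact zero_ne_one this

theorem real_linear_apply (L : ℂ →L[ℝ] ℂ) (w : ℂ) : L w = w.re * L 1 + w.im * L Complex.I := by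
  have h : w = w.re • (1 : ℂ) + w.im • Complex.I := by simp
  conv_lhs => rw [h]
  rw [map_add, map_smul, map_smul]
  simp

/-- The Cauchy-Riemann operator in polar coordinates. -/
theorem cauchyRiemann_polar (L : ℂ →L[ℝ] ℂ) (t : ℝ) :
    L 1 + Complex.I * L Complex.I
      = unitC t * (L (unitC t) + Complex.I * L (Complex.I * unitC t)) := by
  have hre : (unitC t).re = Real.cos t := by simp [unitC, Complex.cos_ofReal_re]
  have him : (unitC t).im = Real.sin t := by simp [unitC, Complex.sin_ofReal_re]
  rw [real_linear_apply L (unitC t), real_linear_apply L (Complex.I * unitC t),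
    Complex.I_mul_re, Complex.I_mul_im, hre, him, unitC]
  have h := Real.sin_sq_add_cos_sq t
  have h2 : (Real.sin t : ℂ) ^ 2 + (Real.cos t : ℂ) ^ 2 = 1 := by exact_mod_cast h
  push_cast at h2 ⊢
  generalize Complex.sin t = s at *
  generalize Complex.cos t = c at *
  generalize L 1 = a
  generalize L Complex.I = b
  have hI := Complex.I_sq
  linear_combination (-(a + Complex.I * b)) * h2 + (s ^ 2 * (a + Complex.I * b)
    - b * (Complex.I * s ^ 2 + s * c)) * hI

/-- The Cauchy-Pompeiu formula for compactly supported functions. -/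
theorem cauchy_pompeiu {φ : ℂ → ℂ} (hφ : ContDiff ℝ ∞ φ) (hc : HasCompactSupport φ) :
    ∫ u : ℂ, ((Real.pi : ℂ) * u)⁻¹ *
      ((1 / 2 : ℂ) * (fderiv ℝ φ u 1 + Complex.I * fderiv ℝ φ u Complex.I)) = -φ 0 := by
  let A : ℝ × ℝ → ℂ := fun p => fderiv ℝ φ (p.1 * unitC p.2) (unitC p.2)
  let B : ℝ × ℝ → ℂ := fun p => fderiv ℝ φ (p.1 * unitC p.2) (Complex.I * unitC p.2)
  have hpt : Continuous fun p : ℝ × ℝ => (p.1 : ℂ) * unitC p.2 :=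
    (Complex.continuous_ofReal.comp continuous_fst).mul (continuous_unitC.comp continuous_snd)
  have hfd : Continuous (fderiv ℝ φ) := hφ.continuous_fderiv (by simp)
  have hA : Continuous A := (hfd.comp hpt).clm_apply (continuous_unitC.comp continuous_snd)
  have hB : Continuous B := (hfd.comp hpt).clm_apply
    (continuous_const.mul (continuous_unitC.comp continuous_snd))
  have hd : Differentiable ℝ φ := hφ.differentiable (by simp)
  obtain ⟨R, hR⟩ := (hc.fderiv (𝕜 := ℝ)).isCompact.isBounded.subset_closedBall 0
  have hzero : ∀ u : ℂ, R < ‖u‖ → fderiv ℝ φ u = 0 := by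
    intro u hu
    by_contra h
    have := hR (subset_tsupport _ (Function.mem_support.2 h))
    rw [Metric.mem_closedBall, dist_zero_right] at this
    linarith
  have hint : ∀ G : ℝ × ℝ → ℂ, Continuous G → (∀ p : ℝ × ℝ, R < p.1 → 0 < p.1 → G p = 0) →
      IntegrableOn G (Set.Ioi (0 : ℝ) ×ˢ Set.Ioo (-Real.pi) Real.pi) := by
    intro G hG h0
    have h1 : IntegrableOn G (Set.Icc 0 R ×ˢ Set.Icc (-Real.pi) Real.pi) :=
      hG.continuousOn.integrableOn_compact (isCompact_Icc.prod isCompact_Icc)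
    refine h1.of_forall_sdiff_eq_zero (measurableSet_Ioi.prod measurableSet_Ioo) ?_
    rintro ⟨r, t⟩ ⟨⟨hr, ht⟩, hn⟩
    refine h0 _ ?_ hr
    by_contra hle
    exact hn ⟨⟨le_of_lt hr, not_lt.1 hle⟩, ⟨ht.1.le, ht.2.le⟩⟩
  have hnorm : ∀ p : ℝ × ℝ, 0 < p.1 → ‖(p.1 : ℂ) * unitC p.2‖ = p.1 := by
    intro p hp
    rw [norm_mul, unitC_norm, mul_one, Complex.norm_real, Real.norm_of_nonneg hp.le]
  have hAint := hint A hA (fun p h1 h2 => by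
    change fderiv ℝ φ _ _ = 0
    rw [hzero _ (by rwa [hnorm p h2]), zero_apply])
  have hBint := hint B hB (fun p h1 h2 => by
    change fderiv ℝ φ _ _ = 0
    rw [hzero _ (by rwa [hnorm p h2]), zero_apply])
  have hvol : (volume : Measure (ℝ × ℝ)).restrict
      (Set.Ioi (0 : ℝ) ×ˢ Set.Ioo (-Real.pi) Real.pi)
      = (volume.restrict (Set.Ioi (0 : ℝ))).prod
        (volume.restrict (Set.Ioo (-Real.pi) Real.pi)) := by
    rw [Measure.prod_restrict]; rfl
  -- the radial derivative
  have hIA : ∫ p in Set.Ioi (0 : ℝ) ×ˢ Set.Ioo (-Real.pi) Real.pi, A p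
      = (2 * Real.pi : ℂ) * -φ 0 := by
    have h1 : ∀ t : ℝ, ∫ r in Set.Ioi (0 : ℝ), A (r, t) = -φ 0 := by
      intro t
      let ψ : ℝ → ℂ := fun r => φ (r * unitC t)
      have hψ : ∀ r : ℝ, HasDerivAt ψ (A (r, t)) r := by
        intro r
        have h2 : HasDerivAt (fun r : ℝ => (r : ℂ) * unitC t) (unitC t) r := by
          simpa using (Complex.ofRealCLM.hasDerivAt (x := r)).mul_const (unitC t)
        exact (hd _).hasFDerivAt.comp_hasDerivAt r h2
      have hψs : ContDiff ℝ 1 ψ :=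
        (hφ.of_le (by simp)).comp (Complex.ofRealCLM.contDiff.mul contDiff_const)
      have hψc : HasCompactSupport ψ := by
        refine hc.comp_isClosedEmbedding (g := fun r : ℝ => (r : ℂ) * unitC t) ?_
        refine Isometry.isClosedEmbedding (Isometry.of_dist_eq fun a b => ?_)
        rw [dist_eq_norm, ← sub_mul, norm_mul, unitC_norm, mul_one, ← Complex.ofReal_sub,
          Complex.norm_real, Real.dist_eq, Real.norm_eq_abs]
      have h3 := hψc.integral_Ioi_deriv_eq hψs 0
      rw [show deriv ψ = fun r => A (r, t) from funext fun r => (hψ r).deriv] at h3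
      rw [h3]
      simp [ψ]
    rw [hvol, integral_prod_symm A (by rw [← hvol]; exact hAint)]
    simp only [h1]
    rw [setIntegral_const]
    simp only [Measure.real, Real.volume_Ioo, smul_neg, Complex.real_smul]
    rw [ENNReal.toReal_ofReal (by linarith [Real.pi_pos])]
    push_cast
    ring
  -- the angular derivative
  have hIB : ∫ p in Set.Ioi (0 : ℝ) ×ˢ Set.Ioo (-Real.pi) Real.pi, B p = 0 := by
    rw [hvol, integral_prod B (by rw [← hvol]; exact hBint)]
    refine setIntegral_eq_zero_of_forall_eq_zero fun r hr => ?_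
    have hr' : (r : ℂ) ≠ 0 := Complex.ofReal_ne_zero.2 (ne_of_gt hr)
    have h2 : ∀ t : ℝ, HasDerivAt (fun t => φ (r * unitC t)) (r * B (r, t)) t := by
      intro t
      have h3 : HasDerivAt (fun t => (r : ℂ) * unitC t) (r * (Complex.I * unitC t)) t :=
        (hasDerivAt_unitC t).const_mul (r : ℂ)
      refine ((hd _).hasFDerivAt.comp_hasDerivAt t h3).congr_deriv ?_
      change fderiv ℝ φ (r * unitC t) _ = _
      simpa only [Complex.real_smul] using
        (fderiv ℝ φ (r * unitC t)).map_smul r (Complex.I * unitC t)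
    have h4 : ∫ t in (-Real.pi)..Real.pi, (r : ℂ) * B (r, t) = 0 := by
      rw [intervalIntegral.integral_eq_sub_of_hasDerivAt (fun t _ => h2 t)
        ((continuous_const.mul (hB.comp (continuous_const.prodMk continuous_id))).intervalIntegrable
          _ _)]
      have : unitC (-Real.pi) = unitC Real.pi := by simp [unitC]
      rw [this, sub_self]
    rw [intervalIntegral.integral_const_mul, mul_eq_zero, or_iff_right hr',
      intervalIntegral.integral_of_le (by linarith [Real.pi_pos]),
      integral_Ioc_eq_integral_Ioo] at h4
    exact h4
  rw [← Complex.integral_comp_polarCoord_symm]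
  have hpi : (Real.pi : ℂ) ≠ 0 := Complex.ofReal_ne_zero.2 Real.pi_ne_zero
  -- in polar coordinates the absolute value of the kernel cancels the Jacobian
  have hcongr : ∫ p in polarCoord.target, p.1 • (fun u : ℂ => ((Real.pi : ℂ) * u)⁻¹ *
      ((1 / 2 : ℂ) * (fderiv ℝ φ u 1 + Complex.I * fderiv ℝ φ u Complex.I)))
        (Complex.polarCoord.symm p)
      = ∫ p in Set.Ioi (0 : ℝ) ×ˢ Set.Ioo (-Real.pi) Real.pi,
        ((2 * Real.pi : ℂ)⁻¹ * A p + (2 * Real.pi : ℂ)⁻¹ * Complex.I * B p) := by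
    refine setIntegral_congr_fun (measurableSet_Ioi.prod measurableSet_Ioo) ?_
    rintro ⟨r, t⟩ ⟨hr, -⟩
    have hr' : (r : ℂ) ≠ 0 := Complex.ofReal_ne_zero.2 (ne_of_gt hr)
    have hu := unitC_ne_zero t
    have e : Complex.polarCoord.symm (r, t) = r * unitC t := by
      rw [Complex.polarCoord_symm_apply]; rfl
    simp only [e, cauchyRiemann_polar _ t, A, B, Complex.real_smul]
    field_simp
  refine hcongr.trans ?_
  rw [integral_add (hAint.const_mul _) (hBint.const_mul _), integral_const_mul,
    integral_const_mul, hIA, hIB]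
  field_simp
  simp

/-- The kernel `1/(πu)` of the Cauchy transform. -/
noncomputable def cauchyKernel (u : ℂ) : ℂ := ((Real.pi : ℂ) * u)⁻¹

theorem locallyIntegrable_cauchyKernel : LocallyIntegrable cauchyKernel volume := by
  refine locallyIntegrable_of_norm_le_rpow (C := Real.pi⁻¹) (α := 1)
    (by rw [Complex.finrank_real_complex]; norm_num)
    (by rw [Complex.finrank_real_complex]; norm_num)
    (Filter.Eventually.of_forall fun u => ?_) ?_
  · rw [cauchyKernel, norm_inv, norm_mul, Complex.norm_real, Real.norm_of_nonneg Real.pi_pos.le,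
      mul_inv, Real.rpow_neg_one]
  · exact (Measurable.inv (measurable_const.mul measurable_id)).aestronglyMeasurable

/-- The smooth functions supported where `|z_k| ≤ R`. -/
def SuppIn (k : Fin 5) (R : ℝ) (h : Smooth) : Prop := ∀ z, R < ‖z k‖ → h.1 z = 0

theorem SuppIn.dirDer {k : Fin 5} {R : ℝ} {h : Smooth} (hh : SuppIn k R h) (v : Fin 5 → ℂ) :
    SuppIn k R (dirDer v h) := by
  intro z hz
  change fderiv ℝ h.1 z v = 0
  have : h.1 =ᶠ[nhds z] fun _ => 0 := Filter.eventually_of_mem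
    ((isOpen_lt continuous_const (continuous_apply k).norm :
      IsOpen {w : Fin 5 → ℂ | R < ‖w k‖}).mem_nhds hz) hh
  rw [this.fderiv_eq]
  simp

/-- The translate of a function in the direction `-u e_k`. -/
noncomputable def shiftArg (k : Fin 5) (h : Smooth) (u : ℂ) (z : Fin 5 → ℂ) : ℂ :=
  h.1 (z - Pi.single k u)

theorem contDiff_shiftArg (k : Fin 5) (h : Smooth) :
    ContDiff ℝ ∞ (Function.uncurry (shiftArg k h)) := by
  refine (smooth_contDiff h).comp (contDiff_snd.sub ?_)
  exact (ContinuousLinearMap.single ℝ (fun _ : Fin 5 => ℂ) k).contDiff.comp contDiff_fst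

theorem locallySupported_shiftArg {k : Fin 5} {R : ℝ} {h : Smooth} (hh : SuppIn k R h) :
    LocallySupported cauchyKernel (shiftArg k h) := by
  intro R₁
  refine ⟨R + R₁, fun u z hz hu => Or.inr (hh _ ?_)⟩
  rw [Pi.sub_apply, Pi.single_eq_same]
  have h1 : ‖z k‖ ≤ ‖z‖ := norm_le_pi_norm z k
  have h2 : ‖u‖ ≤ ‖z k - u‖ + ‖z k‖ := by
    rw [norm_sub_rev]; simpa using norm_add_le (u - z k) (z k)
  linarith

open Classical in
/-- The Cauchy transform in the variable `z_k` of a smooth function whose support is bounded in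
the direction of that variable (and zero for other functions). -/
noncomputable def cauchy (k : Fin 5) (h : Smooth) : Smooth :=
  if hh : ∃ R, SuppIn k R h then
    ⟨fun z => ∫ u, cauchyKernel u * shiftArg k h u z,
      contDiff_kernel_integral locallyIntegrable_cauchyKernel (contDiff_shiftArg k h)
        (locallySupported_shiftArg hh.choose_spec)⟩
  else 0

theorem cauchy_apply {k : Fin 5} {R : ℝ} {h : Smooth} (hh : SuppIn k R h) (z : Fin 5 → ℂ) :
    (cauchy k h).1 z = ∫ u, cauchyKernel u * h.1 (z - Pi.single k u) := by
  rw [cauchy, dif_pos ⟨R, hh⟩]; rfl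

theorem integrable_cauchy {k : Fin 5} {R : ℝ} {h : Smooth} (hh : SuppIn k R h) (z : Fin 5 → ℂ) :
    Integrable fun u => cauchyKernel u * h.1 (z - Pi.single k u) := by
  obtain ⟨R', hR'⟩ := locallySupported_shiftArg hh (‖z‖ + 1)
  refine integrable_kernel_smul locallyIntegrable_cauchyKernel
    (g := fun u => shiftArg k h u z) ?_ (fun y hy => hR' y z (by linarith) hy)
  exact (contDiff_shiftArg k h).continuous.comp (continuous_id.prodMk continuous_const)

theorem dirDer_cauchy {k : Fin 5} {R : ℝ} {h : Smooth} (hh : SuppIn k R h) (v : Fin 5 → ℂ) :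
    dirDer v (cauchy k h) = cauchy k (dirDer v h) := by
  refine Subtype.ext (funext fun z => ?_)
  rw [cauchy_apply (hh.dirDer v)]
  change fderiv ℝ (cauchy k h).1 z v = _
  have e : (cauchy k h).1 = fun z => ∫ u, cauchyKernel u * shiftArg k h u z :=
    funext fun z => cauchy_apply hh z
  rw [e, fderiv_kernel_integral locallyIntegrable_cauchyKernel (contDiff_shiftArg k h)
    (locallySupported_shiftArg hh)]
  refine integral_congr_ae (Filter.Eventually.of_forall fun u => ?_)
  change _ * fderiv ℝ (fun z => h.1 (z - Pi.single k u)) z v = _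
  rw [fderiv_comp_sub]
  rfl

theorem smooth_add_apply (f g : Smooth) (z : Fin 5 → ℂ) : (f + g).1 z = f.1 z + g.1 z := rfl
theorem smooth_mul_apply (f g : Smooth) (z : Fin 5 → ℂ) : (f * g).1 z = f.1 z * g.1 z := rfl
theorem smooth_sub_apply (f g : Smooth) (z : Fin 5 → ℂ) : (f - g).1 z = f.1 z - g.1 z := rfl
theorem smooth_smul_apply (c : ℂ) (f : Smooth) (z : Fin 5 → ℂ) : (c • f).1 z = c * f.1 z := rfl
theorem smooth_pow_apply (f : Smooth) (n : ℕ) (z : Fin 5 → ℂ) : (f ^ n).1 z = f.1 z ^ n := rfl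
theorem smooth_ext {f g : Smooth} (h : ∀ z, f.1 z = g.1 z) : f = g := Subtype.ext (funext h)

theorem dz_eq (i : Fin 5) (f : Smooth) : dz i f
    = (1 / 2 : ℂ) • (dirDer (Pi.single i 1) f - Complex.I • dirDer (Pi.single i Complex.I) f) := rfl

theorem dzbar_eq (i : Fin 5) (f : Smooth) : dzbar i f
    = (1 / 2 : ℂ) • (dirDer (Pi.single i 1) f + Complex.I • dirDer (Pi.single i Complex.I) f) := rfl

/-- Statements about all Wirtinger derivatives follow from those about directional derivatives. -/
theorem wir_induction {P : Smooth → Prop} (k : Fin 5 ⊕ Fin 5) (f : Smooth)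
    (hd : ∀ v, P (dirDer v f)) (hadd : ∀ f g, P f → P g → P (f + g))
    (hsmul : ∀ (c : ℂ) f, P f → P (c • f)) : P (wir k f) := by
  rcases k with i | i
  · change P (dz i f)
    rw [dz_eq, sub_eq_add_neg, ← neg_smul]
    exact hsmul _ _ (hadd _ _ (hd _) (hsmul _ _ (hd _)))
  · change P (dzbar i f)
    rw [dzbar_eq]
    exact hsmul _ _ (hadd _ _ (hd _) (hsmul _ _ (hd _)))

theorem wir_eq_of_dirDer {T : Smooth → Smooth} {f : Smooth} (k : Fin 5 ⊕ Fin 5) (g : Smooth)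
    (h : ∀ v, dirDer v g = T (dirDer v f))
    (hT : ∀ (a b c : ℂ) v w, T (a • (b • dirDer v f + c • dirDer w f))
      = a • (b • T (dirDer v f) + c • T (dirDer w f))) : wir k g = T (wir k f) := by
  rcases k with i | i
  · change dz i g = T (dz i f)
    have := hT (1 / 2) 1 (-Complex.I) (Pi.single i 1) (Pi.single i Complex.I)
    rw [one_smul, one_smul, neg_smul, neg_smul, ← sub_eq_add_neg, ← sub_eq_add_neg] at this
    rw [dz_eq, dz_eq, this, h, h]
  · change dzbar i g = T (dzbar i f)
    have := hT (1 / 2) 1 Complex.I (Pi.single i 1) (Pi.single i Complex.I)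
    rw [one_smul, one_smul] at this
    rw [dzbar_eq, dzbar_eq, this, h, h]

theorem SuppIn.add {k : Fin 5} {R : ℝ} {f g : Smooth} (hf : SuppIn k R f) (hg : SuppIn k R g) :
    SuppIn k R (f + g) := fun z hz => by rw [smooth_add_apply, hf z hz, hg z hz, add_zero]

theorem SuppIn.smul {k : Fin 5} {R : ℝ} {f : Smooth} (c : ℂ) (hf : SuppIn k R f) :
    SuppIn k R (c • f) := fun z hz => by rw [smooth_smul_apply, hf z hz, mul_zero]

theorem SuppIn.mul_left {k : Fin 5} {R : ℝ} {f : Smooth} (g : Smooth) (hf : SuppIn k R f) :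
    SuppIn k R (g * f) := fun z hz => by rw [smooth_mul_apply, hf z hz, mul_zero]

theorem SuppIn.wir {k : Fin 5} {R : ℝ} {f : Smooth} (hf : SuppIn k R f) (l : Fin 5 ⊕ Fin 5) :
    SuppIn k R (wir l f) :=
  wir_induction l f (fun v => hf.dirDer v) (fun _ _ => SuppIn.add) fun c _ => SuppIn.smul c

theorem cauchy_add {k : Fin 5} {R : ℝ} {f g : Smooth} (hf : SuppIn k R f) (hg : SuppIn k R g) :
    cauchy k (f + g) = cauchy k f + cauchy k g := by
  refine smooth_ext fun z => ?_
  rw [smooth_add_apply, cauchy_apply (hf.add hg), cauchy_apply hf, cauchy_apply hg,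
    ← integral_add (integrable_cauchy hf z) (integrable_cauchy hg z)]
  simp only [smooth_add_apply, mul_add]

theorem cauchy_smul {k : Fin 5} {R : ℝ} {f : Smooth} (c : ℂ) (hf : SuppIn k R f) :
    cauchy k (c • f) = c • cauchy k f := by
  refine smooth_ext fun z => ?_
  rw [smooth_smul_apply, cauchy_apply (hf.smul c), cauchy_apply hf, ← integral_const_mul]
  simp only [smooth_smul_apply, mul_left_comm]

theorem wir_cauchy {k : Fin 5} {R : ℝ} {f : Smooth} (hf : SuppIn k R f) (l : Fin 5 ⊕ Fin 5) :
    wir l (cauchy k f) = cauchy k (wir l f) :=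
  wir_eq_of_dirDer (T := cauchy k) l _ (fun v => dirDer_cauchy hf v)
    fun a b c v w => by
      rw [cauchy_smul a (((hf.dirDer v).smul b).add ((hf.dirDer w).smul c)),
        cauchy_add ((hf.dirDer v).smul b) ((hf.dirDer w).smul c), cauchy_smul b (hf.dirDer v),
        cauchy_smul c (hf.dirDer w)]

theorem hasCompactSupport_shiftArg {k : Fin 5} {R : ℝ} {f : Smooth} (hf : SuppIn k R f)
    (z : Fin 5 → ℂ) : HasCompactSupport fun u => shiftArg k f u z := by
  refine HasCompactSupport.intro (isCompact_closedBall (0 : ℂ) (R + ‖z k‖)) fun u hu => ?_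
  refine hf _ ?_
  rw [Metric.mem_closedBall, dist_zero_right, not_le] at hu
  rw [Pi.sub_apply, Pi.single_eq_same]
  have h2 : ‖u‖ ≤ ‖z k - u‖ + ‖z k‖ := by
    rw [norm_sub_rev]; simpa using norm_add_le (u - z k) (z k)
  linarith

theorem fderiv_shiftArg (k : Fin 5) (f : Smooth) (z : Fin 5 → ℂ) (u w : ℂ) :
    fderiv ℝ (fun u => shiftArg k f u z) u w
      = -(dirDer (Pi.single k w) f).1 (z - Pi.single k u) := by
  have h2 : HasFDerivAt (fun u : ℂ => z - Pi.single k u)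
      (-(ContinuousLinearMap.single ℝ (fun _ : Fin 5 => ℂ) k)) u :=
    (ContinuousLinearMap.single ℝ (fun _ : Fin 5 => ℂ) k).hasFDerivAt.const_sub z
  have h3 := (smooth_differentiable f (z - Pi.single k u)).hasFDerivAt.comp u h2
  change fderiv ℝ (f.1 ∘ fun u : ℂ => z - Pi.single k u) u w = _
  rw [h3.fderiv, ContinuousLinearMap.comp_apply, neg_apply, map_neg]
  rfl

/-- The Cauchy transform solves the Cauchy-Riemann equation. -/
theorem dzbar_cauchy {k : Fin 5} {R : ℝ} {f : Smooth} (hf : SuppIn k R f) :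
    dzbar k (cauchy k f) = f := by
  have h1 : dzbar k (cauchy k f) = cauchy k (dzbar k f) := wir_cauchy hf (Sum.inr k)
  rw [h1]
  refine smooth_ext fun z => ?_
  rw [cauchy_apply (R := R) (h := dzbar k f) (hf.wir (Sum.inr k))]
  have hφ : ContDiff ℝ ∞ fun u => shiftArg k f u z :=
    (contDiff_shiftArg k f).comp (contDiff_id.prodMk contDiff_const)
  have h3 := cauchy_pompeiu hφ (hasCompactSupport_shiftArg hf z)
  have h4 : shiftArg k f 0 z = f.1 z := by rw [shiftArg, Pi.single_zero, sub_zero]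
  rw [h4] at h3
  rw [← neg_inj, ← h3, ← integral_neg]
  refine integral_congr_ae (Filter.Eventually.of_forall fun u => ?_)
  simp only [fderiv_shiftArg, cauchyKernel, dzbar_eq, smooth_smul_apply, smooth_add_apply]
  ring

/-! ### Damped solutions of the Cauchy-Riemann equation -/

/-- The coordinate function `z_k`. -/
def coordFn (k : Fin 5) : Smooth :=
  ⟨fun z => z k, show ContDiff ℝ ∞ fun z : Fin 5 → ℂ => z k from
    (ContinuousLinearMap.proj (R := ℝ) (φ := fun _ : Fin 5 => ℂ) k).contDiff⟩

theorem dirDer_coordFn (k : Fin 5) (v z : Fin 5 → ℂ) : (dirDer v (coordFn k)).1 z = v k := by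
  change fderiv ℝ (ContinuousLinearMap.proj (R := ℝ) (φ := fun _ : Fin 5 => ℂ) k) z v = _
  rw [ContinuousLinearMap.fderiv]; rfl

theorem dz_coordFn (i k : Fin 5) : dz i (coordFn k) = if i = k then 1 else 0 := by
  refine smooth_ext fun z => ?_
  rw [dz_eq, smooth_smul_apply, smooth_sub_apply, smooth_smul_apply, dirDer_coordFn, dirDer_coordFn]
  by_cases h : i = k
  · subst h
    rw [if_pos rfl, Pi.single_eq_same, Pi.single_eq_same, Complex.I_mul_I]
    change _ = (1 : ℂ); norm_num
  · rw [if_neg h, Pi.single_eq_of_ne' h, Pi.single_eq_of_ne' h]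
    change _ = (0 : ℂ); norm_num

theorem dzbar_coordFn (i k : Fin 5) : dzbar i (coordFn k) = 0 := by
  refine smooth_ext fun z => ?_
  rw [dzbar_eq, smooth_smul_apply, smooth_add_apply, smooth_smul_apply, dirDer_coordFn,
    dirDer_coordFn]
  by_cases h : i = k
  · subst h
    rw [Pi.single_eq_same, Pi.single_eq_same, Complex.I_mul_I]
    change _ = (0 : ℂ); norm_num
  · rw [Pi.single_eq_of_ne' h, Pi.single_eq_of_ne' h]
    change _ = (0 : ℂ); norm_num

theorem wir_coordFn {k : Fin 5} {l : Fin 5 ⊕ Fin 5} (hl : l ≠ Sum.inl k) :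
    wir l (coordFn k) = 0 := by
  rcases l with i | i
  · change dz i (coordFn k) = 0
    rw [dz_coordFn, if_neg (fun h => hl (by rw [h]))]
  · exact dzbar_coordFn i k

/-- A function of the one variable `z_k`. -/
def ofCoord (k : Fin 5) (φ : ℂ → ℂ) (hφ : ContDiff ℝ ∞ φ) : Smooth :=
  ⟨fun z => φ (z k),
    hφ.comp (ContinuousLinearMap.proj (R := ℝ) (φ := fun _ : Fin 5 => ℂ) k).contDiff⟩

theorem wir_ofCoord {k : Fin 5} {φ : ℂ → ℂ} (hφ : ContDiff ℝ ∞ φ) {l : Fin 5 ⊕ Fin 5}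
    (hl : l ≠ Sum.inl k) (hl' : l ≠ Sum.inr k) : wir l (ofCoord k φ hφ) = 0 := by
  have hd : ∀ v z, (dirDer v (ofCoord k φ hφ)).1 z = fderiv ℝ φ (z k) (v k) := by
    intro v z
    have h1 : HasFDerivAt (fun z : Fin 5 → ℂ => z k)
        (ContinuousLinearMap.proj (R := ℝ) (φ := fun _ : Fin 5 => ℂ) k) z :=
      (ContinuousLinearMap.proj (R := ℝ) (φ := fun _ : Fin 5 => ℂ) k).hasFDerivAt
    have h2 := ((hφ.differentiable (by simp)) (z k)).hasFDerivAt.comp z h1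
    change fderiv ℝ (φ ∘ fun z : Fin 5 → ℂ => z k) z v = _
    rw [h2.fderiv]; rfl
  refine smooth_ext fun z => ?_
  rcases l with i | i
  · have h : k ≠ i := fun h => hl (by rw [h])
    change (dz i _).1 z = 0
    rw [dz_eq, smooth_smul_apply, smooth_sub_apply, smooth_smul_apply, hd, hd,
      Pi.single_eq_of_ne h, Pi.single_eq_of_ne h]
    simp
  · have h : k ≠ i := fun h => hl' (by rw [h])
    change (dzbar i _).1 z = 0
    rw [dzbar_eq, smooth_smul_apply, smooth_add_apply, smooth_smul_apply, hd, hd,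
      Pi.single_eq_of_ne h, Pi.single_eq_of_ne h]
    simp

/-- A smooth cutoff function, equal to one on the disc of radius `n + 1` and to zero outside of
the disc of radius `n + 2`. -/
noncomputable def cutBump (n : ℕ) : ContDiffBump (0 : ℂ) where
  rIn := n + 1
  rOut := n + 2
  rIn_pos := by positivity
  rIn_lt_rOut := by linarith

theorem contDiff_ofReal_bump (b : ContDiffBump (0 : ℂ)) : ContDiff ℝ ∞ fun u => ((b u : ℝ) : ℂ) :=
  Complex.ofRealCLM.contDiff.comp b.contDiff

/-- The cutoff function in the variable `z_k`. -/
noncomputable def cutoff (k : Fin 5) (n : ℕ) : Smooth :=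
  ofCoord k (fun u => ((cutBump n u : ℝ) : ℂ)) (contDiff_ofReal_bump _)

theorem cutoff_eq_one {k : Fin 5} {n : ℕ} {z : Fin 5 → ℂ} (h : ‖z k‖ ≤ n + 1) :
    (cutoff k n).1 z = 1 := by
  change ((cutBump n (z k) : ℝ) : ℂ) = 1
  rw [(cutBump n).one_of_mem_closedBall (by rw [Metric.mem_closedBall, dist_zero_right]; exact h),
    Complex.ofReal_one]

theorem cutoff_eq_zero {k : Fin 5} {n : ℕ} {z : Fin 5 → ℂ} (h : (n : ℝ) + 2 ≤ ‖z k‖) :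
    (cutoff k n).1 z = 0 := by
  change ((cutBump n (z k) : ℝ) : ℂ) = 0
  rw [(cutBump n).zero_of_le_dist (by rw [dist_zero_right]; exact h), Complex.ofReal_zero]

/-- A smooth cutoff function, equal to zero outside of the unit disc and to one near the origin. -/
noncomputable def smallBump : ContDiffBump (0 : ℂ) where
  rIn := 1 / 2
  rOut := 1
  rIn_pos := by norm_num
  rIn_lt_rOut := by norm_num

theorem contDiff_recip : ContDiff ℝ ∞ fun u : ℂ => (1 - ((smallBump u : ℝ) : ℂ)) * u⁻¹ := by
  rw [contDiff_iff_contDiffAt]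
  intro u
  by_cases hu : u = 0
  · have h : (fun u : ℂ => (1 - ((smallBump u : ℝ) : ℂ)) * u⁻¹) =ᶠ[nhds u] fun _ => 0 := by
      filter_upwards [Metric.closedBall_mem_nhds u (ε := 1 / 2) (by norm_num)] with w hw
      rw [smallBump.one_of_mem_closedBall (by rwa [hu] at hw)]
      simp
    exact contDiffAt_const.congr_of_eventuallyEq h
  · exact (contDiff_const.sub (contDiff_ofReal_bump _)).contDiffAt.mul
      (contDiffAt_id.inv hu)

/-- A smooth function of `z_k`, equal to `1 / z_k` outside of the unit disc. -/
noncomputable def recip (k : Fin 5) : Smooth := ofCoord k _ contDiff_recip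

theorem recip_apply {k : Fin 5} {z : Fin 5 → ℂ} (h : 1 ≤ ‖z k‖) : (recip k).1 z = (z k)⁻¹ := by
  change (1 - ((smallBump (z k) : ℝ) : ℂ)) * (z k)⁻¹ = _
  rw [smallBump.zero_of_le_dist (by rw [dist_zero_right]; exact h)]
  simp

/-- The smooth functions supported where `r ≤ |z_k| ≤ R`. -/
structure Annular (k : Fin 5) (r R : ℝ) (h : Smooth) : Prop where
  inner : ∀ z, ‖z k‖ < r → h.1 z = 0
  outer : SuppIn k R h

variable {k : Fin 5} {r R : ℝ} {f g : Smooth}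

theorem Annular.add (hf : Annular k r R f) (hg : Annular k r R g) : Annular k r R (f + g) :=
  ⟨fun z hz => by rw [smooth_add_apply, hf.inner z hz, hg.inner z hz, add_zero],
    hf.outer.add hg.outer⟩

theorem Annular.smul (c : ℂ) (hf : Annular k r R f) : Annular k r R (c • f) :=
  ⟨fun z hz => by rw [smooth_smul_apply, hf.inner z hz, mul_zero], hf.outer.smul c⟩

theorem Annular.mul_left (g : Smooth) (hf : Annular k r R f) : Annular k r R (g * f) :=
  ⟨fun z hz => by rw [smooth_mul_apply, hf.inner z hz, mul_zero], hf.outer.mul_left g⟩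

theorem Annular.dirDer (hf : Annular k r R f) (v : Fin 5 → ℂ) : Annular k r R (dirDer v f) := by
  refine ⟨fun z hz => ?_, hf.outer.dirDer v⟩
  change fderiv ℝ f.1 z v = 0
  have : f.1 =ᶠ[nhds z] fun _ => 0 := Filter.eventually_of_mem
    ((isOpen_lt (continuous_apply k).norm continuous_const :
      IsOpen {w : Fin 5 → ℂ | ‖w k‖ < r}).mem_nhds hz) hf.inner
  rw [this.fderiv_eq]
  simp

theorem Annular.wir (hf : Annular k r R f) (l : Fin 5 ⊕ Fin 5) : Annular k r R (wir l f) :=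
  wir_induction l f (fun v => hf.dirDer v) (fun _ _ => Annular.add) fun c _ => Annular.smul c

theorem coordFn_mul_recip (hr : 1 ≤ r) (hf : Annular k r R f) : coordFn k * recip k * f = f := by
  refine smooth_ext fun z => ?_
  rw [smooth_mul_apply, smooth_mul_apply]
  by_cases hz : ‖z k‖ < r
  · rw [hf.inner z hz, mul_zero]
  · have h1 : 1 ≤ ‖z k‖ := hr.trans (not_lt.1 hz)
    have h2 : z k ≠ 0 := norm_pos_iff.1 (one_pos.trans_le h1)
    rw [recip_apply h1]
    change z k * (z k)⁻¹ * _ = _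
    rw [mul_inv_cancel₀ h2, one_mul]

theorem wir_recip_mul (hr : 1 ≤ r) (hf : Annular k r R f) {l : Fin 5 ⊕ Fin 5}
    (hl : l ≠ Sum.inl k) : wir l (recip k) * f = 0 := by
  -- differentiate the identity `z_k * recip * f = f`
  have h1 := congrArg (wir l) (coordFn_mul_recip hr hf)
  rw [Derivation.leibniz, Derivation.leibniz, wir_coordFn hl] at h1
  simp only [smul_eq_mul, mul_zero, add_zero] at h1
  rw [coordFn_mul_recip hr (hf.wir l)] at h1
  have h2 : coordFn k * (wir l (recip k) * f) = 0 := by linear_combination h1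
  have h3 := coordFn_mul_recip hr (hf.mul_left (wir l (recip k)))
  rw [← h3, mul_comm (coordFn k), mul_assoc, h2, mul_zero]

theorem dz_recip_mul (hr : 1 ≤ r) (hf : Annular k r R f) :
    dz k (recip k) * f = -(recip k * (recip k * f)) := by
  -- differentiate the identity `z_k * recip * f = f`
  have h1 := congrArg (dz k) (coordFn_mul_recip hr hf)
  rw [Derivation.leibniz, Derivation.leibniz, dz_coordFn, if_pos rfl] at h1
  simp only [smul_eq_mul, mul_one] at h1
  have h4 : coordFn k * recip k * dz k f = dz k f := coordFn_mul_recip hr (hf.wir (Sum.inl k))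
  rw [h4] at h1
  have h2 : coordFn k * (dz k (recip k) * f) = -(recip k * f) := by linear_combination h1
  have h3 := coordFn_mul_recip hr (hf.mul_left (dz k (recip k)))
  rw [← h3, mul_comm (coordFn k), mul_assoc, h2, mul_neg]

/-- A solution of `∂u/∂z̄_k = h` that is small, for large `N`, inside of the annulus that
supports `h`: the solution with the kernel `(z/ζ)^N / (z - ζ)`. -/
noncomputable def damped (k : Fin 5) (N : ℕ) (h : Smooth) : Smooth :=
  coordFn k ^ N * cauchy k (recip k ^ N * h)

theorem coordFn_pow_mul_recip_pow (hr : 1 ≤ r) (hf : Annular k r R f) (N : ℕ) :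
    coordFn k ^ N * (recip k ^ N * f) = f := by
  induction N with
  | zero => simp
  | succ N ih =>
    have h : coordFn k ^ (N + 1) * (recip k ^ (N + 1) * f)
        = coordFn k ^ N * (recip k ^ N * (coordFn k * recip k * f)) := by ring
    rw [h, coordFn_mul_recip hr hf, ih]

theorem wir_pow_mul_of_eq_zero {l : Fin 5 ⊕ Fin 5} {a f : Smooth} (h : wir l a * f = 0) (N : ℕ) :
    wir l (a ^ N * f) = a ^ N * wir l f := by
  rw [Derivation.leibniz, Derivation.leibniz_pow]
  simp only [smul_eq_mul, nsmul_eq_mul]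
  linear_combination (N * a ^ (N - 1)) * h

theorem wir_damped (hr : 1 ≤ r) (hf : Annular k r R f) {l : Fin 5 ⊕ Fin 5} (hl : l ≠ Sum.inl k)
    (N : ℕ) : wir l (damped k N f) = damped k N (wir l f) := by
  rw [damped, wir_pow_mul_of_eq_zero (by rw [wir_coordFn hl, zero_mul]),
    wir_cauchy (hf.mul_left _).outer, wir_pow_mul_of_eq_zero (wir_recip_mul hr hf hl), damped]

theorem dzbar_damped (hr : 1 ≤ r) (hf : Annular k r R f) (N : ℕ) :
    dzbar k (damped k N f) = f := by
  have h1 : dzbar k (damped k N f) = coordFn k ^ N * dzbar k (cauchy k (recip k ^ N * f)) :=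
    wir_pow_mul_of_eq_zero (l := Sum.inr k) (by
      rw [wir_coordFn (by simp), zero_mul]) N
  rw [h1, dzbar_cauchy (hf.mul_left _).outer, coordFn_pow_mul_recip_pow hr hf]

theorem dz_damped (hr : 1 ≤ r) (hf : Annular k r R f) (N : ℕ) :
    dz k (damped k N f) = (N : ℂ) • (damped k (N - 1) (recip k * f) - damped k N (recip k * f))
      + damped k N (dz k f) := by
  have h1 : dz k (recip k ^ N * f)
      = recip k ^ N * dz k f + (-(N : ℂ)) • (recip k ^ N * (recip k * f)) := by
    rw [Derivation.leibniz, Derivation.leibniz_pow]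
    simp only [smul_eq_mul, nsmul_eq_mul]
    have h2 := dz_recip_mul hr hf
    have h3 : (-(N : ℂ)) • (recip k ^ N * (recip k * f))
        = -((N : Smooth) * (recip k ^ N * (recip k * f))) := by
      rw [neg_smul, Nat.cast_smul_eq_nsmul, nsmul_eq_mul]
    rw [h3]
    rcases N with _ | N
    · simp
    · rw [Nat.add_sub_cancel]
      linear_combination ((N + 1 : ℕ) * recip k ^ N : Smooth) * h2
  have h4 : dz k (cauchy k (recip k ^ N * f)) = cauchy k (recip k ^ N * dz k f)
      + (-(N : ℂ)) • cauchy k (recip k ^ N * (recip k * f)) := by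
    have h5 : dz k (cauchy k (recip k ^ N * f)) = cauchy k (dz k (recip k ^ N * f)) :=
      wir_cauchy (hf.mul_left _).outer (Sum.inl k)
    have h6 : Annular k r R (dz k f) := hf.wir (Sum.inl k)
    rw [h5, h1, cauchy_add (h6.mul_left _).outer
      (((hf.mul_left (recip k)).mul_left (recip k ^ N)).smul _).outer,
      cauchy_smul _ ((hf.mul_left (recip k)).mul_left (recip k ^ N)).outer]
  rw [damped, Derivation.leibniz, h4, Derivation.leibniz_pow, dz_coordFn, if_pos rfl]
  simp only [smul_eq_mul, nsmul_eq_mul, mul_one]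
  rcases N with _ | N
  · simp [damped]
  · rw [Nat.add_sub_cancel]
    have h7 : recip k ^ (N + 1) * f = recip k ^ N * (recip k * f) := by ring
    rw [h7]
    simp only [damped, smul_sub, mul_add, neg_smul, Nat.cast_smul_eq_nsmul, nsmul_eq_mul]
    ring

/-- Iterated Wirtinger derivatives. -/
noncomputable def word : List (Fin 5 ⊕ Fin 5) → Smooth →ₗ[ℂ] Smooth
  | [] => LinearMap.id
  | l :: L => word L ∘ₗ (wir l).toLinearMap

theorem word_cons (l : Fin 5 ⊕ Fin 5) (L : List (Fin 5 ⊕ Fin 5)) (f : Smooth) :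
    word (l :: L) f = word L (wir l f) := rfl

/-- A sequence of functions that decreases on the set `K` faster than any power of its index. -/
def Decays (K : Set (Fin 5 → ℂ)) (u : ℕ → Smooth) : Prop :=
  ∀ j : ℕ, ∀ ε : ℝ, 0 < ε → ∀ᶠ N : ℕ in Filter.atTop, ∀ z ∈ K, (N : ℝ) ^ j * ‖(u N).1 z‖ ≤ ε

theorem Decays.add {K : Set (Fin 5 → ℂ)} {u v : ℕ → Smooth} (hu : Decays K u) (hv : Decays K v) :
    Decays K fun N => u N + v N := by
  intro j ε hε
  filter_upwards [hu j (ε / 2) (by positivity), hv j (ε / 2) (by positivity)] with N h1 h2 z hz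
  have h3 : (N : ℝ) ^ j * ‖(u N + v N).1 z‖ ≤ (N : ℝ) ^ j * (‖(u N).1 z‖ + ‖(v N).1 z‖) :=
    mul_le_mul_of_nonneg_left (norm_add_le _ _) (by positivity)
  linarith [h1 z hz, h2 z hz, mul_add ((N : ℝ) ^ j) ‖(u N).1 z‖ ‖(v N).1 z‖]

theorem Decays.sub {K : Set (Fin 5 → ℂ)} {u v : ℕ → Smooth} (hu : Decays K u) (hv : Decays K v) :
    Decays K fun N => u N - v N := by
  intro j ε hε
  filter_upwards [hu j (ε / 2) (by positivity), hv j (ε / 2) (by positivity)] with N h1 h2 z hz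
  have h3 : (N : ℝ) ^ j * ‖(u N - v N).1 z‖ ≤ (N : ℝ) ^ j * (‖(u N).1 z‖ + ‖(v N).1 z‖) :=
    mul_le_mul_of_nonneg_left (norm_sub_le _ _) (by positivity)
  linarith [h1 z hz, h2 z hz, mul_add ((N : ℝ) ^ j) ‖(u N).1 z‖ ‖(v N).1 z‖]

theorem Decays.natCast_smul {K : Set (Fin 5 → ℂ)} {u : ℕ → Smooth} (hu : Decays K u) :
    Decays K fun N => (N : ℂ) • u N := by
  intro j ε hε
  filter_upwards [hu (j + 1) ε hε] with N h1 z hz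
  have h2 := h1 z hz
  rw [smooth_smul_apply, norm_mul, Complex.norm_natCast]
  rwa [pow_succ, mul_assoc] at h2

theorem Decays.pred {K : Set (Fin 5 → ℂ)} {u : ℕ → Smooth} (hu : Decays K u) :
    Decays K fun N => u (N - 1) := by
  intro j ε hε
  have h := (Filter.tendsto_sub_atTop_nat 1).eventually (hu j (ε / 2 ^ j) (by positivity))
  filter_upwards [h, Filter.eventually_ge_atTop 2] with N h1 hN z hz
  have h2 := h1 z hz
  have h3 : (N : ℝ) ≤ 2 * ((N - 1 : ℕ) : ℝ) := by
    have : N ≤ 2 * (N - 1) := by omega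
    exact_mod_cast this
  have h4 : (N : ℝ) ^ j ≤ 2 ^ j * ((N - 1 : ℕ) : ℝ) ^ j := by
    rw [← mul_pow]; exact pow_le_pow_left₀ (Nat.cast_nonneg _) h3 j
  rw [le_div_iff₀ (by positivity)] at h2
  calc (N : ℝ) ^ j * ‖(u (N - 1)).1 z‖
      ≤ 2 ^ j * ((N - 1 : ℕ) : ℝ) ^ j * ‖(u (N - 1)).1 z‖ :=
        mul_le_mul_of_nonneg_right h4 (norm_nonneg _)
    _ ≤ ε := by linarith

/-- The points with `|z| ≤ R₀` and `|z_k| ≤ r'`. -/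
def decaySet (k : Fin 5) (r' R₀ : ℝ) : Set (Fin 5 → ℂ) := {z | ‖z‖ ≤ R₀ ∧ ‖z k‖ ≤ r'}

/-- On the support of `f` the reciprocal of `z_k` is at most `1 / r` in absolute value. -/
theorem norm_damped_le {k : Fin 5} {r R : ℝ} (hr : 1 ≤ r) {f : Smooth} (hf : Annular k r R f)
    (R₀ : ℝ) : ∃ M : ℝ, ∀ N z, ‖z‖ ≤ R₀ → ‖(damped k N f).1 z‖ ≤ (‖z k‖ / r) ^ N * M := by
  have hr0 : 0 < r := one_pos.trans_le hr
  obtain ⟨R', hR'⟩ := locallySupported_shiftArg hf.outer (R₀ + 1)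
  obtain ⟨C, hC⟩ := ((isCompact_closedBall (0 : ℂ) R').prod
    (isCompact_closedBall (0 : Fin 5 → ℂ) R₀)).exists_bound_of_continuousOn
      (contDiff_shiftArg k f).continuous.continuousOn
  have hK : IntegrableOn (fun u => ‖cauchyKernel u‖) (Metric.closedBall 0 R') :=
    (locallyIntegrable_cauchyKernel.integrableOn_isCompact (isCompact_closedBall 0 R')).norm
  refine ⟨∫ u in Metric.closedBall (0 : ℂ) R', ‖cauchyKernel u‖ * C, fun N z hz => ?_⟩
  have h1 : ‖(cauchy k (recip k ^ N * f)).1 z‖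
      ≤ (r⁻¹) ^ N * ∫ u in Metric.closedBall (0 : ℂ) R', ‖cauchyKernel u‖ * C := by
    rw [cauchy_apply (hf.mul_left _).outer, ← integral_const_mul,
      ← integral_indicator Metric.isClosed_closedBall.measurableSet]
    refine norm_integral_le_of_norm_le (IntegrableOn.integrable_indicator
      ((hK.mul_const C).const_mul _) Metric.isClosed_closedBall.measurableSet)
      (Filter.Eventually.of_forall fun u => ?_)
    rw [norm_mul, smooth_mul_apply, norm_mul, smooth_pow_apply, norm_pow]
    by_cases hu : u ∈ Metric.closedBall (0 : ℂ) R'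
    · rw [Set.indicator_of_mem hu]
      have h2 : ‖f.1 (z - Pi.single k u)‖ ≤ C :=
        hC (u, z) ⟨hu, by rwa [Metric.mem_closedBall, dist_zero_right]⟩
      by_cases h3 : ‖(z - Pi.single k u : Fin 5 → ℂ) k‖ < r
      · rw [hf.inner _ h3, norm_zero, mul_zero, mul_zero]
        have h4 : 0 ≤ C := (norm_nonneg _).trans h2
        positivity
      · rw [recip_apply (hr.trans (not_lt.1 h3)), norm_inv]
        have h4 : ‖(z - Pi.single k u : Fin 5 → ℂ) k‖⁻¹ ^ N ≤ (r⁻¹) ^ N :=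
          pow_le_pow_left₀ (by positivity) (inv_anti₀ hr0 (not_lt.1 h3)) N
        calc ‖cauchyKernel u‖ * (‖(z - Pi.single k u : Fin 5 → ℂ) k‖⁻¹ ^ N * ‖f.1 (z - Pi.single k u)‖)
            ≤ ‖cauchyKernel u‖ * ((r⁻¹) ^ N * C) :=
              mul_le_mul_of_nonneg_left (mul_le_mul h4 h2 (norm_nonneg _) (by positivity))
                (norm_nonneg _)
          _ = (r⁻¹) ^ N * (‖cauchyKernel u‖ * C) := by ring
    · rw [Set.indicator_of_notMem hu]
      rw [Metric.mem_closedBall, dist_zero_right, not_le] at hu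
      rcases hR' u z (by linarith) hu with h | h
      · simp [h]
      · have h2 : f.1 (z - Pi.single k u) = 0 := h
        simp [h2]
  rw [damped, smooth_mul_apply, norm_mul, smooth_pow_apply, norm_pow, div_eq_mul_inv, mul_pow,
    mul_assoc]
  exact mul_le_mul_of_nonneg_left h1 (by positivity)

theorem decays_damped {k : Fin 5} {r R : ℝ} (hr : 1 ≤ r) {f : Smooth} (hf : Annular k r R f)
    {r' : ℝ} (hr' : r' < r) (R₀ : ℝ) : Decays (decaySet k r' R₀) fun N => damped k N f := by
  intro j ε hε
  have hr0 : 0 < r := one_pos.trans_le hr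
  obtain ⟨M, hM⟩ := norm_damped_le hr hf R₀
  by_cases hr'0 : r' < 0
  · refine Filter.Eventually.of_forall fun N z hz => ?_
    exact absurd (hz.2.trans_lt hr'0) (not_lt.2 (norm_nonneg _))
  have hq : |r' / r| < 1 := by
    rw [abs_of_nonneg (div_nonneg (not_lt.1 hr'0) hr0.le)]
    exact (div_lt_one hr0).2 hr'
  have hlim := (tendsto_pow_const_mul_const_pow_of_abs_lt_one j hq).mul_const |M|
  rw [zero_mul] at hlim
  filter_upwards [hlim.eventually (gt_mem_nhds hε)] with N hN z hz
  refine le_trans ?_ hN.le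
  rw [mul_assoc]
  refine mul_le_mul_of_nonneg_left ((hM N z hz.1).trans ?_) (by positivity)
  refine (mul_le_mul_of_nonneg_left (le_abs_self M) (by positivity)).trans ?_
  refine mul_le_mul_of_nonneg_right (pow_le_pow_left₀ (by positivity) ?_ N) (abs_nonneg M)
  exact div_le_div_of_nonneg_right hz.2 hr0.le

/-- All derivatives of the damped solutions decay: each `∂/∂z_k` costs a factor `N`, which the
geometric decay absorbs. -/
theorem decays_word_damped {k : Fin 5} {r R : ℝ} (hr : 1 ≤ r) {r' : ℝ} (hr' : r' < r) (R₀ : ℝ)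
    (L : List (Fin 5 ⊕ Fin 5)) (f : Smooth) (hf : Annular k r R f) :
    Decays (decaySet k r' R₀) fun N => word L (damped k N f) := by
  induction L generalizing f with
  | nil => exact decays_damped hr hf hr' R₀
  | cons l L ih =>
    by_cases hl : l = Sum.inl k
    · subst hl
      have h1 : (fun N => word (Sum.inl k :: L) (damped k N f))
          = fun N : ℕ => (N : ℂ) • (word L (damped k (N - 1) (recip k * f))
            - word L (damped k N (recip k * f))) + word L (damped k N (wir (Sum.inl k) f)) := by
        funext N
        rw [word_cons]
        change word L (dz k (damped k N f)) = _
        rw [dz_damped hr hf, map_add, map_smul, map_sub]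
        rfl
      rw [h1]
      have h2 := ih _ (hf.mul_left (recip k))
      exact ((h2.pred.sub h2).natCast_smul).add (ih _ (hf.wir (Sum.inl k)))
    · have h1 : (fun N => word (l :: L) (damped k N f))
          = fun N => word L (damped k N (wir l f)) := by
        funext N
        rw [word_cons, wir_damped hr hf hl]
      rw [h1]
      exact ih _ (hf.wir l)

/-! ### Smooth sums of series -/

theorem dirDer_eq_wir (v : Fin 5 → ℂ) (f : Smooth) : dirDer v f
    = ∑ i, (v i • wir (Sum.inl i) f + (starRingEnd ℂ (v i)) • wir (Sum.inr i) f) := by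
  have h : ∀ i, v i • wir (Sum.inl i) f + (starRingEnd ℂ (v i)) • wir (Sum.inr i) f
      = dirDer (Pi.single i (v i)) f := by
    intro i
    refine smooth_ext fun z => ?_
    change v i * (dz i f).1 z + starRingEnd ℂ (v i) * (dzbar i f).1 z
      = fderiv ℝ f.1 z (Pi.single i (v i))
    have e : (Pi.single i (v i) : Fin 5 → ℂ)
        = (v i).re • (Pi.single i 1 : Fin 5 → ℂ)
          + (v i).im • (Pi.single i Complex.I : Fin 5 → ℂ) := by
      rw [← Pi.single_smul, ← Pi.single_smul, ← Pi.single_add]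
      congr 1
      simp
    rw [e, map_add, map_smul, map_smul, dz_eq, dzbar_eq]
    change _ * (1 / 2 * (fderiv ℝ f.1 z (Pi.single i 1)
        - Complex.I * fderiv ℝ f.1 z (Pi.single i Complex.I)))
      + _ * (1 / 2 * (fderiv ℝ f.1 z (Pi.single i 1)
        + Complex.I * fderiv ℝ f.1 z (Pi.single i Complex.I))) = _
    simp only [Complex.real_smul]
    generalize fderiv ℝ f.1 z (Pi.single i 1) = a
    generalize fderiv ℝ f.1 z (Pi.single i Complex.I) = b
    conv_lhs => rw [← Complex.re_add_im (v i)]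
    simp only [map_add, map_mul, Complex.conj_ofReal, Complex.conj_I]
    linear_combination (-((v i).im : ℂ) * b) * Complex.I_sq
  rw [Finset.sum_congr rfl fun i _ => h i]
  refine smooth_ext fun z => ?_
  have h2 : ∀ s : Finset (Fin 5), (∑ i ∈ s, dirDer (Pi.single i (v i)) f).1 z
      = ∑ i ∈ s, fderiv ℝ f.1 z (Pi.single i (v i)) := by
    intro s
    induction s using Finset.induction_on with
    | empty => rfl
    | insert a s ha ih =>
      rw [Finset.sum_insert ha, Finset.sum_insert ha, smooth_add_apply, ih]; rfl
  rw [h2, ← map_sum, Finset.univ_sum_single]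
  rfl

theorem norm_fderiv_le (f : Smooth) (z : Fin 5 → ℂ) :
    ‖fderiv ℝ f.1 z‖ ≤ ∑ l, ‖(wir l f).1 z‖ := by
  refine ContinuousLinearMap.opNorm_le_bound _ (Finset.sum_nonneg fun _ _ => norm_nonneg _)
    fun v => ?_
  have h1 : fderiv ℝ f.1 z v = ∑ i, (v i * (wir (Sum.inl i) f).1 z
      + starRingEnd ℂ (v i) * (wir (Sum.inr i) f).1 z) := by
    have h2 := congrArg (fun g : Smooth => g.1 z) (dirDer_eq_wir v f)
    refine h2.trans ?_
    generalize (Finset.univ : Finset (Fin 5)) = s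
    induction s using Finset.induction_on with
    | empty => rfl
    | insert a s ha ih =>
      rw [Finset.sum_insert ha, Finset.sum_insert ha, ← ih]; rfl
  rw [h1, Fintype.sum_sum_type, add_mul, Finset.sum_mul, Finset.sum_mul, ← Finset.sum_add_distrib]
  refine (norm_sum_le _ _).trans (Finset.sum_le_sum fun i _ => (norm_add_le _ _).trans ?_)
  rw [norm_mul, norm_mul, RCLike.norm_conj, mul_comm, mul_comm ‖v i‖]
  exact add_le_add (mul_le_mul_of_nonneg_left (norm_le_pi_norm v i) (norm_nonneg _))
    (mul_le_mul_of_nonneg_left (norm_le_pi_norm v i) (norm_nonneg _))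

/-- Uniform absolute summability on bounded sets. -/
def BddSummable (u : ℕ → Smooth) : Prop :=
  ∀ R : ℝ, ∃ M : ℕ → ℝ, Summable M ∧ ∀ n z, ‖z‖ ≤ R → ‖(u n).1 z‖ ≤ M n

theorem BddSummable.add {u v : ℕ → Smooth} (hu : BddSummable u) (hv : BddSummable v) :
    BddSummable fun n => u n + v n := by
  intro R
  obtain ⟨M, hM, h1⟩ := hu R
  obtain ⟨M', hM', h2⟩ := hv R
  exact ⟨_, hM.add hM', fun n z hz => (norm_add_le _ _).trans (add_le_add (h1 n z hz) (h2 n z hz))⟩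

theorem BddSummable.smul {u : ℕ → Smooth} (c : ℂ) (hu : BddSummable u) :
    BddSummable fun n => c • u n := by
  intro R
  obtain ⟨M, hM, h1⟩ := hu R
  refine ⟨_, hM.mul_left ‖c‖, fun n z hz => ?_⟩
  rw [smooth_smul_apply, norm_mul]
  exact mul_le_mul_of_nonneg_left (h1 n z hz) (norm_nonneg _)

theorem bddSummable_of_eventually {u : ℕ → Smooth}
    (h : ∀ R : ℝ, ∃ n₀ : ℕ, ∀ n ≥ n₀, ∀ z, ‖z‖ ≤ R → ‖(u n).1 z‖ ≤ (1 / 2 : ℝ) ^ n) :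
    BddSummable u := by
  intro R
  obtain ⟨n₀, hn⟩ := h R
  have hC : ∀ n, ∃ C, ∀ z, ‖z‖ ≤ R → ‖(u n).1 z‖ ≤ C := fun n => by
    obtain ⟨C, hC⟩ := (isCompact_closedBall (0 : Fin 5 → ℂ) R).exists_bound_of_continuousOn
      (smooth_contDiff (u n)).continuous.continuousOn
    exact ⟨C, fun z hz => hC z (by rwa [Metric.mem_closedBall, dist_zero_right])⟩
  choose C hC using hC
  refine ⟨fun n => if n < n₀ then C n else (1 / 2 : ℝ) ^ n, ?_, fun n z hz => ?_⟩
  · rw [← summable_nat_add_iff n₀]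
    have h1 : Summable fun n : ℕ => (1 / 2 : ℝ) ^ n :=
      summable_geometric_of_lt_one (by norm_num) (by norm_num)
    refine ((summable_nat_add_iff n₀).2 h1).congr fun n => ?_
    rw [if_neg (by omega)]
  · by_cases hn' : n < n₀
    · simp only [if_pos hn']; exact hC n z hz
    · simp only [if_neg hn']; exact hn n (not_lt.1 hn') z hz

theorem BddSummable.hasSum {u : ℕ → Smooth} (hu : BddSummable u) (z : Fin 5 → ℂ) :
    HasSum (fun n => (u n).1 z) (∑' n, (u n).1 z) := by
  obtain ⟨M, hM, h1⟩ := hu ‖z‖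
  exact (Summable.of_norm_bounded hM fun n => h1 n z le_rfl).hasSum

theorem BddSummable.fderiv {u : ℕ → Smooth} (hu : BddSummable u)
    (hw : ∀ l, BddSummable fun n => wir l (u n)) (z : Fin 5 → ℂ) :
    DifferentiableAt ℝ (fun z => ∑' n, (u n).1 z) z ∧ ∀ v,
      HasSum (fun n => (dirDer v (u n)).1 z) (fderiv ℝ (fun z => ∑' n, (u n).1 z) z v) := by
  choose M hM h1 using fun l => hw l (‖z‖ + 1)
  have hsum : Summable fun n => ∑ l, M l n := summable_sum fun l _ => hM l
  have hbound : ∀ n x, x ∈ Metric.ball (0 : Fin 5 → ℂ) (‖z‖ + 1) →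
      ‖_root_.fderiv ℝ (u n).1 x‖ ≤ ∑ l, M l n := by
    intro n x hx
    rw [Metric.mem_ball, dist_zero_right] at hx
    exact (norm_fderiv_le _ _).trans (Finset.sum_le_sum fun l _ => h1 l n x hx.le)
  have hz : z ∈ Metric.ball (0 : Fin 5 → ℂ) (‖z‖ + 1) := by
    rw [Metric.mem_ball, dist_zero_right]; linarith
  have hd := hasFDerivAt_tsum_of_isPreconnected (𝕜 := ℝ) (f := fun n => (u n).1)
    (f' := fun n => _root_.fderiv ℝ (u n).1) hsum Metric.isOpen_ball
    (convex_ball (0 : Fin 5 → ℂ) (‖z‖ + 1)).isPreconnected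
    (fun n x _ => (smooth_differentiable (u n) x).hasFDerivAt) hbound hz (hu.hasSum z).summable hz
  refine ⟨hd.differentiableAt, fun v => ?_⟩
  rw [hd.fderiv]
  have hs : Summable fun n => _root_.fderiv ℝ (u n).1 z :=
    Summable.of_norm_bounded hsum fun n => hbound n z hz
  exact (ContinuousLinearMap.apply ℝ ℂ v).hasSum hs.hasSum

theorem word_dirDer (L : List (Fin 5 ⊕ Fin 5)) (v : Fin 5 → ℂ) (f : Smooth) :
    word L (dirDer v f)
      = ∑ i, (v i • word (Sum.inl i :: L) f + (starRingEnd ℂ (v i)) • word (Sum.inr i :: L) f) := by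
  rw [dirDer_eq_wir, map_sum]
  simp only [map_add, map_smul, word_cons]

theorem bddSummable_dirDer {u : ℕ → Smooth} (hu : ∀ L, BddSummable fun n => word L (u n))
    (v : Fin 5 → ℂ) (L : List (Fin 5 ⊕ Fin 5)) : BddSummable fun n => word L (dirDer v (u n)) := by
  simp only [word_dirDer]
  generalize (Finset.univ : Finset (Fin 5)) = s
  induction s using Finset.induction_on with
  | empty => exact fun R => ⟨0, summable_zero, fun n z _ => by simp⟩
  | insert a s ha ih =>
    simp only [Finset.sum_insert ha]
    exact (((hu _).smul _).add ((hu _).smul _)).add ih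

/-- A series of smooth functions all of whose derivatives are summable uniformly on bounded sets
has a smooth sum, and can be differentiated termwise. -/
theorem exists_smooth_sum {u : ℕ → Smooth} (hu : ∀ L, BddSummable fun n => word L (u n)) :
    ∃ g : Smooth, ∀ l z, HasSum (fun n => (wir l (u n)).1 z) ((wir l g).1 z) := by
  have hsm : ContDiff ℝ ∞ fun z => ∑' n, (u n).1 z := by
    refine contDiff_of_fderiv_mem {F | ∃ u : ℕ → Smooth, (∀ L, BddSummable fun n => word L (u n)) ∧
      F = fun z => ∑' n, (u n).1 z} ?_ ?_ _ ⟨u, hu, rfl⟩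
    · rintro _ ⟨u, hu, rfl⟩ z
      exact ((hu []).fderiv (fun l => hu [l]) z).1
    · rintro _ ⟨u, hu, rfl⟩ v
      refine ⟨fun n => dirDer v (u n), bddSummable_dirDer hu v, funext fun z => ?_⟩
      exact (((hu []).fderiv (fun l => hu [l]) z).2 v).tsum_eq.symm
  refine ⟨⟨_, hsm⟩, fun l z => ?_⟩
  have hd : ∀ v, HasSum (fun n => (dirDer v (u n)).1 z)
      ((dirDer v (⟨_, hsm⟩ : Smooth)).1 z) := ((hu []).fderiv (fun l => hu [l]) z).2
  rcases l with i | i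
  · exact ((hd _).sub ((hd _).mul_left Complex.I)).mul_left (1 / 2 : ℂ)
  · exact ((hd _).add ((hd _).mul_left Complex.I)).mul_left (1 / 2 : ℂ)

theorem cauchy_zero (k : Fin 5) : cauchy k 0 = 0 := by
  have h : SuppIn k 0 0 := fun _ _ => rfl
  have := cauchy_smul 0 h
  rwa [zero_smul, zero_smul] at this

theorem damped_zero (k : Fin 5) (N : ℕ) : damped k N 0 = 0 := by
  rw [damped, mul_zero, cauchy_zero, mul_zero]

theorem wir_cutoff_mul {k : Fin 5} {l : Fin 5 ⊕ Fin 5} (hl : l ≠ Sum.inl k) (hl' : l ≠ Sum.inr k)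
    (n : ℕ) (f : Smooth) : wir l (cutoff k n * f) = cutoff k n * wir l f := by
  have h : wir l (cutoff k n) = 0 := wir_ofCoord (contDiff_ofReal_bump _) hl hl'
  rw [Derivation.leibniz, h]
  simp

theorem suppIn_cutoff_mul (k : Fin 5) (n : ℕ) (f : Smooth) :
    SuppIn k (n + 2) (cutoff k n * f) := fun z hz => by
  rw [smooth_mul_apply, cutoff_eq_zero hz.le, zero_mul]

/-- The part of a function that is supported in the `n`-th annulus. -/
noncomputable def annularPart (k : Fin 5) (f : Smooth) (n : ℕ) : Smooth :=
  cutoff k (n + 1) * f - cutoff k n * f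

theorem annular_annularPart (k : Fin 5) (f : Smooth) (n : ℕ) :
    Annular k (n + 1) (n + 3) (annularPart k f n) := by
  constructor
  · intro z hz
    rw [annularPart, smooth_sub_apply, smooth_mul_apply, smooth_mul_apply, cutoff_eq_one hz.le,
      cutoff_eq_one (by push_cast; linarith), sub_self]
  · intro z hz
    rw [annularPart, smooth_sub_apply, smooth_mul_apply, smooth_mul_apply,
      cutoff_eq_zero (by push_cast; linarith), cutoff_eq_zero (by linarith), sub_self]

theorem hasSum_annularPart (k : Fin 5) (f : Smooth) (z : Fin 5 → ℂ) (s : ℂ)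
    (h : HasSum (fun n => (annularPart k f n).1 z) s) : (cutoff k 0 * f).1 z + s = f.1 z := by
  have h1 : ∀ m : ℕ, ∑ n ∈ Finset.range m, (annularPart k f n).1 z
      = (cutoff k m * f).1 z - (cutoff k 0 * f).1 z := fun m =>
    Finset.sum_range_sub (fun n => (cutoff k n * f).1 z) m
  have h2 := h.tendsto_sum_nat
  simp only [h1] at h2
  have h3 : Filter.Tendsto (fun m : ℕ => (cutoff k m * f).1 z - (cutoff k 0 * f).1 z) Filter.atTop
      (nhds (f.1 z - (cutoff k 0 * f).1 z)) := by
    refine tendsto_const_nhds.congr' ?_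
    filter_upwards [Filter.eventually_ge_atTop ⌈‖z k‖⌉₊] with m hm
    have h4 : ‖z k‖ ≤ m := (Nat.le_ceil _).trans (by exact_mod_cast hm)
    rw [smooth_mul_apply (cutoff k m), cutoff_eq_one (by linarith), one_mul]
  rw [tendsto_nhds_unique h2 h3]
  ring

/-- The Cauchy-Riemann equation in one variable is solvable on the whole plane, with a solution
that commutes with the derivatives in the other variables. The solution is a sum over annuli; the
damped solution in each annulus differs from the Cauchy transform by a function entire in `z_k`. -/
theorem exists_dzbar_eq (k : Fin 5) (f : Smooth) : ∃ g : Smooth, dzbar k g = f ∧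
    ∀ l, l ≠ Sum.inl k → l ≠ Sum.inr k → wir l f = 0 → wir l g = 0 := by
  have hA := annular_annularPart k f
  have h1 : ∀ n : ℕ, (1 : ℝ) ≤ n + 1 := fun n => by
    have : (0 : ℝ) ≤ n := Nat.cast_nonneg n
    linarith
  -- the exponent for the `n`-th annulus makes all derivatives of order at most `n` smaller than
  -- `2⁻ⁿ` on the ball of radius `n`
  have hN : ∀ n : ℕ, ∃ N : ℕ, ∀ L ∈ {L : List (Fin 5 ⊕ Fin 5) | L.length ≤ n}, ∀ z,
      ‖z‖ ≤ n → ‖(word L (damped k N (annularPart k f n))).1 z‖ ≤ (1 / 2 : ℝ) ^ n := by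
    intro n
    have h2 : ∀ L ∈ {L : List (Fin 5 ⊕ Fin 5) | L.length ≤ n}, ∀ᶠ N : ℕ in Filter.atTop, ∀ z,
        ‖z‖ ≤ n → ‖(word L (damped k N (annularPart k f n))).1 z‖ ≤ (1 / 2 : ℝ) ^ n := by
      intro L _
      filter_upwards [decays_word_damped (h1 n) (lt_add_one (n : ℝ)) n L _ (hA n) 0
        ((1 / 2 : ℝ) ^ n) (by positivity)] with N hN z hz
      have := hN z ⟨hz, (norm_le_pi_norm z k).trans hz⟩
      rwa [pow_zero, one_mul] at this
    exact ((Filter.eventually_all_finite (List.finite_length_le _ n)).2 h2).exists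
  choose N hN using hN
  obtain ⟨g, hg⟩ := exists_smooth_sum (u := fun n => damped k (N n) (annularPart k f n))
    fun L => bddSummable_of_eventually fun R => by
      refine ⟨max L.length ⌈R⌉₊, fun n hn z hz => hN n L ((le_max_left _ _).trans hn) z ?_⟩
      exact hz.trans ((Nat.le_ceil R).trans (by exact_mod_cast (le_max_right _ _).trans hn))
  have hc := suppIn_cutoff_mul k 0 f
  refine ⟨cauchy k (cutoff k 0 * f) + g, ?_, fun l hl hl' hf => ?_⟩
  · rw [map_add, dzbar_cauchy hc]
    refine smooth_ext fun z => ?_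
    rw [smooth_add_apply]
    refine hasSum_annularPart k f z _ ?_
    refine (hg (Sum.inr k) z).congr_fun fun n => ?_
    change _ = (dzbar k _).1 z
    rw [dzbar_damped (h1 n) (hA n)]
  · have h2 : wir l g = 0 := by
      refine smooth_ext fun z => (hg l z).unique ?_
      refine hasSum_zero.congr_fun fun n => ?_
      rw [wir_damped (h1 n) (hA n) hl, annularPart, map_sub, wir_cutoff_mul hl hl',
        wir_cutoff_mul hl hl', hf, mul_zero, mul_zero, sub_zero, damped_zero]
      rfl
    rw [map_add, wir_cauchy hc, wir_cutoff_mul hl hl', hf, mul_zero, cauchy_zero, h2, add_zero]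

/-! ### Complex conjugation and radial integrals -/

/-- The complex conjugate of a smooth function. -/
def conjS (f : Smooth) : Smooth :=
  ⟨fun z => starRingEnd ℂ (f.1 z), show ContDiff ℝ ∞ fun z => Complex.conjCLE (f.1 z) from
    Complex.conjCLE.contDiff.comp (smooth_contDiff f)⟩

theorem conjS_conjS (f : Smooth) : conjS (conjS f) = f :=
  smooth_ext fun z => Complex.conj_conj (f.1 z)

theorem conjS_zero : conjS 0 = 0 := smooth_ext fun _ => map_zero (starRingEnd ℂ)

theorem dirDer_conjS (v : Fin 5 → ℂ) (f : Smooth) : dirDer v (conjS f) = conjS (dirDer v f) := by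
  refine smooth_ext fun z => ?_
  change fderiv ℝ (fun z => Complex.conjCLE (f.1 z)) z v = starRingEnd ℂ (fderiv ℝ f.1 z v)
  have h := Complex.conjCLE.toContinuousLinearMap.hasFDerivAt.comp z
    (smooth_differentiable f z).hasFDerivAt
  have h2 : fderiv ℝ (fun z => Complex.conjCLE (f.1 z)) z = _ := h.fderiv
  rw [h2]
  rfl

theorem conjS_apply (f : Smooth) (z : Fin 5 → ℂ) : (conjS f).1 z = starRingEnd ℂ (f.1 z) := rfl

theorem wir_conjS (l : Fin 5 ⊕ Fin 5) (f : Smooth) :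
    wir l (conjS f) = conjS (wir l.swap f) := by
  refine smooth_ext fun z => ?_
  rcases l with i | i
  · change (dz i (conjS f)).1 z = (conjS (dzbar i f)).1 z
    rw [conjS_apply, dz_eq, dzbar_eq]
    simp only [smooth_smul_apply, smooth_sub_apply, smooth_add_apply, dirDer_conjS, conjS_apply,
      map_mul, map_add, Complex.conj_I, map_div₀, map_one, map_ofNat]
    ring
  · change (dzbar i (conjS f)).1 z = (conjS (dz i f)).1 z
    rw [conjS_apply, dz_eq, dzbar_eq]
    simp only [smooth_smul_apply, smooth_sub_apply, smooth_add_apply, dirDer_conjS, conjS_apply,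
      map_mul, map_sub, Complex.conj_I, map_div₀, map_one, map_ofNat]
    ring

theorem wir_conj_coordFn {k : Fin 5} {l : Fin 5 ⊕ Fin 5} (hl : l ≠ Sum.inr k) :
    wir l (conjS (coordFn k)) = 0 := by
  rw [wir_conjS, wir_coordFn, conjS_zero]
  rcases l with i | i
  · simp
  · intro h
    simp only [Sum.swap_inr, Sum.inl.injEq] at h
    exact hl (by rw [h])

theorem dzbar_conj_coordFn (k : Fin 5) : dzbar k (conjS (coordFn k)) = 1 := by
  have h : dzbar k (conjS (coordFn k)) = conjS (dz k (coordFn k)) := wir_conjS (Sum.inr k) _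
  rw [h, dz_coordFn, if_pos rfl]
  exact smooth_ext fun _ => map_one (starRingEnd ℂ)

/-- The indicator function of the unit interval, as a kernel. -/
noncomputable def unitKernel : ℝ → ℂ := (Set.Ioc (0 : ℝ) 1).indicator fun _ => 1

theorem locallyIntegrable_unitKernel : LocallyIntegrable unitKernel volume := by
  refine Integrable.locallyIntegrable ?_
  rw [unitKernel, integrable_indicator_iff measurableSet_Ioc]
  exact integrableOn_const (by simp)

/-- The linear map that multiplies the `k`-th coordinate by `t`. -/
noncomputable def scaleCoord (k : Fin 5) (t : ℝ) (z : Fin 5 → ℂ) : Fin 5 → ℂ :=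
  z + (t - 1 : ℝ) • (Pi.single k (z k) : Fin 5 → ℂ)

theorem contDiff_scaleCoord (k : Fin 5) :
    ContDiff ℝ ∞ fun p : ℝ × (Fin 5 → ℂ) => scaleCoord k p.1 p.2 := by
  refine contDiff_snd.add ((contDiff_fst.sub contDiff_const).smul ?_)
  exact (ContinuousLinearMap.single ℝ (fun _ : Fin 5 => ℂ) k).contDiff.comp
    ((ContinuousLinearMap.proj (R := ℝ) (φ := fun _ : Fin 5 => ℂ) k).contDiff.comp contDiff_snd)

theorem contDiff_scale (k : Fin 5) (f : Smooth) :
    ContDiff ℝ ∞ (Function.uncurry fun (t : ℝ) z => f.1 (scaleCoord k t z)) :=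
  (smooth_contDiff f).comp (contDiff_scaleCoord k)

theorem locallySupported_unitKernel (Φ : ℝ → (Fin 5 → ℂ) → ℂ) :
    LocallySupported unitKernel Φ := fun _ => ⟨1, fun t _ _ ht => Or.inl (by
  refine Set.indicator_of_notMem (fun h => ?_) _
  rw [Real.norm_of_nonneg h.1.le] at ht
  exact absurd h.2 (not_le.2 ht))⟩

/-- The integral of a function along radii in the variable `z_k`. -/
noncomputable def radial (k : Fin 5) (f : Smooth) : Smooth :=
  ⟨fun z => ∫ t, unitKernel t * f.1 (scaleCoord k t z),
    contDiff_kernel_integral locallyIntegrable_unitKernel (contDiff_scale k f)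
      (locallySupported_unitKernel _)⟩

theorem integral_unitKernel (φ : ℝ → ℂ) : ∫ t, unitKernel t * φ t = ∫ t in (0 : ℝ)..1, φ t := by
  rw [intervalIntegral.integral_of_le zero_le_one, ← integral_indicator measurableSet_Ioc]
  refine integral_congr_ae (Filter.Eventually.of_forall fun t => ?_)
  by_cases ht : t ∈ Set.Ioc (0 : ℝ) 1
  · simp [unitKernel, Set.indicator_of_mem ht]
  · simp [unitKernel, Set.indicator_of_notMem ht]

theorem continuous_scale (k : Fin 5) (f : Smooth) (z : Fin 5 → ℂ) :
    Continuous fun t => f.1 (scaleCoord k t z) :=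
  (contDiff_scale k f).continuous.comp (continuous_id.prodMk continuous_const)

theorem dirDer_radial (k : Fin 5) (f : Smooth) (v z : Fin 5 → ℂ) :
    (dirDer v (radial k f)).1 z = ∫ t in (0 : ℝ)..1, ((dirDer v f).1 (scaleCoord k t z)
      + (t - 1 : ℝ) * (dirDer (Pi.single k (v k)) f).1 (scaleCoord k t z)) := by
  have h1 : (dirDer v (radial k f)).1 z
      = ∫ t, unitKernel t * fderiv ℝ (fun z => f.1 (scaleCoord k t z)) z v :=
    fderiv_kernel_integral locallyIntegrable_unitKernel (contDiff_scale k f)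
      (locallySupported_unitKernel _) z v
  rw [h1, ← integral_unitKernel]
  refine integral_congr_ae (Filter.Eventually.of_forall fun t => ?_)
  let S : (Fin 5 → ℂ) →L[ℝ] (Fin 5 → ℂ) := ContinuousLinearMap.id ℝ _
    + (t - 1 : ℝ) • ((ContinuousLinearMap.single ℝ (fun _ : Fin 5 => ℂ) k).comp
      (ContinuousLinearMap.proj (R := ℝ) (φ := fun _ : Fin 5 => ℂ) k))
  have hS : ∀ w, S w = scaleCoord k t w := fun _ => rfl
  have h2 := (smooth_differentiable f (S z)).hasFDerivAt.comp z S.hasFDerivAt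
  have h3 : fderiv ℝ (fun z => f.1 (scaleCoord k t z)) z = (fderiv ℝ f.1 (S z)).comp S := h2.fderiv
  change unitKernel t * fderiv ℝ (fun z => f.1 (scaleCoord k t z)) z v = _
  rw [h3, ContinuousLinearMap.comp_apply, hS v, scaleCoord, map_add, map_smul, Complex.real_smul]
  rfl

theorem wir_radial_of_ne {k : Fin 5} (f : Smooth) {l : Fin 5 ⊕ Fin 5} (hl : l ≠ Sum.inl k)
    (hl' : l ≠ Sum.inr k) : wir l (radial k f) = radial k (wir l f) := by
  have hd : ∀ i, i ≠ k → ∀ c z, (dirDer (Pi.single i c) (radial k f)).1 z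
      = ∫ t in (0 : ℝ)..1, (dirDer (Pi.single i c) f).1 (scaleCoord k t z) := by
    intro i hi c z
    rw [dirDer_radial, Pi.single_eq_of_ne' hi, Pi.single_zero]
    refine intervalIntegral.integral_congr fun t _ => ?_
    have h0 : (dirDer 0 f).1 (scaleCoord k t z) = 0 := map_zero (fderiv ℝ f.1 (scaleCoord k t z))
    simp only [h0, mul_zero, add_zero]
  have hi : ∀ v z, IntervalIntegrable (fun t => (dirDer v f).1 (scaleCoord k t z)) volume 0 1 :=
    fun v z => (continuous_scale k (dirDer v f) z).intervalIntegrable _ _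
  refine smooth_ext fun z => ?_
  have hr : ∀ h : Smooth, (radial k h).1 z = ∫ t in (0 : ℝ)..1, h.1 (scaleCoord k t z) :=
    fun h => integral_unitKernel _
  rw [hr]
  rcases l with i | i
  · have hik : i ≠ k := fun h => hl (by rw [h])
    change (dz i _).1 z = ∫ t in (0 : ℝ)..1, (dz i f).1 (scaleCoord k t z)
    simp only [dz_eq, smooth_smul_apply, smooth_sub_apply]
    rw [hd i hik, hd i hik, intervalIntegral.integral_const_mul,
      intervalIntegral.integral_sub (hi _ z) ((hi _ z).const_mul _),
      intervalIntegral.integral_const_mul]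
  · have hik : i ≠ k := fun h => hl' (by rw [h])
    change (dzbar i _).1 z = ∫ t in (0 : ℝ)..1, (dzbar i f).1 (scaleCoord k t z)
    simp only [dzbar_eq, smooth_smul_apply, smooth_add_apply]
    rw [hd i hik, hd i hik, intervalIntegral.integral_const_mul,
      intervalIntegral.integral_add (hi _ z) ((hi _ z).const_mul _),
      intervalIntegral.integral_const_mul]

theorem wir_radial_self (k : Fin 5) (f : Smooth) (z : Fin 5 → ℂ) :
    (dz k (radial k f)).1 z = (∫ t in (0 : ℝ)..1, (t : ℂ) * (dz k f).1 (scaleCoord k t z)) ∧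
    (dzbar k (radial k f)).1 z = ∫ t in (0 : ℝ)..1, (t : ℂ) * (dzbar k f).1 (scaleCoord k t z) := by
  have hd : ∀ c, (dirDer (Pi.single k c) (radial k f)).1 z
      = ∫ t in (0 : ℝ)..1, (t : ℂ) * (dirDer (Pi.single k c) f).1 (scaleCoord k t z) := by
    intro c
    rw [dirDer_radial, Pi.single_eq_same]
    refine intervalIntegral.integral_congr fun t _ => ?_
    push_cast
    ring
  have hi : ∀ v, IntervalIntegrable (fun t : ℝ => (t : ℂ) * (dirDer v f).1 (scaleCoord k t z))
      volume 0 1 := fun v =>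
    (Complex.continuous_ofReal.mul (continuous_scale k (dirDer v f) z)).intervalIntegrable _ _
  constructor
  · rw [dz_eq, smooth_smul_apply, smooth_sub_apply, smooth_smul_apply, hd, hd,
      ← intervalIntegral.integral_const_mul, ← intervalIntegral.integral_sub (hi _)
        ((hi _).const_mul _), ← intervalIntegral.integral_const_mul]
    refine intervalIntegral.integral_congr fun t _ => ?_
    simp only [dz_eq, smooth_smul_apply, smooth_sub_apply]
    ring
  · rw [dzbar_eq, smooth_smul_apply, smooth_add_apply, smooth_smul_apply, hd, hd,
      ← intervalIntegral.integral_const_mul, ← intervalIntegral.integral_add (hi _)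
        ((hi _).const_mul _), ← intervalIntegral.integral_const_mul]
    refine intervalIntegral.integral_congr fun t _ => ?_
    simp only [dzbar_eq, smooth_smul_apply, smooth_add_apply]
    ring

theorem dirDer_single_eq (k : Fin 5) (c : ℂ) (f : Smooth) :
    dirDer (Pi.single k c) f = c • dz k f + starRingEnd ℂ c • dzbar k f := by
  rw [dirDer_eq_wir, Finset.sum_eq_single k]
  · rw [Pi.single_eq_same]; rfl
  · intro i _ hi
    rw [Pi.single_eq_of_ne hi, map_zero, zero_smul, zero_smul, add_zero]
  · exact fun h => absurd (Finset.mem_univ k) h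

/-- The solution of the Cauchy-Riemann equation for a function that is antiholomorphic in `z_k`. -/
theorem exists_dzbar_eq_of_antiholomorphic (k : Fin 5) (f : Smooth) (hk : dz k f = 0) :
    ∃ g : Smooth, dzbar k g = f ∧ ∀ l, l ≠ Sum.inr k → wir l f = 0 → wir l g = 0 := by
  have hdz : dz k (radial k f) = 0 := by
    refine smooth_ext fun z => ?_
    rw [(wir_radial_self k f z).1, hk]
    change (∫ t in (0 : ℝ)..1, (t : ℂ) * 0) = 0
    simp
  refine ⟨conjS (coordFn k) * radial k f, ?_, fun l hl hf => ?_⟩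
  · rw [Derivation.leibniz, dzbar_conj_coordFn]
    refine smooth_ext fun z => ?_
    rw [smul_eq_mul, smul_eq_mul, mul_one, smooth_add_apply, smooth_mul_apply,
      (wir_radial_self k f z).2]
    have h1 : (radial k f).1 z = ∫ t in (0 : ℝ)..1, f.1 (scaleCoord k t z) := integral_unitKernel _
    have hi : IntervalIntegrable (fun t : ℝ => starRingEnd ℂ ((coordFn k).1 z)
        * (t * (dzbar k f).1 (scaleCoord k t z))) volume 0 1 :=
      (continuous_const.mul (Complex.continuous_ofReal.mul
        (continuous_scale k (dzbar k f) z))).intervalIntegrable _ _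
    rw [h1, conjS_apply, ← intervalIntegral.integral_const_mul,
      ← intervalIntegral.integral_add hi ((continuous_scale k f z).intervalIntegrable _ _)]
    have h2 : ∀ t : ℝ, HasDerivAt (fun t : ℝ => (t : ℂ) * f.1 (scaleCoord k t z))
        (starRingEnd ℂ ((coordFn k).1 z) * (t * (dzbar k f).1 (scaleCoord k t z))
          + f.1 (scaleCoord k t z)) t := by
      intro t
      have h3 : HasDerivAt (fun t : ℝ => scaleCoord k t z) (Pi.single k (z k) : Fin 5 → ℂ) t := by
        have := (((hasDerivAt_id t).sub_const 1).smul_const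
          (Pi.single k (z k) : Fin 5 → ℂ)).const_add z
        rwa [one_smul] at this
      have h4 := (smooth_differentiable f _).hasFDerivAt.comp_hasDerivAt t h3
      have h5 : fderiv ℝ f.1 (scaleCoord k t z) (Pi.single k (z k))
          = starRingEnd ℂ (z k) * (dzbar k f).1 (scaleCoord k t z) := by
        change (dirDer (Pi.single k (z k)) f).1 _ = _
        rw [dirDer_single_eq, hk, smul_zero, zero_add]
        rfl
      rw [h5] at h4
      refine ((Complex.ofRealCLM.hasDerivAt (x := t)).mul h4).congr_deriv ?_
      simp only [Complex.ofRealCLM_apply, Complex.ofReal_one, Function.comp_apply, coordFn]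
      ring
    rw [intervalIntegral.integral_eq_sub_of_hasDerivAt (fun t _ => h2 t)
      (((continuous_const.mul (Complex.continuous_ofReal.mul
        (continuous_scale k (dzbar k f) z))).add (continuous_scale k f z)).intervalIntegrable _ _)]
    have h6 : scaleCoord k 1 z = z := by rw [scaleCoord, sub_self, zero_smul, add_zero]
    rw [h6]
    simp
  · rw [Derivation.leibniz, wir_conj_coordFn hl]
    by_cases h : l = Sum.inl k
    · subst h
      have h2 : wir (Sum.inl k) (radial k f) = 0 := hdz
      rw [h2]; simp
    · have h2 : radial k (0 : Smooth) = 0 := by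
        refine smooth_ext fun z => ?_
        change ∫ t, unitKernel t * 0 = 0
        simp
      rw [wir_radial_of_ne f h hl, hf, h2]; simp

/-- Each of the equations `∂g/∂z^k = f` and `∂g/∂z̄^k = f` is solvable in smooth functions. -/
theorem solvable_top : Solvable ⊤ := by
  have key : ∀ (k : Fin 5) (f : Smooth), ∃ g : Smooth, wir (Sum.inr k) g = f ∧
      ∀ l, l ≠ Sum.inr k → wir l f = 0 → wir l g = 0 := by
    intro k f
    by_cases hk : dz k f = 0
    · exact exists_dzbar_eq_of_antiholomorphic k f hk
    · obtain ⟨g, h1, h2⟩ := exists_dzbar_eq k f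
      refine ⟨g, h1, fun l hl hf => h2 l ?_ hl hf⟩
      rintro rfl
      exact hk hf
  refine ⟨fun _ _ _ => Submodule.mem_top, fun k f _ => ?_⟩
  rcases k with k | k
  · obtain ⟨g, h1, h2⟩ := key k (conjS f)
    refine ⟨conjS g, Submodule.mem_top, ?_, fun l hl hf => ?_⟩
    · rw [wir_conjS, Sum.swap_inl, h1, conjS_conjS]
    · rw [wir_conjS, h2, conjS_zero]
      · intro h
        refine hl ?_
        rw [← Sum.swap_swap l, h, Sum.swap_inr]
      · rw [wir_conjS, Sum.swap_swap, hf, conjS_zero]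
  · obtain ⟨g, h1, h2⟩ := key k f
    exact ⟨g, Submodule.mem_top, h1, h2⟩

/-! ### Polynomials in `z` and `z̄` -/

/-- The functions `z_k` and `z̄_k`. -/
noncomputable def coordVar : Fin 5 ⊕ Fin 5 → Smooth := Sum.elim coordFn fun k => conjS (coordFn k)

theorem wir_coordVar (l j : Fin 5 ⊕ Fin 5) :
    wir l (coordVar j) = if l = j then 1 else 0 := by
  rcases j with j | j
  · by_cases h : l = Sum.inl j
    · subst h
      rw [if_pos rfl]
      exact (dz_coordFn j j).trans (if_pos rfl)
    · rw [if_neg h]; exact wir_coordFn h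
  · by_cases h : l = Sum.inr j
    · subst h
      rw [if_pos rfl]
      exact dzbar_conj_coordFn j
    · rw [if_neg h]; exact wir_conj_coordFn h

/-- The function of `z` and `z̄` defined by a polynomial in ten variables. -/
noncomputable def polyFn : MvPolynomial (Fin 5 ⊕ Fin 5) ℂ →ₐ[ℂ] Smooth :=
  MvPolynomial.aeval coordVar

theorem wir_polyFn (l : Fin 5 ⊕ Fin 5) (p : MvPolynomial (Fin 5 ⊕ Fin 5) ℂ) :
    wir l (polyFn p) = polyFn (MvPolynomial.pderiv l p) := by
  induction p using MvPolynomial.induction_on with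
  | C a =>
    rw [MvPolynomial.pderiv_C, map_zero, polyFn, MvPolynomial.aeval_C, Derivation.map_algebraMap]
  | add p q hp hq => simp only [map_add, hp, hq]
  | mul_X p j hp =>
    have hX : polyFn (MvPolynomial.X j) = coordVar j := MvPolynomial.aeval_X _ _
    rw [map_mul, Derivation.leibniz, hp, Derivation.leibniz, map_add, hX, wir_coordVar,
      MvPolynomial.pderiv_X, Pi.single_apply]
    simp only [smul_eq_mul, map_mul, hX]
    by_cases h : l = j
    · rw [if_pos h, if_pos h.symm, map_one]
    · rw [if_neg h, if_neg (Ne.symm h), map_zero]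

theorem polyFn_at_zero (p : MvPolynomial (Fin 5 ⊕ Fin 5) ℂ) :
    (polyFn p).1 0 = MvPolynomial.coeff 0 p := by
  induction p using MvPolynomial.induction_on with
  | C a =>
    rw [polyFn, MvPolynomial.aeval_C, MvPolynomial.coeff_C, if_pos rfl]; rfl
  | add p q hp hq => rw [map_add, smooth_add_apply, hp, hq, MvPolynomial.coeff_add]
  | mul_X p j hp =>
    have hX : polyFn (MvPolynomial.X j) = coordVar j := MvPolynomial.aeval_X _ _
    have h0 : (coordVar j).1 0 = 0 := by
      rcases j with j | j
      · rfl
      · exact map_zero (starRingEnd ℂ)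
    rw [map_mul, hX, smooth_mul_apply, h0, mul_zero, MvPolynomial.coeff_mul_X', if_neg (by simp)]

theorem polyFn_injective : Function.Injective polyFn := by
  have key : ∀ n : ℕ, ∀ m : Fin 5 ⊕ Fin 5 →₀ ℕ, m.degree = n →
      ∀ p, polyFn p = 0 → MvPolynomial.coeff m p = 0 := by
    intro n
    induction n with
    | zero =>
      intro m hm p hp
      rw [Finsupp.degree_eq_zero_iff] at hm
      rw [hm, ← polyFn_at_zero, hp]
      rfl
    | succ n ih =>
      intro m hm p hp
      obtain ⟨l, hl⟩ : ∃ l, m l ≠ 0 := by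
        by_contra h
        push Not at h
        have : m = 0 := Finsupp.ext h
        rw [this, map_zero] at hm
        omega
      have hle : Finsupp.single l 1 ≤ m :=
        Finsupp.single_le_iff.2 (Nat.one_le_iff_ne_zero.2 hl)
      have hm' : m - Finsupp.single l 1 + Finsupp.single l 1 = m := tsub_add_cancel_of_le hle
      have h1 := ih (m - Finsupp.single l 1) (by
        have h2 := congrArg Finsupp.degree hm'
        rw [map_add, Finsupp.degree_single] at h2
        omega) (MvPolynomial.pderiv l p) (by rw [← wir_polyFn, hp, map_zero])
      rw [MvPolynomial.coeff_pderiv, hm'] at h1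
      refine (mul_eq_zero.1 h1).resolve_right ?_
      exact Nat.cast_add_one_ne_zero _
  rw [injective_iff_map_eq_zero]
  intro p hp
  ext m
  rw [key _ m rfl p hp, MvPolynomial.coeff_zero]

theorem range_polyFn : polyFn.range = PolySmooth := by
  rw [polyFn, ← Algebra.adjoin_range_eq_range_aeval, PolySmooth]
  congr 1
  ext f
  constructor
  · rintro ⟨j | j, rfl⟩
    · exact ⟨j, Or.inl rfl⟩
    · exact ⟨j, Or.inr rfl⟩
  · rintro ⟨i, h | h⟩
    · exact ⟨Sum.inl i, Subtype.ext h.symm⟩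
    · exact ⟨Sum.inr i, Subtype.ext h.symm⟩

/-- The antiderivative of a polynomial with respect to one variable, without constant term. -/
noncomputable def antideriv (k : Fin 5 ⊕ Fin 5) :
    MvPolynomial (Fin 5 ⊕ Fin 5) ℂ →ₗ[ℂ] MvPolynomial (Fin 5 ⊕ Fin 5) ℂ :=
  (MvPolynomial.basisMonomials (Fin 5 ⊕ Fin 5) ℂ).constr ℂ fun m =>
    MvPolynomial.monomial (m + Finsupp.single k 1) ((m k + 1 : ℂ)⁻¹)

theorem antideriv_monomial (k : Fin 5 ⊕ Fin 5) (m : Fin 5 ⊕ Fin 5 →₀ ℕ) :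
    antideriv k (MvPolynomial.monomial m 1)
      = MvPolynomial.monomial (m + Finsupp.single k 1) ((m k + 1 : ℂ)⁻¹) := by
  have := (MvPolynomial.basisMonomials (Fin 5 ⊕ Fin 5) ℂ).constr_basis ℂ (fun m =>
    MvPolynomial.monomial (m + Finsupp.single k 1) ((m k + 1 : ℂ)⁻¹)) m
  rwa [MvPolynomial.coe_basisMonomials] at this

theorem pderiv_antideriv (k : Fin 5 ⊕ Fin 5) (p : MvPolynomial (Fin 5 ⊕ Fin 5) ℂ) :
    MvPolynomial.pderiv k (antideriv k p) = p := by
  have h : (MvPolynomial.pderiv k).toLinearMap ∘ₗ antideriv k = LinearMap.id := by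
    refine (MvPolynomial.basisMonomials (Fin 5 ⊕ Fin 5) ℂ).ext fun m => ?_
    rw [MvPolynomial.coe_basisMonomials]
    change MvPolynomial.pderiv k (antideriv k (MvPolynomial.monomial m 1)) = _
    rw [antideriv_monomial, MvPolynomial.pderiv_monomial, add_tsub_cancel_right]
    have h2 : (m k + 1 : ℂ) ≠ 0 := Nat.cast_add_one_ne_zero _
    have h3 : (m k + 1 : ℂ)⁻¹ * (((m + Finsupp.single k 1 : Fin 5 ⊕ Fin 5 →₀ ℕ) k : ℕ) : ℂ) = 1 := by
      rw [Finsupp.add_apply, Finsupp.single_eq_same]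
      push_cast
      exact inv_mul_cancel₀ h2
    rw [h3]
    rfl
  exact congrArg (fun T => T p) h

theorem pderiv_antideriv_of_ne {k l : Fin 5 ⊕ Fin 5} (hl : l ≠ k)
    (p : MvPolynomial (Fin 5 ⊕ Fin 5) ℂ) :
    MvPolynomial.pderiv l (antideriv k p) = antideriv k (MvPolynomial.pderiv l p) := by
  have h : (MvPolynomial.pderiv l).toLinearMap ∘ₗ antideriv k
      = antideriv k ∘ₗ (MvPolynomial.pderiv l).toLinearMap := by
    refine (MvPolynomial.basisMonomials (Fin 5 ⊕ Fin 5) ℂ).ext fun m => ?_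
    rw [MvPolynomial.coe_basisMonomials]
    change MvPolynomial.pderiv l (antideriv k (MvPolynomial.monomial m 1))
      = antideriv k (MvPolynomial.pderiv l (MvPolynomial.monomial m 1))
    have hs : ∀ (s : Fin 5 ⊕ Fin 5 →₀ ℕ) (a : ℂ), MvPolynomial.monomial s a
        = a • MvPolynomial.monomial s 1 := fun s a => by
      rw [MvPolynomial.smul_monomial, smul_eq_mul, mul_one]
    rw [antideriv_monomial, MvPolynomial.pderiv_monomial, MvPolynomial.pderiv_monomial,
      hs _ (1 * _), map_smul, antideriv_monomial, MvPolynomial.smul_monomial, Finsupp.add_apply,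
      Finsupp.single_eq_of_ne hl, add_zero, one_mul, smul_eq_mul, Finsupp.tsub_apply,
      Finsupp.single_eq_of_ne hl.symm, tsub_zero, mul_comm]
    by_cases hm : m l = 0
    · simp [hm]
    · congr 2
      ext j
      simp only [Finsupp.add_apply, Finsupp.tsub_apply, Finsupp.single_apply]
      by_cases h1 : l = j
      · subst h1
        rw [if_pos rfl, if_neg (Ne.symm hl)]
        omega
      · rw [if_neg h1]; omega
  exact congrArg (fun T => T p) h

theorem solvable_polySmooth : Solvable (Subalgebra.toSubmodule PolySmooth) := by
  constructor
  · intro k f hf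
    rw [Subalgebra.mem_toSubmodule, ← range_polyFn] at hf ⊢
    obtain ⟨p, rfl⟩ := hf
    exact ⟨_, (wir_polyFn k p).symm⟩
  · intro k f hf
    rw [Subalgebra.mem_toSubmodule, ← range_polyFn] at hf
    obtain ⟨p, rfl⟩ := hf
    refine ⟨polyFn (antideriv k p), ?_, ?_, fun l hl h => ?_⟩
    · rw [Subalgebra.mem_toSubmodule, ← range_polyFn]
      exact ⟨_, rfl⟩
    · rw [wir_polyFn, pderiv_antideriv]; rfl
    · have h1 : polyFn (MvPolynomial.pderiv l p) = 0 := by rw [← wir_polyFn]; exact h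
      rw [wir_polyFn, pderiv_antideriv_of_ne hl, (map_eq_zero_iff _ polyFn_injective).1 h1,
        map_zero, map_zero]

/-- The holomorphic function on `ℂ⁵` defined by a polynomial. -/
noncomputable def holPoly : MvPolynomial (Fin 5) ℂ →ₐ[ℂ] Smooth :=
  polyFn.comp (MvPolynomial.rename Sum.inl)

theorem holPoly_injective : Function.Injective holPoly :=
  polyFn_injective.comp (MvPolynomial.rename_injective _ Sum.inl_injective)

theorem dz_holPoly (i : Fin 5) (p : MvPolynomial (Fin 5) ℂ) :
    dz i (holPoly p) = holPoly (MvPolynomial.pderiv i p) := by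
  have h := wir_polyFn (Sum.inl i) (MvPolynomial.rename Sum.inl p)
  rw [MvPolynomial.pderiv_rename Sum.inl_injective] at h
  exact h

theorem mem_range_holPoly (f : Smooth) :
    (∃ p, holPoly p = f) ↔ f ∈ PolySmooth ∧ ∀ k, dzbar k f = 0 := by
  constructor
  · rintro ⟨p, rfl⟩
    refine ⟨by rw [← range_polyFn]; exact ⟨_, rfl⟩, fun k => ?_⟩
    have h := wir_polyFn (Sum.inr k) (MvPolynomial.rename Sum.inl p)
    rw [MvPolynomial.pderiv_eq_zero_of_notMem_vars, map_zero] at h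
    · exact h
    · intro hv
      obtain ⟨j, -, hj⟩ := MvPolynomial.mem_vars_rename _ _ hv
      exact absurd hj (by simp)
  · rintro ⟨hf, hk⟩
    rw [← range_polyFn] at hf
    obtain ⟨p, rfl⟩ := hf
    have hp : ∀ k, MvPolynomial.pderiv (Sum.inr k) p = 0 := fun k => by
      refine (map_eq_zero_iff _ polyFn_injective).1 ?_
      rw [← wir_polyFn]; exact hk k
    obtain ⟨q, hq⟩ := MvPolynomial.exists_rename_eq_of_vars_subset_range p
      (Sum.inl : Fin 5 → Fin 5 ⊕ Fin 5) Sum.inl_injective (by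
        intro l hl
        rcases l with j | j
        · exact ⟨j, rfl⟩
        · exfalso
          obtain ⟨d, hd, hj⟩ := (MvPolynomial.mem_vars_iff_mem_support _).1 hl
          rw [Finsupp.mem_support_iff] at hj
          have hle : Finsupp.single (Sum.inr j : Fin 5 ⊕ Fin 5) 1 ≤ d :=
            Finsupp.single_le_iff.2 (Nat.one_le_iff_ne_zero.2 hj)
          have h1 := congrArg (MvPolynomial.coeff (d - Finsupp.single (Sum.inr j) 1)) (hp j)
          rw [MvPolynomial.coeff_pderiv, tsub_add_cancel_of_le hle, MvPolynomial.coeff_zero] at h1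
          rcases mul_eq_zero.1 h1 with h | h
          · exact (MvPolynomial.mem_support_iff.1 hd) h
          · exact absurd h (Nat.cast_add_one_ne_zero _))
    exact ⟨q, congrArg polyFn hq⟩

/-! ### The first variation of the cubic Lagrangian -/

theorem sum_rotate {ι κ l Q : Type} [Fintype ι] [Fintype κ] [Fintype l] [AddCommMonoid Q]
    (f : ι → κ → l → Q) : ∑ i, ∑ j, ∑ k, f i j k = ∑ j, ∑ k, ∑ i, f i j k := by
  rw [Finset.sum_comm]
  exact Finset.sum_congr rfl fun j _ => Finset.sum_comm

section Variation

variable {R Q : Type} [Ring R] [Algebra ℂ R] [AddCommGroup Q] [Module ℂ Q]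
  {δ : Fin 5 → R →ₗ[ℂ] R} {C : Submodule ℂ R} {I : R →ₗ[ℂ] Q}

theorem sum_matrix_cubic (a A B : Matrix (Fin 32) (Fin 32) R) (hA : ∀ i j, A i j = -A j i)
    (hB : ∀ i j, B i j = -B j i) :
    ∑ i, ∑ j, ∑ k, (a i j * A j k * B k i - a i j * A k i * B j k - a j k * A i j * B k i
        + a j k * A k i * B i j + a k i * A i j * B j k - a k i * A j k * B i j)
      = (3 : ℂ) • ∑ i, ∑ j, a i j * ∑ k, (A j k * B k i - A i k * B k j) := by
  have h1 : ∑ i, ∑ j, ∑ k, a j k * A k i * B i j = ∑ i, ∑ j, ∑ k, a i j * A j k * B k i :=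
    sum_rotate _
  have h2 : ∑ i, ∑ j, ∑ k, a k i * A i j * B j k = ∑ i, ∑ j, ∑ k, a i j * A j k * B k i :=
    (sum_rotate _).symm
  have h3 : ∑ i, ∑ j, ∑ k, a j k * A i j * B k i = ∑ i, ∑ j, ∑ k, a i j * A k i * B j k :=
    sum_rotate _
  have h4 : ∑ i, ∑ j, ∑ k, a k i * A j k * B i j = ∑ i, ∑ j, ∑ k, a i j * A k i * B j k :=
    (sum_rotate _).symm
  have h5 : ∑ i, ∑ j, ∑ k, a i j * A k i * B j k = ∑ i, ∑ j, ∑ k, a i j * A i k * B k j :=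
    Finset.sum_congr rfl fun i _ => Finset.sum_congr rfl fun j _ => Finset.sum_congr rfl
      fun k _ => by rw [hA k i, hB j k]; simp
  simp only [Finset.mul_sum, mul_sub, ← mul_assoc, Finset.sum_add_distrib, Finset.sum_sub_distrib]
  rw [h1, h2, h3, h4, h5]
  module

/-- The rule of integration by parts for the functional `I`, for elements of `C` ("compact
support") in the first factor. -/
structure ByParts (δ : Fin 5 → R →ₗ[ℂ] R) (C : Submodule ℂ R) (I : R →ₗ[ℂ] Q) : Prop where
  comm : ∀ i j x, δ i (δ j x) = δ j (δ i x)
  leibniz : ∀ i x y, δ i (x * y) = δ i x * y + x * δ i y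
  stable : ∀ i, ∀ x ∈ C, δ i x ∈ C
  parts : ∀ i, ∀ c ∈ C, ∀ y, I (δ i c * y) = -I (c * δ i y)

namespace ByParts

variable (h : ByParts δ C I) {p q : Fin 5 → R} (hp : ∑ i, δ i (p i) = 0) (hq : ∑ i, δ i (q i) = 0)
include h

theorem parts_mul (i : Fin 5) {c : R} (hc : c ∈ C) (y z : R) :
    I (δ i c * y * z) = -I (c * δ i y * z) - I (c * y * δ i z) := by
  rw [mul_assoc, h.parts i c hc, h.leibniz, mul_add, map_add, ← mul_assoc, ← mul_assoc]
  abel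

theorem sum_div (hp : ∑ i, δ i (p i) = 0) (j k : Fin 5) : ∑ i, δ i (δ k (δ j (p i))) = 0 := by
  have h1 : ∀ i, δ i (δ k (δ j (p i))) = δ k (δ j (δ i (p i))) := fun i => by
    rw [h.comm i k, h.comm i j]
  simp only [h1, ← map_sum, hp, map_zero]

theorem parts_left {u : Fin 5 → R} (hu : ∑ i, δ i (u i) = 0) {c : R} (hc : c ∈ C) (z : R) :
    ∑ i, I (δ i c * u i * z) = -∑ i, I (c * u i * δ i z) := by
  have h1 : ∑ i, I (c * δ i (u i) * z) = 0 := by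
    rw [← map_sum, ← Finset.sum_mul, ← Finset.mul_sum, hu, mul_zero, zero_mul, map_zero]
  simp only [h.parts_mul _ hc, Finset.sum_sub_distrib, Finset.sum_neg_distrib]
  rw [h1, neg_zero, zero_sub]

theorem parts_right {u : Fin 5 → R} (hu : ∑ i, δ i (u i) = 0) {c : R} (hc : c ∈ C) (y : R) :
    ∑ i, I (δ i c * y * u i) = -∑ i, I (c * δ i y * u i) := by
  have h1 : ∑ i, I (c * y * δ i (u i)) = 0 := by
    rw [← map_sum, ← Finset.mul_sum, hu, mul_zero, map_zero]
  simp only [h.parts_mul _ hc, Finset.sum_sub_distrib, Finset.sum_neg_distrib]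
  rw [h1, sub_zero]

include hp hq

theorem variation_gauge (a A B : Matrix (Fin 32) (Fin 32) R) (m : Fin 5 → R)
    (ha : ∀ i j, a i j ∈ C) :
    I (∑ i, ∑ j, ∑ k, (m i * A j k * δ i (B k j) - m i * δ i (A k j) * B j k
        - a j k * p i * δ i (B k j) + a j k * δ i (A k j) * q i
        + δ i (a k j) * p i * B j k - δ i (a k j) * A j k * q i))
      = I (∑ i, m i * ∑ j, ∑ k, (A j k * δ i (B k j) - δ i (A k j) * B j k))
        + (2 : ℂ) • I (∑ j, ∑ k, a j k * ∑ i, (δ i (A k j) * q i - p i * δ i (B k j))) := by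
  have h1 : ∑ i, ∑ j, ∑ k, I (δ i (a k j) * p i * B j k)
      = -∑ j, ∑ k, ∑ i, I (a j k * p i * δ i (B k j)) := by
    rw [sum_rotate, Finset.sum_comm]
    simp only [h.parts_left hp (ha _ _), Finset.sum_neg_distrib]
  have h2 : ∑ i, ∑ j, ∑ k, I (δ i (a k j) * A j k * q i)
      = -∑ j, ∑ k, ∑ i, I (a j k * δ i (A k j) * q i) := by
    rw [sum_rotate, Finset.sum_comm]
    simp only [h.parts_right hq (ha _ _), Finset.sum_neg_distrib]
  have h3 : ∑ i, ∑ j, ∑ k, I (a j k * p i * δ i (B k j))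
      = ∑ j, ∑ k, ∑ i, I (a j k * p i * δ i (B k j)) := sum_rotate _
  have h4 : ∑ i, ∑ j, ∑ k, I (a j k * δ i (A k j) * q i)
      = ∑ j, ∑ k, ∑ i, I (a j k * δ i (A k j) * q i) := sum_rotate _
  simp only [map_sum, map_add, map_sub, Finset.mul_sum, mul_sub, ← mul_assoc,
    Finset.sum_add_distrib, Finset.sum_sub_distrib]
  rw [h1, h2, h3, h4]
  module

theorem variation_contraction (w w' : Fin 5 → Fin 5 → R) (hw : ∀ i j, w i j = -w j i)
    (hw' : ∀ i j, w' i j = -w' j i) (m g : Fin 5 → R) (hg : ∀ i, g i ∈ C) :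
    I (∑ i, ∑ j, ((δ i (g j) - δ j (g i)) * p i * q j - (δ i (g j) - δ j (g i)) * p j * q i
        - m i * w i j * q j + m i * p j * w' i j + m j * w i j * q i - m j * p i * w' i j))
      = (2 : ℂ) • I (∑ i, m i * ∑ k, (p k * w' i k - w i k * q k))
        + (2 : ℂ) • I (∑ j, g j * -∑ i, (p i * δ i (q j) - δ i (p j) * q i)) := by
  have h1 : ∑ i, ∑ j, I (δ i (g j) * p i * q j) = -∑ j, ∑ i, I (g j * p i * δ i (q j)) := by
    rw [Finset.sum_comm]
    simp only [h.parts_left hp (hg _), Finset.sum_neg_distrib]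
  have h2 : ∑ i, ∑ j, I (δ i (g j) * p j * q i) = -∑ j, ∑ i, I (g j * δ i (p j) * q i) := by
    rw [Finset.sum_comm]
    simp only [h.parts_right hq (hg _), Finset.sum_neg_distrib]
  have h3 : ∑ i, ∑ j, I (δ j (g i) * p i * q j) = -∑ j, ∑ i, I (g j * δ i (p j) * q i) := by
    rw [← h2, Finset.sum_comm]
  have h4 : ∑ i, ∑ j, I (δ j (g i) * p j * q i) = -∑ j, ∑ i, I (g j * p i * δ i (q j)) := by
    rw [← h1, Finset.sum_comm]
  have h5 : ∑ i, ∑ j, I (m j * w i j * q i) = -∑ i, ∑ j, I (m i * w i j * q j) := by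
    rw [Finset.sum_comm]
    simp only [← Finset.sum_neg_distrib]
    refine Finset.sum_congr rfl fun i _ => Finset.sum_congr rfl fun j _ => ?_
    rw [hw j i, mul_neg, neg_mul, map_neg]
  have h6 : ∑ i, ∑ j, I (m j * p i * w' i j) = -∑ i, ∑ j, I (m i * p j * w' i j) := by
    rw [Finset.sum_comm]
    simp only [← Finset.sum_neg_distrib]
    refine Finset.sum_congr rfl fun i _ => Finset.sum_congr rfl fun j _ => ?_
    rw [hw' j i, mul_neg, map_neg]
  simp only [map_sum, map_add, map_sub, map_neg, Finset.mul_sum, mul_sub, sub_mul, mul_neg,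
    ← mul_assoc, Finset.sum_add_distrib, Finset.sum_sub_distrib, Finset.sum_neg_distrib]
  rw [h1, h2, h3, h4, h5, h6]
  module

/-- Each of the three factors of the cubic term in `μ` contributes the same amount. -/
theorem variation_anomaly (m : Fin 5 → R) (hm : ∀ i, m i ∈ C) :
    I (∑ i, ∑ j, ∑ k, (m k * δ i (p j) * δ k (δ j (q i)) - m k * δ k (δ j (p i)) * δ i (q j)
        - δ i (m j) * p k * δ k (δ j (q i)) + δ i (m j) * δ k (δ j (p i)) * q k
        + δ k (δ j (m i)) * p k * δ i (q j) - δ k (δ j (m i)) * δ i (p j) * q k))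
      = (3 : ℂ) • I (∑ i, m i * ∑ j, ∑ l, (δ l (p j) * δ i (δ j (q l))
          - δ i (δ j (p l)) * δ l (q j))) := by
  let X : Fin 5 → Fin 5 → Fin 5 → Q := fun i j l => I (m i * δ l (p j) * δ i (δ j (q l)))
  let Y : Fin 5 → Fin 5 → Fin 5 → Q := fun i j l => I (m i * δ i (δ j (p l)) * δ l (q j))
  have h1 : ∑ i, ∑ j, ∑ k, I (m k * δ i (p j) * δ k (δ j (q i))) = ∑ i, ∑ j, ∑ l, X i j l := by
    rw [← sum_rotate]
    exact Finset.sum_congr rfl fun i _ => Finset.sum_comm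
  have h2 : ∑ i, ∑ j, ∑ k, I (m k * δ k (δ j (p i)) * δ i (q j)) = ∑ i, ∑ j, ∑ l, Y i j l := by
    rw [← sum_rotate]
    exact Finset.sum_congr rfl fun i _ => Finset.sum_comm
  -- one integration by parts moves the derivative off `m`; where it falls on the field with the
  -- same index, the divergence constraint makes the term vanish
  have h3 : ∑ i, ∑ j, ∑ k, I (δ i (m j) * p k * δ k (δ j (q i))) = -∑ i, ∑ j, ∑ l, X i j l := by
    rw [sum_rotate]
    simp only [← Finset.sum_neg_distrib]
    refine Finset.sum_congr rfl fun j _ => Finset.sum_congr rfl fun k _ => ?_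
    have h0 : ∑ i, I (m j * p k * δ i (δ k (δ j (q i)))) = 0 := by
      rw [← map_sum, ← Finset.mul_sum, h.sum_div hq, mul_zero, map_zero]
    simp only [h.parts_mul _ (hm j), Finset.sum_sub_distrib]
    rw [h0, sub_zero]
    exact Finset.sum_congr rfl fun i _ => by rw [h.comm k j]
  have h4 : ∑ i, ∑ j, ∑ k, I (δ i (m j) * δ k (δ j (p i)) * q k) = -∑ i, ∑ j, ∑ l, Y i j l := by
    rw [sum_rotate]
    simp only [← Finset.sum_neg_distrib]
    refine Finset.sum_congr rfl fun j _ => Finset.sum_congr rfl fun k _ => ?_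
    have h0 : ∑ i, I (m j * δ i (δ k (δ j (p i))) * q k) = 0 := by
      rw [← map_sum, ← Finset.sum_mul, ← Finset.mul_sum, h.sum_div hp, mul_zero, zero_mul, map_zero]
    simp only [h.parts_mul _ (hm j), Finset.sum_sub_distrib, Finset.sum_neg_distrib]
    rw [h0, neg_zero, zero_sub]
    exact congrArg Neg.neg (Finset.sum_congr rfl fun i _ => by rw [h.comm k j])
  -- two integrations by parts, each with the divergence constraint of the field that carries the
  -- index of the derivative
  have h5 : ∑ i, ∑ j, ∑ k, I (δ k (δ j (m i)) * p k * δ i (q j)) = ∑ i, ∑ j, ∑ l, X i j l := by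
    refine Finset.sum_congr rfl fun i _ => ?_
    have h0 : ∀ k, ∑ j, I (m i * p k * δ j (δ k (δ i (q j)))) = 0 := fun k => by
      rw [← map_sum, ← Finset.mul_sum, h.sum_div hq, mul_zero, map_zero]
    simp only [h.parts_left hp (h.stable _ _ (hm i)), Finset.sum_neg_distrib]
    rw [Finset.sum_comm, ← Finset.sum_neg_distrib]
    refine Finset.sum_congr rfl fun k _ => ?_
    simp only [h.parts_mul _ (hm i), Finset.sum_sub_distrib, Finset.sum_neg_distrib]
    rw [h0, sub_zero, neg_neg]
    exact Finset.sum_congr rfl fun j _ => by rw [h.comm k i]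
  have h6 : ∑ i, ∑ j, ∑ k, I (δ k (δ j (m i)) * δ i (p j) * q k) = ∑ i, ∑ j, ∑ l, Y i j l := by
    refine Finset.sum_congr rfl fun i _ => ?_
    have h0 : ∀ k, ∑ j, I (m i * δ j (δ k (δ i (p j))) * q k) = 0 := fun k => by
      rw [← map_sum, ← Finset.sum_mul, ← Finset.mul_sum, h.sum_div hp, mul_zero, zero_mul, map_zero]
    simp only [h.parts_right hq (h.stable _ _ (hm i)), Finset.sum_neg_distrib]
    rw [Finset.sum_comm, ← Finset.sum_neg_distrib]
    refine Finset.sum_congr rfl fun k _ => ?_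
    simp only [h.parts_mul _ (hm i), Finset.sum_sub_distrib, Finset.sum_neg_distrib]
    rw [h0, neg_zero, zero_sub, neg_neg]
    exact Finset.sum_congr rfl fun j _ => by rw [h.comm k i]
  simp only [map_sum, map_add, map_sub, Finset.mul_sum, mul_sub, ← mul_assoc,
    Finset.sum_add_distrib, Finset.sum_sub_distrib]
  rw [h1, h2, h3, h4, h5, h6]
  module

omit hp hq in
/-- The pairing with a divergence is the pairing of the potential with an exterior derivative. -/
theorem pairing_curl (b : Fin 5 → Fin 5 → R) (hb : ∀ i j, b i j ∈ C)
    (hskew : ∀ i j, b i j = -b j i) (t : Fin 5 → R) :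
    I (∑ i, (∑ j, δ j (b i j)) * t i)
      = I ((1 / 2 : ℂ) • ∑ i, ∑ j, b i j * (δ i (t j) - δ j (t i))) := by
  have h1 : ∑ i, ∑ j, I (b i j * δ i (t j)) = -∑ i, ∑ j, I (b i j * δ j (t i)) := by
    rw [Finset.sum_comm]
    simp only [← Finset.sum_neg_distrib]
    refine Finset.sum_congr rfl fun i _ => Finset.sum_congr rfl fun j _ => ?_
    rw [hskew j i, neg_mul, map_neg]
  simp only [Finset.sum_mul, map_sum, map_smul, mul_sub, map_sub, Finset.sum_sub_distrib,
    h.parts _ _ (hb _ _), Finset.sum_neg_distrib]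
  rw [h1]
  module

end ByParts

end Variation

/-! ### Integration of compactly supported forms -/

/-- Smooth functions with compact support. -/
def CompactSmooth : Submodule ℂ Smooth where
  carrier := {f | HasCompactSupport f.1}
  add_mem' hf hg := HasCompactSupport.add hf hg
  zero_mem' := HasCompactSupport.zero
  smul_mem' c f hf := HasCompactSupport.smul_left (f := fun _ => c) (show HasCompactSupport f.1 from hf)

theorem dirDer_mem_compactSmooth (v : Fin 5 → ℂ) {f : Smooth} (hf : f ∈ CompactSmooth) :
    dirDer v f ∈ CompactSmooth :=
  HasCompactSupport.fderiv_apply (𝕜 := ℝ) (show HasCompactSupport f.1 from hf) v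

theorem dz_mem_compactSmooth (i : Fin 5) {f : Smooth} (hf : f ∈ CompactSmooth) :
    dz i f ∈ CompactSmooth := by
  rw [dz_eq]
  exact Submodule.smul_mem _ _ (Submodule.sub_mem _ (dirDer_mem_compactSmooth _ hf)
    (Submodule.smul_mem _ _ (dirDer_mem_compactSmooth _ hf)))

theorem integrable_of_mem {f : Smooth} (hf : f ∈ CompactSmooth) : Integrable f.1 :=
  (smooth_contDiff f).continuous.integrable_of_hasCompactSupport hf

theorem integral_dirDer (v : Fin 5 → ℂ) {f : Smooth} (hf : f ∈ CompactSmooth) :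
    ∫ z, (dirDer v f).1 z = 0 := by
  have h := integral_mul_fderiv_eq_neg_fderiv_mul_of_integrable (μ := volume)
    (f := fun _ : Fin 5 → ℂ => (1 : ℂ)) (g := f.1) (v := v) (by simp)
    (by simp only [one_mul]; exact integrable_of_mem (dirDer_mem_compactSmooth v hf))
    (by simpa using integrable_of_mem hf) (fun _ _ => differentiableAt_const _)
    (fun x _ => smooth_differentiable f x)
  have h2 : ∫ z, fderiv ℝ f.1 z v = 0 := by simpa using h
  exact h2

theorem integral_dz (i : Fin 5) {f : Smooth} (hf : f ∈ CompactSmooth) :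
    ∫ z, (dz i f).1 z = 0 := by
  have h1 := integrable_of_mem (dirDer_mem_compactSmooth (Pi.single i 1) hf)
  have h2 := integrable_of_mem (dirDer_mem_compactSmooth (Pi.single i Complex.I) hf)
  rw [dz_eq]
  simp only [smooth_smul_apply, smooth_sub_apply]
  rw [integral_const_mul, integral_sub h1 (h2.const_mul _), integral_const_mul,
    integral_dirDer _ hf, integral_dirDer _ hf]
  simp

/-- The coefficient of `dz̄¹ ⋯ dz̄⁵` of a form. -/
noncomputable def topFun : Dol →ₗ[ℂ] Smooth :=
  (TensorProduct.rid ℂ Smooth).toLinearMap ∘ₗ LinearMap.lTensor Smooth topCoeff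

theorem topFun_tmul (f : Smooth) (w : AntiHol) : topFun (f ⊗ₜ[ℂ] w) = topCoeff w • f := rfl

theorem integral_eq (x : Dol) : integral x = ∫ z, (topFun x).1 z := rfl

theorem topFun_D (i : Fin 5) (x : Dol) : topFun (D i x) = dz i (topFun x) := by
  induction x using TensorProduct.induction_on with
  | zero => simp only [map_zero]
  | add x y hx hy => simp only [map_add, hx, hy]
  | tmul f w =>
    rw [topFun_tmul, Derivation.map_smul]
    rfl

theorem topFun_apply (x : Dol) (z : Fin 5 → ℂ) : (topFun x).1 z = topCoeff (ev z x) := by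
  induction x using TensorProduct.induction_on with
  | zero => simp only [map_zero]; rfl
  | add x y hx hy => rw [map_add, map_add, map_add, ← hx, ← hy]; rfl
  | tmul f w => rw [topFun_tmul, ev_tmul, map_smul, smul_eq_mul, mul_comm]; rfl

theorem topFun_mem {x : Dol} (hx : x ∈ DolCompact) : topFun x ∈ CompactSmooth :=
  coefIn_le (S := CompactSmooth.comap topFun) (fun _ hf _ => CompactSmooth.smul_mem _ hf) hx

theorem mul_mem_coefIn_of_ideal {M : Type} [AddCommGroup M] [Module ℂ M] {V : Submodule ℂ Smooth}
    (hV : ∀ f ∈ V, ∀ g, f * g ∈ V) {x : SForm M} (hx : x ∈ coefIn V) (y : SForm M) :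
    x * y ∈ coefIn V := by
  refine coefIn_le (S := (coefIn V).comap (LinearMap.mulRight ℂ y)) (fun f hf w => ?_) hx
  refine coefIn_le (V := ⊤) (S := (coefIn V).comap (LinearMap.mulLeft ℂ (f ⊗ₜ[ℂ] w)))
    (fun g _ u => ?_) (mem_coefIn_top y)
  change (f ⊗ₜ[ℂ] w) * (g ⊗ₜ[ℂ] u) ∈ coefIn (M := M) V
  rw [Algebra.TensorProduct.tmul_mul_tmul]
  exact tmul_mem_coefIn (hV f hf g) _

theorem mul_mem_dolCompact {x : Dol} (hx : x ∈ DolCompact) (y : Dol) : x * y ∈ DolCompact :=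
  mul_mem_coefIn_of_ideal (V := CompactSmooth)
    (fun f hf _ => HasCompactSupport.mul_right (show HasCompactSupport f.1 from hf)) hx y

theorem D_mem_dolCompact (i : Fin 5) {x : Dol} (hx : x ∈ DolCompact) : D i x ∈ DolCompact :=
  coef_mem_coefIn (V := CompactSmooth) (fun _ hf => dz_mem_compactSmooth i hf) hx

theorem integral_D (i : Fin 5) {x : Dol} (hx : x ∈ DolCompact) : integral (D i x) = 0 := by
  rw [integral_eq, topFun_D]
  exact integral_dz i (topFun_mem hx)

theorem integral_add' {x y : Dol} (hx : x ∈ DolCompact) (hy : y ∈ DolCompact) :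
    integral (x + y) = integral x + integral y := by
  rw [integral_eq, integral_eq, integral_eq, map_add,
    ← integral_add (integrable_of_mem (topFun_mem hx)) (integrable_of_mem (topFun_mem hy))]
  rfl

theorem integral_smul' (c : ℂ) (x : Dol) : integral (c • x) = c * integral x := by
  rw [integral_eq, integral_eq, map_smul, ← integral_const_mul]
  rfl

/-- A linear functional on all forms that is the integral on forms with compact support. -/
theorem exists_linear_integral : ∃ I : Dol →ₗ[ℂ] ℂ, ∀ x ∈ DolCompact, I x = integral x := by
  obtain ⟨I, hI⟩ := LinearMap.exists_extend (p := DolCompact)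
    { toFun := fun x : DolCompact => integral x.1
      map_add' := fun x y => integral_add' x.2 y.2
      map_smul' := fun c x => integral_smul' c x.1 }
  exact ⟨I, fun x hx => congrArg (fun T => T ⟨x, hx⟩) hI⟩

theorem byParts_of_integral {I : Dol →ₗ[ℂ] ℂ} (hI : ∀ x ∈ DolCompact, I x = integral x) :
    ByParts D DolCompact I where
  comm := D_comm
  leibniz := D_mul
  stable i _ hx := D_mem_dolCompact i hx
  parts i c hc y := by
    have h1 := integral_D i (mul_mem_dolCompact hc y)
    rw [← hI _ (D_mem_dolCompact i (mul_mem_dolCompact hc y)), D_mul, map_add] at h1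
    exact eq_neg_of_add_eq_zero_left h1

/-! ### Nondegeneracy of the pairing of forms -/

theorem conE_map (i : Fin 5) (y : AntiHol) :
    ExteriorAlgebra.map (LinearMap.id - LinearMap.single ℂ (fun _ : Fin 5 => ℂ) i ∘ₗ LinearMap.proj i)
      y = y - dzb i * conE i y ∧
    ExteriorAlgebra.map (LinearMap.id - LinearMap.single ℂ (fun _ : Fin 5 => ℂ) i ∘ₗ LinearMap.proj i)
      (conE i y) = conE i y := by
  set P := LinearMap.id - LinearMap.single ℂ (fun _ : Fin 5 => ℂ) i ∘ₗ LinearMap.proj i with hP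
  have hPk : ∀ k, ExteriorAlgebra.map P (dzb k) = if i = k then 0 else dzb k := by
    intro k
    rw [dzb, ExteriorAlgebra.map_apply_ι]
    split_ifs with hk
    · subst hk
      rw [← map_zero (ExteriorAlgebra.ι ℂ)]
      congr 1
      simp [hP]
    · congr 1
      simp [hP, hk]
  induction y using antiHol_induction with
  | algebraMap r =>
    have h0 : conE i (algebraMap ℂ AntiHol r) = 0 := con_algebraMap _ r
    rw [h0, mul_zero, sub_zero, AlgHom.commutes, map_zero]
    exact ⟨rfl, rfl⟩
  | add x y hx hy =>
    rw [map_add, map_add, hx.1, hy.1, map_add, hx.2, hy.2, mul_add]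
    exact ⟨by abel, rfl⟩
  | smul r x hx =>
    rw [map_smul, map_smul, map_smul, hx.1, hx.2, mul_smul_comm, smul_sub]
    exact ⟨rfl, rfl⟩
  | dzb_mul k x hx =>
    rw [map_mul, hPk, conE_dzb_mul, map_sub, map_mul, hPk, hx.2]
    split_ifs with hk
    · subst hk
      rw [zero_mul, zero_mul, hx.1, mul_sub, dzb_sq, sub_zero, sub_zero, sub_self]
      exact ⟨rfl, rfl⟩
    · rw [hx.1, map_zero, zero_sub, mul_neg, mul_sub, dzb_mul_dzb i k]
      exact ⟨by abel, rfl⟩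

theorem topCoeff_conE (i : Fin 5) (y : AntiHol) : topCoeff (conE i y) = 0 := by
  rw [← (conE_map i y).2]
  generalize conE i y = u
  have h : topCoeff ∘ₗ (ExteriorAlgebra.map (LinearMap.id
      - LinearMap.single ℂ (fun _ : Fin 5 => ℂ) i ∘ₗ LinearMap.proj i)).toLinearMap = 0 := by
    refine ExteriorAlgebra.lhom_ext fun n => ?_
    ext v
    simp only [LinearMap.compAlternatingMap_apply, LinearMap.comp_apply, AlgHom.toLinearMap_apply,
      ExteriorAlgebra.map_apply_ιMulti, topCoeff, ExteriorAlgebra.liftAlternating_apply_ιMulti]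
    match n with
    | 0 | 1 | 2 | 3 | 4 => rfl
    | (n + 6) => rfl
    | 5 =>
      change (Pi.basisFun ℂ (Fin 5)).det _ = 0
      rw [Module.Basis.det_apply]
      refine Matrix.det_eq_zero_of_row_eq_zero i fun j => ?_
      simp [Module.Basis.toMatrix_apply]
  exact congrArg (fun T => T u) h

/-- The wedge product followed by the coefficient of `dz̄¹ ⋯ dz̄⁵` is a nondegenerate pairing.
The radical is stable under contractions and contains no constants. -/
theorem eq_zero_of_topCoeff (x : AntiHol) (hx : ∀ w, topCoeff (w * x) = 0) : x = 0 := by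
  have hcon : ∀ (i : Fin 5) (y : AntiHol), (∀ w, topCoeff (w * y) = 0) →
      ∀ w, topCoeff (w * conE i y) = 0 := by
    intro i y hy w
    have h1 : conE i (invol w * y) = conE i (invol w) * y + w * conE i y := by
      have := con_mul (LinearMap.proj i : Module.Dual ℂ (Fin 5 → ℂ)) (invol w) y
      rw [invol_invol] at this
      exact this
    have h2 := topCoeff_conE i (invol w * y)
    rw [h1, map_add, hy, zero_add] at h2
    exact h2
  have key : ∀ m ≤ 5, ∀ y : AntiHol, (∀ w, topCoeff (w * y) = 0) →
      (∀ i : Fin 5, m ≤ i.val → conE i y = 0) → y = 0 := by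
    intro m
    induction m with
    | zero =>
      intro _ y hy h
      have h1 := eq_const_of_conE y (fun i => h i (Nat.zero_le _))
      generalize ExteriorAlgebra.algebraMapInv y = r at h1
      have h2 := hy (ExteriorAlgebra.ιMulti ℂ 5 (fun i : Fin 5 => Pi.single i (1 : ℂ)))
      rw [h1, ← Algebra.commutes, ← Algebra.smul_def, map_smul, topCoeff,
        ExteriorAlgebra.liftAlternating_apply_ιMulti] at h2
      have h3 : (Pi.basisFun ℂ (Fin 5)).det (fun i : Fin 5 => Pi.single i (1 : ℂ)) = 1 := by
        have h4 := (Pi.basisFun ℂ (Fin 5)).det_self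
        convert h4 using 2
        funext i
        exact (Pi.basisFun_apply ℂ (Fin 5) i).symm
      change r • (Pi.basisFun ℂ (Fin 5)).det _ = 0 at h2
      rw [h3, smul_eq_mul, mul_one] at h2
      rw [h1, h2, map_zero]
    | succ m ih =>
      intro hm y hy h
      have h0 : conE ⟨m, by omega⟩ y = 0 := by
        refine ih (by omega) _ (hcon _ y hy) fun i hi => ?_
        rcases hi.lt_or_eq with h1 | h1
        · rw [conE, conE, con_con, ← conE, ← conE, h i h1, map_zero, neg_zero]
        · rw [show i = ⟨m, by omega⟩ from Fin.ext h1.symm, conE, con_con_self]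
      refine ih (by omega) y hy fun i hi => ?_
      rcases hi.lt_or_eq with h1 | h1
      · exact h i h1
      · rw [show i = ⟨m, by omega⟩ from Fin.ext h1.symm, h0]
  exact key 5 le_rfl x hx fun i hi => absurd i.isLt (by omega)

/-- The integral of products with forms of compact support detects zero. -/
theorem eq_zero_of_integral (x : Dol) (hx : ∀ c ∈ DolCompact, integral (c * x) = 0) : x = 0 := by
  refine ev_ext fun z => ?_
  rw [map_zero]
  refine eq_zero_of_topCoeff _ fun w => ?_
  obtain ⟨g, hg⟩ : ∃ g, g = topFun ((1 : Smooth) ⊗ₜ[ℂ] w * x) := ⟨_, rfl⟩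
  have hgz : g.1 z = topCoeff (w * ev z x) := by
    rw [hg, topFun_apply, ev_mul, ev_tmul]
    congr 2
    exact one_smul ℂ w
  rw [← hgz]
  have hcont : Continuous g.1 := (smooth_contDiff g).continuous
  have hae : ∀ᵐ y, g.1 y = 0 := by
    refine ae_eq_zero_of_integral_contDiff_smul_eq_zero hcont.locallyIntegrable fun f hf hfc => ?_
    let f' : Smooth := ⟨fun y => (f y : ℂ), Complex.ofRealCLM.contDiff.comp hf⟩
    have hf' : HasCompactSupport f'.1 := hfc.comp_left (g := Complex.ofReal) Complex.ofReal_zero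
    have h1 := hx (f' ⊗ₜ[ℂ] w) (Submodule.subset_span ⟨f', w, hf', rfl⟩)
    rw [integral_eq] at h1
    rw [← h1]
    congr 1
    funext y
    have h2 : (1 : Smooth).1 y • w = w := one_smul ℂ w
    rw [hg, topFun_apply, topFun_apply, ev_mul, ev_mul, ev_tmul, ev_tmul, h2, smul_mul_assoc,
      map_smul]
    rfl
  exact congrFun ((hcont.ae_eq_iff_eq volume (continuous_const (y := (0 : ℂ)))).1 hae) z

/-! ### The BV bracket -/

theorem sum_perm_three {Q : Type} [AddCommGroup Q] (f : Fin 3 → Fin 3 → Fin 3 → Q) :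
    ∑ σ : Equiv.Perm (Fin 3), (Equiv.Perm.sign σ : ℤ) • f (σ 0) (σ 1) (σ 2)
      = f 0 1 2 - f 0 2 1 - f 1 0 2 + f 1 2 0 + f 2 0 1 - f 2 1 0 := by
  rw [← Equiv.sum_comp Equiv.Perm.decomposeFin.symm, Fintype.sum_prod_type, Fin.sum_univ_three]
  have h2 : (Finset.univ : Finset (Equiv.Perm (Fin 2))) = {1, Equiv.swap 0 1} := by decide
  have hne : (1 : Equiv.Perm (Fin 2)) ≠ Equiv.swap 0 1 := by decide
  have hs : ∀ (p : Fin 3) (e : Equiv.Perm (Fin 2)) (s : ℤ) (a b c : Fin 3),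
      (Equiv.Perm.sign (Equiv.Perm.decomposeFin.symm (p, e)) : ℤ) = s →
      Equiv.Perm.decomposeFin.symm (p, e) 0 = a → Equiv.Perm.decomposeFin.symm (p, e) 1 = b →
      Equiv.Perm.decomposeFin.symm (p, e) 2 = c →
      (Equiv.Perm.sign (Equiv.Perm.decomposeFin.symm (p, e)) : ℤ) •
        f (Equiv.Perm.decomposeFin.symm (p, e) 0) (Equiv.Perm.decomposeFin.symm (p, e) 1)
          (Equiv.Perm.decomposeFin.symm (p, e) 2) = s • f a b c := by
    rintro p e s a b c rfl rfl rfl rfl; rfl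
  simp only [h2, Finset.sum_insert (Finset.notMem_singleton.2 hne), Finset.sum_singleton]
  rw [hs 0 1 1 0 1 2 (by decide) (by decide) (by decide) (by decide),
    hs 0 (Equiv.swap 0 1) (-1) 0 2 1 (by decide) (by decide) (by decide) (by decide),
    hs 1 1 (-1) 1 0 2 (by decide) (by decide) (by decide) (by decide),
    hs 1 (Equiv.swap 0 1) 1 1 2 0 (by decide) (by decide) (by decide) (by decide),
    hs 2 1 (-1) 2 1 0 (by decide) (by decide) (by decide) (by decide),
    hs 2 (Equiv.swap 0 1) 1 2 0 1 (by decide) (by decide) (by decide) (by decide)]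
  simp only [one_smul, neg_smul]
  abel

theorem polar_eq (T₀ T₁ T₂ : RawField →ₗ[ℂ] Dol) (x y z : RawField) :
    polar ![T₀, T₁, T₂] ![x, y, z] = T₀ x * T₁ y * T₂ z - T₀ x * T₂ y * T₁ z - T₁ x * T₀ y * T₂ z
      + T₁ x * T₂ y * T₀ z + T₂ x * T₀ y * T₁ z - T₂ x * T₁ y * T₀ z :=
  sum_perm_three fun i j k => ![T₀, T₁, T₂] i x * ![T₀, T₁, T₂] j y * ![T₀, T₁, T₂] k z

theorem polar_mem (T : Fin 3 → RawField →ₗ[ℂ] Dol) (φ : Fin 3 → RawField)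
    (h : ∀ i, T i (φ 0) ∈ DolCompact) : polar T φ ∈ DolCompact :=
  Submodule.sum_mem _ fun _ _ => zsmul_mem (mul_mem_dolCompact (mul_mem_dolCompact (h _) _) _) _

theorem field_mu_mem (v : Variation) (i : Fin 5) : cMu i v.field ∈ DolCompact := by
  change ∑ j, D j (v.b i j) ∈ DolCompact
  exact Submodule.sum_mem _ fun j _ => D_mem_dolCompact j (v.b_compact i j)

theorem field_om_mem (v : Variation) (i j : Fin 5) : cOm i j v.field ∈ DolCompact :=
  Submodule.sub_mem _ (D_mem_dolCompact i (v.γ_compact j)) (D_mem_dolCompact j (v.γ_compact i))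

theorem cubicLagrangian_mem (κ : ℂ) (v : Variation) (φ ψ : RawField) :
    cubicLagrangian κ ![v.field, φ, ψ] ∈ DolCompact := by
  refine Submodule.add_mem _ (Submodule.add_mem _ (Submodule.add_mem _ ?_ ?_) ?_) ?_ <;>
    refine Submodule.smul_mem _ _ (Submodule.sum_mem _ fun i _ => Submodule.sum_mem _ fun j _ => ?_)
  · refine Submodule.sum_mem _ fun k _ => polar_mem _ _ fun l => ?_
    fin_cases l <;> exact v.a_compact _ _
  · refine Submodule.sum_mem _ fun k _ => polar_mem _ _ fun l => ?_
    fin_cases l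
    · exact field_mu_mem v _
    · exact v.a_compact _ _
    · exact D_mem_dolCompact _ (v.a_compact _ _)
  · refine polar_mem _ _ fun l => ?_
    fin_cases l
    · exact field_om_mem v _ _
    · exact field_mu_mem v _
    · exact field_mu_mem v _
  · refine Submodule.sum_mem _ fun k _ => polar_mem _ _ fun l => ?_
    fin_cases l
    · exact field_mu_mem v _
    · exact D_mem_dolCompact _ (field_mu_mem v _)
    · exact D_mem_dolCompact _ (D_mem_dolCompact _ (field_mu_mem v _))

theorem pairing_mem (v : Variation) (φ : RawField) : v.pairing φ ∈ DolCompact := by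
  refine Submodule.add_mem _ (Submodule.add_mem _ (Submodule.smul_mem _ _ ?_) ?_) ?_
  · exact Submodule.sum_mem _ fun i _ => Submodule.sum_mem _ fun j _ =>
      mul_mem_dolCompact (v.b_compact i j) _
  · exact Submodule.sum_mem _ fun i _ => mul_mem_dolCompact (v.γ_compact i) _
  · exact Submodule.sum_mem _ fun i _ => Submodule.sum_mem _ fun j _ =>
      mul_mem_dolCompact (v.a_compact i j) _

section

variable {I : Dol →ₗ[ℂ] ℂ} (hB : ByParts D DolCompact I) (v : Variation) (φ ψ : Fields)
include hB

theorem variation_cubicLagrangian :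
    I (cubicLagrangian (1 / 3) ![v.field, φ.1, ψ.1])
      = I (∑ i, v.field.1 i * brTheta D D (LinearMap.mul ℂ Dol) φ.1 ψ.1 i)
        + I (∑ j, v.γ j * brMu D D (LinearMap.mul ℂ Dol) φ.1 ψ.1 j)
        + I (∑ i, ∑ j, v.a i j * brA D D (LinearMap.mul ℂ Dol) φ.1 ψ.1 j i) := by
  have hm : ∀ i, v.field.1 i ∈ DolCompact := field_mu_mem v
  have e1 := sum_matrix_cubic v.a φ.1.2.2 ψ.1.2.2 φ.2.2.2.2 ψ.2.2.2.2
  have e2 := hB.variation_gauge (p := φ.1.1) (q := ψ.1.1) φ.2.1 ψ.2.1 v.a φ.1.2.2 ψ.1.2.2 v.field.1 v.a_compact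
  have e3 := hB.variation_contraction (p := φ.1.1) (q := ψ.1.1) φ.2.1 ψ.2.1 φ.1.2.1 ψ.1.2.1 φ.2.2.1 ψ.2.2.1 v.field.1 v.γ
    v.γ_compact
  have e4 := hB.variation_anomaly (p := φ.1.1) (q := ψ.1.1) φ.2.1 ψ.2.1 v.field.1 hm
  have f1 : I (∑ i, v.field.1 i * brTheta D D (LinearMap.mul ℂ Dol) φ.1 ψ.1 i)
      = I (∑ i, v.field.1 i * ∑ k, (φ.1.1 k * ψ.1.2.1 i k - φ.1.2.1 i k * ψ.1.1 k))
        + (1 / 2 : ℂ) • I (∑ i, v.field.1 i * ∑ j, ∑ k,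
          (φ.1.2.2 j k * D i (ψ.1.2.2 k j) - D i (φ.1.2.2 k j) * ψ.1.2.2 j k))
        + I (∑ i, v.field.1 i * ∑ j, ∑ l, (D l (φ.1.1 j) * D i (D j (ψ.1.1 l))
          - D i (D j (φ.1.1 l)) * D l (ψ.1.1 j))) := by
    rw [← map_smul, ← map_add, ← map_add, Finset.smul_sum, ← Finset.sum_add_distrib,
      ← Finset.sum_add_distrib]
    congr 1
    refine Finset.sum_congr rfl fun i _ => ?_
    rw [← mul_smul_comm, ← mul_add, ← mul_add]
    rfl
  have f2 : I (∑ i, ∑ j, v.a i j * brA D D (LinearMap.mul ℂ Dol) φ.1 ψ.1 j i)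
      = I (∑ i, ∑ j, v.a i j * ∑ k, (φ.1.2.2 j k * ψ.1.2.2 k i - φ.1.2.2 i k * ψ.1.2.2 k j))
        + I (∑ j, ∑ k, v.a j k * ∑ i, (D i (φ.1.2.2 k j) * ψ.1.1 i
          - φ.1.1 i * D i (ψ.1.2.2 k j))) := by
    have h : ∀ i j, v.a i j * brA D D (LinearMap.mul ℂ Dol) φ.1 ψ.1 j i
        = v.a i j * (∑ k, (φ.1.2.2 j k * ψ.1.2.2 k i - φ.1.2.2 i k * ψ.1.2.2 k j))
          + v.a i j * ∑ k, (D k (φ.1.2.2 j i) * ψ.1.1 k - φ.1.1 k * D k (ψ.1.2.2 j i)) :=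
      fun i j => mul_add (v.a i j) _ _
    simp only [h, Finset.sum_add_distrib]
    exact map_add I _ _
  have g1 : ∑ a, ∑ b, ∑ c, polar ![cA a b, cA b c, cA c a] ![v.field, φ.1, ψ.1]
      = (3 : ℂ) • ∑ i, ∑ j, v.a i j * ∑ k, (φ.1.2.2 j k * ψ.1.2.2 k i - φ.1.2.2 i k * ψ.1.2.2 k j) := by
    rw [← e1]; simp only [polar_eq]; rfl
  rw [cubicLagrangian, g1]
  simp only [polar_eq, map_add, map_smul]
  rw [f1, f2]
  refine (congrArg₂ (· + ·) (congrArg₂ (· + ·) (congrArg _ (congrArg _ e2)) (congrArg _ e3))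
    (congrArg _ e4)).trans ?_
  simp only [brMu, LinearMap.mul_apply']
  module

end

theorem isBVBracket_ell : IsBVBracket (1 / 3) ell := by
  intro v φ ψ
  obtain ⟨I, hI⟩ := exists_linear_integral
  have hB := byParts_of_integral hI
  rw [← hI _ (cubicLagrangian_mem _ v _ _), ← hI _ (pairing_mem v _),
    variation_cubicLagrangian hB v φ ψ, Variation.pairing, map_add, map_add]
  congr 2
  exact hB.pairing_curl v.b v.b_compact v.b_skew (brTheta D D (LinearMap.mul ℂ Dol) φ.1 ψ.1)

/-! ### Uniqueness of the BV bracket -/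

/-- The skew-symmetric matrix with entries `c` and `-c` in the places `(i, j)` and `(j, i)`. -/
noncomputable def skewUnit {n : ℕ} (i j : Fin n) (c : Dol) (k l : Fin n) : Dol :=
  (if k = i then if l = j then c else 0 else 0) - if k = j then if l = i then c else 0 else 0

theorem skewUnit_skew {n : ℕ} (i j : Fin n) (c : Dol) (k l : Fin n) :
    skewUnit i j c k l = -skewUnit i j c l k := by
  unfold skewUnit
  split_ifs <;> simp

theorem skewUnit_mem {n : ℕ} (i j : Fin n) {c : Dol} (hc : c ∈ DolCompact) (k l : Fin n) :
    skewUnit i j c k l ∈ DolCompact := by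
  unfold skewUnit
  refine Submodule.sub_mem _ ?_ ?_ <;> split_ifs <;>
    first | exact hc | exact Submodule.zero_mem _

theorem sum_skewUnit_mul {n : ℕ} (i j : Fin n) (c : Dol) (x : Fin n → Fin n → Dol) :
    ∑ k, ∑ l, skewUnit i j c k l * x k l = c * x i j - c * x j i := by
  simp only [skewUnit, sub_mul, ite_mul, zero_mul, Finset.sum_sub_distrib, Finset.sum_ite_irrel,
    Finset.sum_const_zero, Finset.sum_ite_eq', Finset.mem_univ, if_true]

theorem pairing_sub (v : Variation) (φ ψ : RawField) :
    v.pairing (φ - ψ) = v.pairing φ - v.pairing ψ := by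
  simp only [Variation.pairing, map_sub, mul_sub, Finset.sum_sub_distrib, smul_sub]
  abel

/-- The pairing with compactly supported variations detects zero. -/
theorem eq_zero_of_pairing (χ : Fields) (h : ∀ v : Variation, integral (v.pairing χ.1) = 0) :
    χ = 0 := by
  -- each component is tested with a variation that has a single potential
  have hmu : ∀ i, cMu i χ.1 = 0 := fun i => by
    refine eq_zero_of_integral _ fun c hc => ?_
    have h1 := h ⟨0, fun k => if k = i then c else 0, 0, by simp, by simp,
      fun _ _ => Submodule.zero_mem _, fun k => by
        split_ifs
        · exact hc
        · exact Submodule.zero_mem _, fun _ _ => Submodule.zero_mem _⟩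
    simpa [Variation.pairing] using h1
  have hom : ∀ i j, cOm i j χ.1 = 0 := fun i j => by
    refine eq_zero_of_integral _ fun c hc => ?_
    have h1 := h ⟨skewUnit i j c, 0, 0, skewUnit_skew i j c, by simp, skewUnit_mem i j hc,
      fun _ => Submodule.zero_mem _, fun _ _ => Submodule.zero_mem _⟩
    have h2 : (1 / 2 : ℂ) • (c * cOm i j χ.1 - c * cOm j i χ.1) = c * cOm i j χ.1 := by
      rw [χ.2.2.1 j i, mul_neg, sub_neg_eq_add, ← two_smul ℂ, smul_smul]
      norm_num
    simp only [Variation.pairing, sum_skewUnit_mul i j c (fun k l => cOm k l χ.1), h2] at h1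
    simpa using h1
  have hA : ∀ a b, cA a b χ.1 = 0 := fun a b => by
    refine eq_zero_of_integral _ fun c hc => ?_
    have h1 := h ⟨0, 0, skewUnit a b c, by simp, skewUnit_skew a b c,
      fun _ _ => Submodule.zero_mem _, fun _ => Submodule.zero_mem _, skewUnit_mem a b hc⟩
    have h2 : c * cA b a χ.1 - c * cA a b χ.1 = (-2 : ℂ) • (c * cA a b χ.1) := by
      rw [χ.2.2.2.2 b a, mul_neg]
      module
    simp only [Variation.pairing, sum_skewUnit_mul a b c (fun k l => cA l k χ.1), h2] at h1
    have h3 : integral ((-2 : ℂ) • (c * cA a b χ.1)) = 0 := by simpa using h1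
    rw [integral_smul'] at h3
    exact (mul_eq_zero.1 h3).resolve_left (by norm_num)
  exact Subtype.ext (Prod.ext (funext hmu) (Prod.ext (funext fun i => funext fun j => hom i j)
    (funext fun a => funext fun b => hA a b)))

theorem isBVBracket_unique {κ : ℂ} {l l' : Fields →ₗ[ℂ] Fields →ₗ[ℂ] Fields}
    (h : IsBVBracket κ l) (h' : IsBVBracket κ l') : l' = l := by
  refine LinearMap.ext fun φ => LinearMap.ext fun ψ => ?_
  rw [← sub_eq_zero]
  refine eq_zero_of_pairing _ fun v => ?_
  obtain ⟨I, hI⟩ := exists_linear_integral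
  change integral (v.pairing ((l' φ ψ).1 - (l φ ψ).1)) = 0
  rw [← hI _ (pairing_mem v _), pairing_sub, map_sub, hI _ (pairing_mem v _),
    hI _ (pairing_mem v _), ← h v φ ψ, ← h' v φ ψ, sub_self]

/-! ### Cohomology of the components -/

open PartialDerivatives

/-- `ρ` identifies the algebra `F` with the holomorphic functions in the algebra `V` of smooth
functions, compatibly with the partial derivatives. -/
structure IsHolPart {F : Type} [CommRing F] [Algebra ℂ F] [PartialDerivatives F]
    (V : Subalgebra ℂ Smooth) (ρ : F →ₐ[ℂ] Smooth) : Prop where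
  solvable : Solvable (Subalgebra.toSubmodule V)
  injective : ∀ f, ρ f = 0 → f = 0
  dz_apply : ∀ i f, dz i (ρ f) = ρ (pd i f)
  mem_range : ∀ f, (∃ p, ρ p = f) ↔ f ∈ V ∧ ∀ k, dzbar k f = 0

/-- Forms with coefficients in the algebra `V` of smooth functions. -/
noncomputable abbrev formsIn (V : Subalgebra ℂ Smooth) : Submodule ℂ Dol :=
  coefIn (M := Fin 5 → ℂ) (Subalgebra.toSubmodule V)

section Components

variable {F : Type} [CommRing F] [Algebra ℂ F]

/-- Functions as `(0, 0)`-forms. -/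
noncomputable def formOf (ρ : F →ₐ[ℂ] Smooth) : F →ₗ[ℂ] Dol :=
  (TensorProduct.mk ℂ Smooth AntiHol).flip 1 ∘ₗ ρ.toLinearMap

variable {V : Subalgebra ℂ Smooth} {ρ : F →ₐ[ℂ] Smooth}

theorem formOf_apply (f : F) : formOf ρ f = ρ f ⊗ₜ[ℂ] 1 := rfl

theorem cst_formOf (f : F) : cst (formOf ρ f) = ρ f := cst_tmul_one _

theorem formOf_mul (f g : F) : formOf ρ f * formOf ρ g = formOf ρ (f * g) := by
  rw [formOf_apply, formOf_apply, Algebra.TensorProduct.tmul_mul_tmul, ← map_mul, one_mul,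
    formOf_apply]

theorem par_formOf (f : F) : par (formOf ρ f) = formOf ρ f := by
  rw [formOf_apply, par_eq, spar_tmul, map_one]

namespace IsHolPart

variable [PartialDerivatives F] (h : IsHolPart V ρ)
include h

theorem D_formOf (i : Fin 5) (f : F) : D i (formOf ρ f) = formOf ρ (pdL F i f) := by
  rw [formOf_apply, formOf_apply, pdL_apply, ← h.dz_apply]; rfl

theorem formOf_mem (f : F) : formOf ρ f ∈ formsIn V :=
  tmul_mem_coefIn ((h.mem_range _).1 ⟨f, rfl⟩).1 1

theorem dbar_formOf (f : F) : dbar (formOf ρ f) = 0 := by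
  rw [dbar_eq]
  refine Finset.sum_eq_zero fun k _ => ?_
  have h1 : cwir (Sum.inr k) (formOf ρ f) = dzbar k (ρ f) ⊗ₜ[ℂ] (1 : AntiHol) := rfl
  rw [h1, ((h.mem_range _).1 ⟨f, rfl⟩).2 k, TensorProduct.zero_tmul, map_zero]

theorem D_mem (i : Fin 5) {x : Dol} (hx : x ∈ formsIn V) : D i x ∈ formsIn V :=
  h.solvable.cwir_mem (Sum.inl i) hx

theorem dbar_mem {x : Dol} (hx : x ∈ formsIn V) : dbar x ∈ formsIn V := by
  rw [dbar_eq]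
  exact Submodule.sum_mem _ fun k _ => extn_mem_coefIn _ (h.solvable.cwir_mem (Sum.inr k) hx)

/-- Antiderivatives in the algebra of functions `F`. -/
theorem exists_pd_eq (k : Fin 5) (f : F) :
    ∃ g, pdL F k g = f ∧ ∀ l ≠ k, pdL F l f = 0 → pdL F l g = 0 := by
  obtain ⟨g, hgV, hg, hg'⟩ := h.solvable.solve (Sum.inl k) (ρ f) ((h.mem_range _).1 ⟨f, rfl⟩).1
  obtain ⟨q, rfl⟩ := (h.mem_range g).2
    ⟨hgV, fun l => hg' (Sum.inr l) (by simp) (((h.mem_range _).1 ⟨f, rfl⟩).2 l)⟩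
  refine ⟨q, ?_, fun l hl hf => h.injective _ ?_⟩
  · rw [← sub_eq_zero]
    refine h.injective _ ?_
    rw [map_sub, pdL_apply, ← h.dz_apply]
    exact sub_eq_zero.2 hg
  · rw [pdL_apply, ← h.dz_apply]
    refine hg' (Sum.inl l) (by simpa using hl) ?_
    change dz l (ρ f) = 0
    rw [h.dz_apply, ← pdL_apply, hf, map_zero]

theorem exists_of_curl_eq_zero (w : Fin 5 → F) (hw : curl F w = 0) : ∃ f, gradient F f = w := by
  obtain ⟨f, -, hf⟩ := poincare_one (T := pdL F) (S := ⊤) pd_comm (fun _ _ _ => Submodule.mem_top)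
    (fun m u _ hu => by
      obtain ⟨g, hg, hg'⟩ := h.exists_pd_eq m u
      exact ⟨g, Submodule.mem_top, hg, fun i hi => hg' i hi.ne (hu i hi)⟩)
    w (fun _ => Submodule.mem_top)
    (fun i j => sub_eq_zero.1 (congrFun (congrFun hw i) j))
  exact ⟨f, funext hf⟩

/-- Closed forms are functions in `F` up to exact forms. -/
theorem exists_dbar_add {x : Dol} (hx : x ∈ formsIn V) (hd : dbar x = 0) :
    ∃ y ∈ formsIn V, ∃ f : F, x = dbar y + formOf ρ f := by
  obtain ⟨y, hy, -, f, hfV, hf, -, e⟩ := h.solvable.dolbeault ∅ hx (by simp) hd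
  obtain ⟨p, rfl⟩ := (h.mem_range f).2 ⟨hfV, hf⟩
  exact ⟨y, hy, p, e⟩

theorem eq_zero_of_dbar_add {y : Dol} {f : F} (e : dbar y + formOf ρ f = 0) : f = 0 := by
  have h1 := congrArg cst e
  rw [map_add, cst_dbar, zero_add, cst_formOf, map_zero] at h1
  exact h.injective _ h1

/-- Closed divergence-free vector fields are holomorphic up to the boundaries of divergence-free
vector fields. -/
theorem exists_vec (u : Fin 5 → Dol) (hu : ∀ i, u i ∈ formsIn V) (hdiv : ∑ i, D i (u i) = 0)
    (hd : ∀ i, dbar (u i) = 0) :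
    ∃ n : Fin 5 → Dol, (∀ i, n i ∈ formsIn V) ∧ ∑ i, D i (n i) = 0 ∧
      ∃ f : Fin 5 → F, ∑ i, pdL F i (f i) = 0 ∧ ∀ i, u i = dbar (n i) + formOf ρ (f i) := by
  choose n hn f e using fun i => h.exists_dbar_add (hu i) (hd i)
  have hsum : dbar (∑ i, D i (n i)) + formOf ρ (∑ i, pdL F i (f i)) = 0 := by
    rw [map_sum, map_sum, ← Finset.sum_add_distrib, ← hdiv]
    refine Finset.sum_congr rfl fun i _ => ?_
    rw [e i, map_add, D_dbar, h.D_formOf]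
  have hf := h.eq_zero_of_dbar_add hsum
  rw [hf, map_zero, add_zero] at hsum
  -- the divergence of `n` is closed; a closed vector field `t ∂_0` with that divergence corrects it
  obtain ⟨r, hr, g, hg⟩ := h.exists_dbar_add
    (Submodule.sum_mem _ fun i _ => h.D_mem i (hn i)) hsum
  obtain ⟨s, hs, hs', -⟩ := h.solvable.solve_form (Sum.inl 0) hr
  have hs0 : D 0 s = r := hs'
  obtain ⟨k, hk, -⟩ := h.exists_pd_eq 0 g
  obtain ⟨t, ht⟩ : ∃ t, t = dbar s + formOf ρ k := ⟨_, rfl⟩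
  have htm : t ∈ formsIn V := by
    rw [ht]; exact Submodule.add_mem _ (h.dbar_mem hs) (h.formOf_mem k)
  have htd : dbar t = 0 := by rw [ht, map_add, dbar_dbar, h.dbar_formOf, add_zero]
  have htD : D 0 t = ∑ i, D i (n i) := by
    rw [ht, map_add, D_dbar, h.D_formOf, hk, hs0, hg]
  refine ⟨fun i => n i - if i = 0 then t else 0, fun i => ?_, ?_, f, hf, fun i => ?_⟩
  · refine Submodule.sub_mem _ (hn i) ?_
    split_ifs
    · exact htm
    · exact Submodule.zero_mem _
  · simp only [map_sub, Finset.sum_sub_distrib]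
    rw [← htD, Finset.sum_eq_single (0 : Fin 5) (fun i _ hi => by rw [if_neg hi, map_zero])
      (fun hi => absurd (Finset.mem_univ _) hi), if_pos rfl, sub_self]
  · rw [e i, map_sub]
    have h0 : dbar (if i = 0 then t else 0) = 0 := by
      split_ifs
      · exact htd
      · exact map_zero _
    rw [h0, sub_zero]

/-- Closed `∂`-closed two-forms are differentials of holomorphic one-forms up to the boundaries
of `∂`-closed two-forms. -/
theorem exists_twoForm (w : Fin 5 → Fin 5 → Dol) (hwm : ∀ i j, w i j ∈ formsIn V)
    (hskew : ∀ i j, w i j = -w j i)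
    (hw : ∀ i j k, D i (w j k) + D j (w k i) + D k (w i j) = 0)
    (hd : ∀ i j, dbar (w i j) = 0) :
    ∃ n : Fin 5 → Dol, (∀ i, n i ∈ formsIn V) ∧ ∃ f : Fin 5 → F,
      ∀ i j, w i j = dbar (D i (n j) - D j (n i)) + formOf ρ (curl F f i j) := by
  obtain ⟨a, ha, hwa⟩ := h.solvable.poincare_two_form w hwm hskew hw
  -- `∂̄a` is `∂`-closed, and its potential can be chosen `∂̄`-closed
  obtain ⟨b, hb, hba⟩ := h.solvable.poincare_one_form (fun i => dbar (a i))
    (fun i => h.dbar_mem (ha i)) (fun i j => by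
      have h1 := hd i j
      rw [hwa, map_sub, ← D_dbar, ← D_dbar] at h1
      exact sub_eq_zero.1 h1)
  obtain ⟨y, hy, hDy, g, -, -, -, hg⟩ := h.solvable.dolbeault Set.univ (h.dbar_mem hb)
    (fun i _ => by rw [D_dbar, hba i, dbar_dbar]) (dbar_dbar b)
  have hg0 : g = 0 := by
    have h1 := congrArg cst hg
    rw [map_add, cst_dbar, cst_dbar, zero_add, cst_tmul_one] at h1
    exact h1.symm
  rw [hg0, TensorProduct.zero_tmul, add_zero, ← sub_eq_zero, ← map_sub] at hg
  obtain ⟨c, hc, p, hcp⟩ := h.exists_dbar_add (Submodule.sub_mem _ hb hy) hg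
  have hDc : ∀ i, dbar (a i - D i c) = 0 := by
    intro i
    have h1 : dbar (a i - D i c) = formOf ρ (pdL F i p) := by
      rw [map_sub, ← hba i, ← h.D_formOf, sub_eq_iff_eq_add', ← D_dbar, ← map_add, ← hcp, map_sub,
        hDy i (Set.mem_univ i), sub_zero]
    have h2 := congrArg cst h1
    rw [cst_dbar, cst_formOf] at h2
    rw [h1, h.injective _ h2.symm, map_zero]
  choose n hn f e using fun i =>
    h.exists_dbar_add (Submodule.sub_mem _ (ha i) (h.D_mem i hc)) (hDc i)
  refine ⟨n, hn, f, fun i j => ?_⟩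
  have hD : ∀ i j, D i (a j) = D i (D j c) + (dbar (D i (n j)) + formOf ρ (pd i (f j))) := by
    intro i j
    rw [← pdL_apply, ← h.D_formOf, ← D_dbar, ← map_add, ← e j, map_sub, add_sub_cancel]
  rw [hwa, hD i j, hD j i, curl_apply, D_comm j i c, map_sub, map_sub]
  abel

/-- Closed skew-symmetric matrices are holomorphic up to the boundaries of skew-symmetric
matrices. -/
theorem exists_matrix (A : Matrix (Fin 32) (Fin 32) Dol) (hA : ∀ a b, A a b ∈ formsIn V)
    (hskew : ∀ a b, A a b = -A b a) (hd : ∀ a b, dbar (A a b) = 0) :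
    ∃ n : Matrix (Fin 32) (Fin 32) Dol, (∀ a b, n a b ∈ formsIn V) ∧ (∀ a b, n a b = -n b a) ∧
      ∃ f : Matrix (Fin 32) (Fin 32) F, (∀ a b, f a b = -f b a) ∧
        ∀ a b, A a b = dbar (n a b) + formOf ρ (f a b) := by
  choose n hn f e using fun a b => h.exists_dbar_add (hA a b) (hd a b)
  refine ⟨fun a b => (1 / 2 : ℂ) • (n a b - n b a), fun a b => Submodule.smul_mem _ _
    (Submodule.sub_mem _ (hn a b) (hn b a)), fun a b => by rw [← smul_neg, neg_sub],
    fun a b => (1 / 2 : ℂ) • (f a b - f b a), fun a b => by rw [← smul_neg, neg_sub],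
    fun a b => ?_⟩
  rw [map_smul, map_smul, ← smul_add, map_sub, map_sub, sub_add_sub_comm, ← e, ← e, hskew b a,
    sub_neg_eq_add, ← two_smul ℂ, smul_smul]
  norm_num

end IsHolPart

end Components

/-! ### Cohomology of the fields -/

open PartialDerivatives

section RawIn

variable {U U' W : Type} [AddCommGroup U] [Module ℂ U] [AddCommGroup U'] [Module ℂ U']
  [AddCommGroup W] [Module ℂ W]

/-- All components of a triple lie in `S`. -/
def RawIn (S : Submodule ℂ U) (φ : Raw U) : Prop :=
  (∀ i, φ.1 i ∈ S) ∧ (∀ i j, φ.2.1 i j ∈ S) ∧ ∀ a b, φ.2.2 a b ∈ S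

theorem RawIn.rawMap {S : Submodule ℂ U} {S' : Submodule ℂ U'} {f : U →ₗ[ℂ] U'}
    (hf : ∀ u ∈ S, f u ∈ S') {φ : Raw U} (hφ : RawIn S φ) : RawIn S' (rawMap f φ) :=
  ⟨fun i => hf _ (hφ.1 i), fun i j => hf _ (hφ.2.1 i j), fun a b => hf _ (hφ.2.2 a b)⟩

theorem RawIn.rawBr {S : Submodule ℂ U} {DU : Fin 5 → U →ₗ[ℂ] U} {m : U →ₗ[ℂ] U →ₗ[ℂ] U}
    (hD : ∀ i, ∀ u ∈ S, DU i u ∈ S) (hm : ∀ u ∈ S, ∀ v ∈ S, m u v ∈ S) {φ ψ : Raw U}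
    (hφ : RawIn S φ) (hψ : RawIn S ψ) : RawIn S (rawBr DU DU DU m φ ψ) := by
  let DS : Fin 5 → S →ₗ[ℂ] S := fun i => (DU i).restrict (hD i)
  let mS : S →ₗ[ℂ] S →ₗ[ℂ] S := LinearMap.mk₂ ℂ (fun u v => ⟨m u v, hm u u.2 v v.2⟩)
    (fun _ _ _ => Subtype.ext (by simp)) (fun _ _ _ => Subtype.ext (by simp))
    (fun _ _ _ => Subtype.ext (by simp)) (fun _ _ _ => Subtype.ext (by simp))
  let lift : (χ : Raw U) → RawIn S χ → Raw S := fun χ h =>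
    (fun i => ⟨χ.1 i, h.1 i⟩, fun i j => ⟨χ.2.1 i j, h.2.1 i j⟩, fun a b => ⟨χ.2.2 a b, h.2.2 a b⟩)
  have h := rawBr_natural (DU := DS) (DV := DS) (DW := DS) mS (DU' := DU) (DV' := DU) (DW' := DU)
    m (f := S.subtype) (g := S.subtype) (h := S.subtype) (fun _ _ => rfl) (fun _ _ => rfl)
    (fun _ _ => rfl) (fun _ _ => rfl) (lift φ hφ) (lift ψ hψ)
  have h2 : TypeOneHet.rawBr DU DU DU m φ ψ = TypeOneHet.rawMap S.subtype _ := h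
  rw [h2]
  exact ⟨fun _ => Subtype.property _, fun _ _ => Subtype.property _, fun _ _ => Subtype.property _⟩

theorem Constraint.rawMap {DU : Fin 5 → U →ₗ[ℂ] U} {DW : Fin 5 → W →ₗ[ℂ] W} {f : U →ₗ[ℂ] W}
    (hf : ∀ i u, DW i (f u) = f (DU i u)) {φ : Raw U} (hφ : Constraint DU φ) :
    Constraint DW (rawMap f φ) := by
  refine ⟨?_, fun i j => ?_, fun i j k => ?_, fun a b => ?_⟩
  · change ∑ i, DW i (f (φ.1 i)) = 0
    simp only [hf, ← map_sum, hφ.1, map_zero]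
  · change f (φ.2.1 i j) = -f (φ.2.1 j i)
    rw [hφ.2.1 i j, map_neg]
  · change DW i (f (φ.2.1 j k)) + DW j (f (φ.2.1 k i)) + DW k (f (φ.2.1 i j)) = 0
    rw [hf, hf, hf, ← map_add, ← map_add, hφ.2.2.1, map_zero]
  · change f (φ.2.2 a b) = -f (φ.2.2 b a)
    rw [hφ.2.2.2 a b, map_neg]

end RawIn

theorem dolBr_zero_left (ψ : RawField) : dolBr 0 ψ = 0 := by
  have h := rawBr_smul_left D D D (LinearMap.mul ℂ Dol) 0 (0 : RawField) ψ
  rwa [zero_smul, zero_smul] at h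

theorem dolBr_zero_right (φ : RawField) : dolBr φ 0 = 0 := by
  have h := rawBr_smul_right D D D (LinearMap.mul ℂ Dol) 0 φ (0 : RawField)
  rwa [zero_smul, zero_smul] at h

theorem brst_ell_of_right (α ψ : Fields) (hψ : brst ψ = 0) : brst (ell α ψ) = ell (brst α) ψ := by
  refine Subtype.ext ?_
  have h2 : rawMap dbar ψ.1 = 0 := congrArg Subtype.val hψ
  change rawMap dbar (dolBr α.1 ψ.1) = dolBr (rawMap dbar α.1) ψ.1
  rw [dbar_dolBr, h2, dolBr_zero_right, add_zero]

namespace IsHolPart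

variable {F : Type} [CommRing F] [Algebra ℂ F] [PartialDerivatives F]
variable {V : Subalgebra ℂ Smooth} {ρ : F →ₐ[ℂ] Smooth} (h : IsHolPart V ρ)
variable {N : Submodule ℂ Fields} (hN : ∀ φ, φ ∈ N ↔ RawIn (formsIn V) φ.1)
include h

theorem toRaw_eq_zero (x : GHet F) (hx : toRaw x = 0) : x = 0 := by
  obtain ⟨w, hw⟩ := (ExactForms F).mkQ_surjective x.form
  rw [toRaw_apply, ← hw, curlQ_mk] at hx
  obtain ⟨f, hf⟩ := h.exists_of_curl_eq_zero w (congrArg (fun y => y.2.1) hx)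
  have h1 : x.vec = 0 := neg_eq_zero.1 (congrArg Prod.fst hx)
  have h2 : x.form = 0 := by
    rw [← hw]; exact (Submodule.Quotient.mk_eq_zero _).2 ⟨f, hf⟩
  have h3 : x.mat = 0 := congrArg (fun y => y.2.2) hx
  exact Prod.ext (Subtype.ext h1) (Prod.ext h2 (Subtype.ext h3))

/-- The holomorphic field of an element of the heterotic Lie algebra. -/
noncomputable def holField : GHet F →ₗ[ℂ] Fields :=
  LinearMap.codRestrict Fields (rawMap (formOf ρ) ∘ₗ toRaw) fun x =>
    Constraint.rawMap (DW := D) h.D_formOf (toRaw_constraint x)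

theorem holField_val (x : GHet F) : (h.holField x).1 = rawMap (formOf ρ) (toRaw x) := rfl

theorem brst_holField (x : GHet F) : brst (h.holField x) = 0 :=
  Subtype.ext (rawMap_eq_zero (f := dbar ∘ₗ formOf ρ) h.dbar_formOf (toRaw x))

theorem par_holField (x : GHet F) : rawMap par (h.holField x).1 = (h.holField x).1 :=
  Prod.ext (funext fun _ => par_formOf _) (Prod.ext (funext fun _ => funext fun _ => par_formOf _)
    (funext fun _ => funext fun _ => par_formOf _))

theorem ell_holField (x y : GHet F) :
    ell (h.holField x) (h.holField y) = h.holField ⁅x, y⁆ := by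
  refine Subtype.ext ?_
  rw [ell_val, holField_val, holField_val, holField_val, ← rawBr_toRaw]
  exact rawBr_natural (LinearMap.mul ℂ F) (LinearMap.mul ℂ Dol) h.D_formOf h.D_formOf h.D_formOf
    formOf_mul (toRaw x) (toRaw y)

/-- A holomorphic field is determined by its class: taking the constant term in the `dz̄ⁱ`
annihilates boundaries. -/
theorem eq_zero_of_holField (x : GHet F) {ψ : RawField}
    (e : rawMap cst (h.holField x).1 = rawMap cst (rawMap dbar ψ)) : x = 0 := by
  have h1 : rawMap cst (rawMap dbar ψ) = 0 := rawMap_eq_zero (f := cst ∘ₗ dbar) cst_dbar ψ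
  rw [h1, holField_val, rawMap_rawMap] at e
  refine h.toRaw_eq_zero x (rawMap_injective (fun f hf => ?_) _ e)
  exact h.injective f (by rw [← cst_formOf (ρ := ρ)]; exact hf)

theorem brst_ell_holField (x : GHet F) (β : Fields) :
    brst (ell (h.holField x) β) = ell (h.holField x) (brst β) := by
  refine Subtype.ext ?_
  have h2 : rawMap dbar (h.holField x).1 = 0 := congrArg Subtype.val (h.brst_holField x)
  change rawMap dbar (dolBr (h.holField x).1 β.1) = dolBr (h.holField x).1 (rawMap dbar β.1)
  rw [dbar_dolBr, h2, h.par_holField, dolBr_zero_left, zero_add]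

include hN

theorem holField_mem (x : GHet F) : h.holField x ∈ N :=
  (hN _).2 (RawIn.rawMap (S := ⊤) (fun f _ => h.formOf_mem f)
    ⟨fun _ => Submodule.mem_top, fun _ _ => Submodule.mem_top, fun _ _ => Submodule.mem_top⟩)

theorem brst_mem (φ : Fields) (hφ : φ ∈ N) : brst φ ∈ N :=
  (hN _).2 (RawIn.rawMap (fun _ => h.dbar_mem) ((hN _).1 hφ))

theorem ell_mem (φ ψ : Fields) (hφ : φ ∈ N) (hψ : ψ ∈ N) : ell φ ψ ∈ N :=
  (hN _).2 (RawIn.rawBr (fun i _ => h.D_mem i)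
    (fun _ hu _ hv => mul_mem_coefIn (fun _ hf _ hg => V.mul_mem hf hg) hu hv)
    ((hN _).1 hφ) ((hN _).1 hψ))

/-- Every cocycle is a holomorphic field up to a boundary. -/
theorem exists_brst_add (φ : Fields) (hφ : φ ∈ Cocycles N) :
    ∃ ψ ∈ N, ∃ x : GHet F, φ = brst ψ + h.holField x := by
  obtain ⟨hd, hφN⟩ := hφ
  have hd' : rawMap dbar φ.1 = 0 := congrArg Subtype.val hd
  have hm := (hN φ).1 hφN
  obtain ⟨n, hn, hdiv, X, hX, eX⟩ := h.exists_vec φ.1.1 hm.1 φ.2.1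
    (fun i => congrFun (congrArg Prod.fst hd') i)
  obtain ⟨c, hc, w, ew⟩ := h.exists_twoForm φ.1.2.1 hm.2.1 φ.2.2.1 φ.2.2.2.1
    (fun i j => congrFun (congrFun (congrArg (fun x => x.2.1) hd') i) j)
  obtain ⟨B, hB, hBs, α, hα, eα⟩ := h.exists_matrix φ.1.2.2 hm.2.2 φ.2.2.2.2
    (fun i j => congrFun (congrFun (congrArg (fun x => x.2.2) hd') i) j)
  let ψ : RawField := (n, fun i j => D i (c j) - D j (c i), B)
  have hψ : ψ ∈ Fields := by
    refine ⟨hdiv, fun i j => ?_, fun i j k => ?_, hBs⟩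
    · change D i (c j) - D j (c i) = -(D j (c i) - D i (c j))
      rw [neg_sub]
    · change D i (D j (c k) - D k (c j)) + D j (D k (c i) - D i (c k))
        + D k (D i (c j) - D j (c i)) = 0
      simp only [map_sub]
      rw [D_comm i j, D_comm i k, D_comm j k]; abel
  refine ⟨⟨ψ, hψ⟩, (hN _).2 ⟨hn, fun i j => Submodule.sub_mem _ (h.D_mem i (hc j))
    (h.D_mem j (hc i)), hB⟩, (⟨-X, ?_⟩, (ExactForms F).mkQ w, ⟨α, ?_⟩), Subtype.ext ?_⟩
  · rw [mem_vectDiv]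
    simp only [Pi.neg_apply, map_neg, Finset.sum_neg_distrib]
    exact neg_eq_zero.2 hX
  · ext a b; exact hα b a
  · refine Prod.ext (funext fun i => ?_) (Prod.ext (funext fun i => funext fun j => ew i j)
      (funext fun a => funext fun b => eα a b))
    refine (eX i).trans ?_
    change _ = dbar (n i) + formOf ρ ((-(-X)) i)
    rw [neg_neg]

theorem mem_coboundaries_of_odd (φ : Fields) (hφ : φ ∈ Cocycles N) (hp : HasParity 1 φ) :
    φ ∈ Coboundaries N := by
  obtain ⟨ψ, hψ, x, e⟩ := h.exists_brst_add hN φ hφ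
  have h1 : rawMap par φ.1 = -φ.1 := by
    rw [(hasParity_iff 1 φ).1 hp, pow_one, neg_smul, one_smul]
  -- the parity operator fixes the terms of degree zero, so those of an odd field vanish
  have hcp : ∀ χ : RawField, rawMap cst (rawMap par χ) = rawMap cst χ := fun χ =>
    Prod.ext (funext fun _ => cst_par _) (Prod.ext (funext fun _ => funext fun _ => cst_par _)
      (funext fun _ => funext fun _ => cst_par _))
  have h2 : rawMap cst φ.1 = 0 := by
    have h3 := hcp φ.1
    rw [h1, map_neg, neg_eq_iff_add_eq_zero, ← two_smul ℂ] at h3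
    exact (smul_eq_zero.1 h3).resolve_left two_ne_zero
  have hx : x = 0 := by
    refine h.eq_zero_of_holField x (ψ := -ψ.1) ?_
    have h4 : (h.holField x).1 = φ.1 - rawMap dbar ψ.1 := by
      rw [e]; exact (add_sub_cancel_left _ _).symm
    rw [h4, map_sub, h2, zero_sub, map_neg, map_neg]
  rw [hx, map_zero, add_zero] at e
  exact ⟨ψ, hψ, e.symm⟩

theorem ell_mem_cocycles (φ ψ : Cocycles N) : ell φ.1 ψ.1 ∈ Cocycles N := by
  refine ⟨?_, h.ell_mem hN _ _ φ.2.2 ψ.2.2⟩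
  have h1 : brst φ.1 = 0 := φ.2.1
  change brst (ell φ.1 ψ.1) = 0
  rw [brst_ell_of_right _ _ ψ.2.1, h1, map_zero, LinearMap.zero_apply]

/-- The cohomology class of the holomorphic field of an element of the heterotic Lie algebra. -/
noncomputable def classOf : GHet F →ₗ[ℂ] Cohomology N :=
  ((Coboundaries N).submoduleOf (Cocycles N)).mkQ ∘ₗ
    LinearMap.codRestrict (Cocycles N) h.holField
      (fun x => ⟨h.brst_holField x, h.holField_mem hN x⟩)

theorem classOf_eq (φ : Cocycles N) (x : GHet F) (hx : ∃ ψ ∈ N, φ.1 = brst ψ + h.holField x) :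
    h.classOf hN x = Submodule.Quotient.mk φ := by
  obtain ⟨ψ, hψ, e⟩ := hx
  refine ((Submodule.Quotient.eq _).2 ?_).symm
  refine Submodule.mem_comap.2 ?_
  refine Submodule.mem_map.2 ⟨ψ, hψ, ?_⟩
  change brst ψ = φ.1 - h.holField x
  rw [e, add_sub_cancel_right]

theorem classOf_bijective : Function.Bijective (h.classOf hN) := by
  constructor
  · rw [injective_iff_map_eq_zero]
    intro x hx
    obtain ⟨ψ, -, e⟩ := Submodule.mem_map.1
      (Submodule.mem_comap.1 ((Submodule.Quotient.mk_eq_zero _).1 hx))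
    have e' : rawMap dbar ψ.1 = (h.holField x).1 := congrArg Subtype.val e
    exact h.eq_zero_of_holField x (ψ := ψ.1) (by rw [e'])
  · intro c
    obtain ⟨φ, rfl⟩ := Submodule.Quotient.mk_surjective _ c
    obtain ⟨ψ, hψ, x, e⟩ := h.exists_brst_add hN φ.1 φ.2
    exact ⟨x, h.classOf_eq hN φ x ⟨ψ, hψ, e⟩⟩

theorem classOf_symm (φ : Cocycles N) (x : GHet F) (hx : ∃ ψ ∈ N, φ.1 = brst ψ + h.holField x) :
    (LinearEquiv.ofBijective _ (h.classOf_bijective hN)).symm (Submodule.Quotient.mk φ) = x := by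
  rw [LinearEquiv.symm_apply_eq]
  exact (h.classOf_eq hN φ x hx).symm

theorem exists_ell_eq (φ ψ : Cocycles N) {α β : Fields} (hα : α ∈ N) (hβ : β ∈ N) {x y : GHet F}
    (ex : φ.1 = brst α + h.holField x) (ey : ψ.1 = brst β + h.holField y) :
    ∃ χ ∈ N, ell φ.1 ψ.1 = brst χ + h.holField ⁅x, y⁆ := by
  refine ⟨ell α ψ.1 + ell (h.holField x) β, N.add_mem
    (h.ell_mem hN _ _ hα ψ.2.2) (h.ell_mem hN _ _ (h.holField_mem hN x) hβ), ?_⟩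
  have h1 : ell φ.1 ψ.1 = ell (brst α) ψ.1 + ell (h.holField x) ψ.1 := by
    rw [ex]; exact LinearMap.map_add₂ ell _ _ _
  have h2 : ell (h.holField x) ψ.1
      = ell (h.holField x) (brst β) + ell (h.holField x) (h.holField y) := by
    rw [ey]; exact (ell (h.holField x)).map_add _ _
  have h3 := brst.map_add (ell α ψ.1) (ell (h.holField x) β)
  rw [brst_ell_of_right α ψ.1 ψ.2.1, h.brst_ell_holField x β] at h3
  rw [h1, h2, h3, h.ell_holField]
  exact (add_assoc _ _ _).symm

/-- The cohomology of the fields is the heterotic Lie algebra. -/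
theorem cohomologyIsoLie : CohomologyIsoLie ell N (GHet F) := by
  have key : ∀ φ ψ : Cocycles N, ∃ hm : ell φ.1 ψ.1 ∈ Cocycles N,
      (LinearEquiv.ofBijective (h.classOf hN) (h.classOf_bijective hN)).symm
        (Submodule.Quotient.mk ⟨ell φ.1 ψ.1, hm⟩)
      = ⁅(LinearEquiv.ofBijective (h.classOf hN) (h.classOf_bijective hN)).symm
          (Submodule.Quotient.mk φ),
        (LinearEquiv.ofBijective (h.classOf hN) (h.classOf_bijective hN)).symm
          (Submodule.Quotient.mk ψ)⁆ := by
    intro φ ψ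
    obtain ⟨α, hα, x, ex⟩ := h.exists_brst_add hN φ.1 φ.2
    obtain ⟨β, hβ, y, ey⟩ := h.exists_brst_add hN ψ.1 ψ.2
    refine ⟨h.ell_mem_cocycles hN φ ψ, ?_⟩
    rw [h.classOf_symm hN φ x ⟨α, hα, ex⟩, h.classOf_symm hN ψ y ⟨β, hβ, ey⟩]
    exact h.classOf_symm hN ⟨ell φ.1 ψ.1, h.ell_mem_cocycles hN φ ψ⟩ _
      (h.exists_ell_eq hN φ ψ hα hβ ex ey)
  exact ⟨h.brst_mem hN, fun φ hφ ψ hψ => h.ell_mem hN φ ψ hφ hψ, h.mem_coboundaries_of_odd hN,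
    (LinearEquiv.ofBijective (h.classOf hN) (h.classOf_bijective hN)).symm, key⟩

end IsHolPart

/-! ### Entire and polynomial coefficients -/

theorem isHolPart_entire : IsHolPart ⊤ Hol.val where
  solvable := by rw [Algebra.top_toSubmodule]; exact solvable_top
  injective _ hf := Subtype.ext hf
  dz_apply _ _ := rfl
  mem_range f := ⟨fun ⟨p, hp⟩ => ⟨Algebra.mem_top, hp ▸ p.2⟩, fun hf => ⟨⟨f, hf.2⟩, rfl⟩⟩

theorem isHolPart_polynomial : IsHolPart PolySmooth holPoly where
  solvable := solvable_polySmooth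
  injective _ hf := (map_eq_zero_iff _ holPoly_injective).1 hf
  dz_apply := dz_holPoly
  mem_range := mem_range_holPoly

theorem cohomologyIsoLie_entire : CohomologyIsoLie ell ⊤ (GHet Hol) := by
  refine isHolPart_entire.cohomologyIsoLie fun φ => ⟨fun _ => ?_, fun _ => Submodule.mem_top⟩
  have h : ∀ x : Dol, x ∈ formsIn ⊤ := fun x => by
    rw [formsIn, Algebra.top_toSubmodule]; exact mem_coefIn_top x
  exact ⟨fun _ => h _, fun _ _ => h _, fun _ _ => h _⟩

theorem cohomologyIsoLie_polynomial :
    CohomologyIsoLie ell PolyFields (GHet (MvPolynomial (Fin 5) ℂ)) :=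
  isHolPart_polynomial.cohomologyIsoLie fun _ => Iff.rfl

end TypeOneHet

theorem mainTheorem3 :
    ∃ l₂ : TypeOneHet.Fields →ₗ[ℂ] TypeOneHet.Fields →ₗ[ℂ] TypeOneHet.Fields,
      TypeOneHet.IsBVBracket (1 / 3) l₂ ∧
      (∀ l₂' : TypeOneHet.Fields →ₗ[ℂ] TypeOneHet.Fields →ₗ[ℂ] TypeOneHet.Fields,
        TypeOneHet.IsBVBracket (1 / 3) l₂' → l₂' = l₂) ∧
      TypeOneHet.IsDGLie l₂ ∧
      TypeOneHet.CohomologyIsoLie l₂ ⊤ (TypeOneHet.GHet TypeOneHet.Hol) ∧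
      TypeOneHet.CohomologyIsoLie l₂ TypeOneHet.PolyFields
        (TypeOneHet.GHet (MvPolynomial (Fin 5) ℂ)) :=
  ⟨TypeOneHet.ell, TypeOneHet.isBVBracket_ell,
    fun _ h => TypeOneHet.isBVBracket_unique TypeOneHet.isBVBracket_ell h,
    TypeOneHet.isDGLie_ell TypeOneHet.solvable_top, TypeOneHet.cohomologyIsoLie_entire,
    TypeOneHet.cohomologyIsoLie_polynomial⟩
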